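/- **Strings.** For a string $S$, $S[a..b)$ is the fragment $S[a]\cdots S[b-1]$ (as a fragment it is identified with the pair of its end points). A string $Q$ is primitive if $Q\ne U^k$ for all strings $U$ and $k>1$; $Q^\infty$ is its infinite repetition, with characters $Q^\infty[i]=Q[i \bmod |Q|]$, $i\in\mathbb Z$; $\mathrm{rot}(Q)$ moves the last character of $Q$ to the front. An alignment $\mathcal A: X[x..x')\twoheadrightarrow Y[y..y')$ is a sequence of pairs from $(x,y)$ to $(x',y')$ with steps $(+1,+1)$, $(+1,0)$, $(0,+1)$; its cost is the number of its steps other than steps $(+1,+1)$ that align equal characters. $\mathrm{ed}(X,Y)$ is the minimum cost of an alignment of $X$ onto $Y$. $\mathrm{Occ}^E_k(P,T)$ is the set of $v$ with $\mathrm{ed}(P,T[v..w))\le k$ for some $w\in[v,|T|]$. We write $\mathrm{edp}(S,Q)$, $\mathrm{edl}(S,Q)$ and $\mathrm{eds}(S,Q)$ for the minimum edit distance between $S$ and a prefix of $Q^\infty$, a substring of $Q^\infty$, and a substring of $Q^\infty$ ending at a multiple of $|Q|$, respectively. **Instance.** Let $P$ (length $m$) and $T$ (length $n$) be strings, $0\le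 k\le m$, $d>0$, $2k\le d$, $m-k\le n<\lceil\frac32m\rceil+k$; let $Q$ be a primitive string of length $q$ with $8dq\le m$; let $d_P=\mathrm{edl}(P,Q)=\mathrm{edp}(P,Q)\le d$ and $d_T=\mathrm{edl}(T,Q)\le 3d$, with given alignments $\mathcal A_P:P\twoheadrightarrow Q^\infty[0..y_P)$ of cost $d_P$ and $\mathcal A_T:T\twoheadrightarrow Q^\infty[x_T..y_T)$ of cost $d_T$, $0\le x_T<q$. Put $\kappa=k+d_P+d_T$, $\tau=q\lceil\kappa/(2q)\rceil$, $\Delta=6\kappa$, $\beta_P=\lceil y_P/\tau\rceil$, $z=\beta_P-17$, and assume $\kappa>0$ and $\beta_P\ge 20$. **Pieces.** Let $J=\{\lceil (x_T-\kappa)/\tau\rceil,\dots,\lfloor (y_T-y_P+\kappa)/\tau\rfloor\}$. For $j\in J$ let $r_j=\min\{a:(a,b)\in\mathcal A_T,\ b\ge j\tau-\kappa\}$ and $r'_j=\max\{a:(a,b)\in\mathcal A_T,\ b\le j\tau+y_P+\kappa\}$. Let $p_i=m$ if $i\tau\ge y_P$ and $p_i=\min\{a:(a,i\tau)\in\mathcal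 A_P\}$ otherwise ($p_0=0$), and let $t_i$ be defined in the same way from $n$, $y_T$, $\mathcal A_T$ (with $t_i=0$ if $i\tau<y_T$ and no pair $(a,i\tau)$ lies in $\mathcal A_T$). Put $$P_1=P[p_0..p_2+\Delta),\quad P_i=P[p_i..p_{i+1}+\Delta)\ (1<i<z),\quad P_z=P[p_z..m),$$ $$T_{j,1}=T[r_j..t_{j+2}+\Delta),\quad T_{j,i}=T[t_{j+i}..t_{j+i+1}+\Delta)\ (1<i<z),\quad T_{j,z}=T[t_{j+z}..r'_j).$$ Let $\mathcal I_j=(P_1,T_{j,1})\cdots(P_z,T_{j,z})$. Put $\mathrm{val}_\Delta(S_1,\dots,S_\ell)=S_1\cdot S_2[\Delta..|S_2|)\cdots S_\ell[\Delta..|S_\ell|)$, and for a sequence $\mathcal I=(U_1,V_1)\cdots(U_\ell,V_\ell)$ put $\mathrm{Occ}^E_k(\mathcal I)=\mathrm{Occ}^E_k(\mathrm{val}_\Delta(U_1,\dots,U_\ell),\mathrm{val}_\Delta(V_1,\dots,V_\ell))$. **Locked fragments.** A fragment $L$ of $S$ is locked if $\mathrm{edl}(L,Q)=\mathrm{ed}(L,Q^\alpha)$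 for some $\alpha\ge 0$, or $L$ is a suffix of $S$ with $\mathrm{edl}(L,Q)=\mathrm{edp}(L,Q)$, or $L$ is a prefix of $S$ with $\mathrm{edl}(L,Q)=\mathrm{eds}(L,Q)$, or $L=S$. A prefix $L$ of $S$ is $h$-locked if $L=S$, or if for all $p\in[0,q)$ with $\mathrm{edp}(L,\mathrm{rot}^p(Q))\le h$ there is $j\in\mathbb Z$ with $jq\ge -p$ and $\mathrm{edp}(L,\mathrm{rot}^p(Q))=\mathrm{ed}(L,Q^\infty[-p..jq))$. An $h$-locked decomposition of $S$ is a sequence of locked fragments $L_1,\dots,L_\ell$ ($\ell\ge1$) with $S=L_1Q^{\alpha_1}L_2Q^{\alpha_2}\cdots Q^{\alpha_{\ell-1}}L_\ell$ for some $\alpha_i>0$, with $L_1$ an $h$-locked prefix, $\mathrm{edl}(S,Q)=\sum_i\mathrm{edl}(L_i,Q)$, and $\mathrm{edl}(L_i,Q)>0$ for $1<i<\ell$. Let $\mathcal L^P$ be a $2d$-locked decomposition of $P$ and $\mathcal L^T$ a $0$-locked decomposition of $T$ whose last fragment is non-empty. **Trimming.** An internal piece $P_i$, $1<i<z$, is red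 if $P_i\ne Q^\infty[0..\tau+\Delta)$ or if $[p_i..p_{i+1}+\Delta)$ meets $[\ell-91d..r+91d)$ for some $P[\ell..r)\in\mathcal L^P$. An internal piece $T[t_i..t_{i+1}+\Delta)$, $\min J+1<i<\max J+z$, is red if it is different from $Q^\infty[0..\tau+\Delta)$ or if $[t_i..t_{i+1}+\Delta)$ meets $[\ell-91d..r+91d)$ for some $T[\ell..r)\in\mathcal L^T$. A pair $(P_i,T_{j,i})$ is plain if $1<i<z$ and neither component is red. Let $\eta$ be an integer with $1\le\eta\le d$ (for instance $\eta=\max\{1,\lfloor\sqrt d/\sqrt{\log(n+1)\log(d+1)}\rfloor\}$, up to the base of the logarithms, as long as it is at most $d$). Let $\mathcal I'_j$ be obtained from $\mathcal I_j$ by shortening every maximal run of more than $2\eta+30$ consecutive plain pairs to length $2\eta+30$ (all plain pairs are equal), and let $F_j$ and $G_j$ be $\mathrm{val}_\Delta$ of the sequences of first and of second components of $\mathcal I'_j$. **Light positions.** For $L=P[\ell..r)\in\mathcal L^P$ and $L'=T[\ell'..r')\in\mathcal L^T$, the pair gives to every integer $v$ with $\ell'-7d-r<v<r'+7d-\ell$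 exactly $\mathrm{edl}(L',Q)$ marks if $L$ is a prefix of $P$, and $\min\{\mathrm{edl}(L',Q),\mathrm{edl}(L,Q)\}$ marks otherwise. Let $\mathbb L$ be the set of $v\in\{0,\dots,n-m+k\}$ which receive fewer than $\eta$ marks in total and for which no fragment in $\mathcal L^T$ overlaps $T[x-7d..x+7d)$, for each $x\in\{v,\ v+m,\ v+|L^P_1|\}$, where $L^P_1$ is the first fragment in $\mathcal L^P$. **Claim.** $$\mathrm{Occ}^E_k(P,T)\cap\mathbb L=\Big(\bigcup_{j\in J}\big(r_j+\mathrm{Occ}^E_k(\mathcal I'_j)\big)\Big)\cap\mathbb L=\Big(\bigcup_{j\in J}\big(r_j+\mathrm{Occ}^E_k(F_j,G_j)\big)\Big)\cap\mathbb L .$$ -/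

import Mathlib

namespace PuzzleMatching

noncomputable section

variable {σ : Type*}

/-! ### Strings, fragments, periodic extensions -/

/-- The fragment `S[a .. b)` of a string `S` (`0 ≤ a ≤ b ≤ |S|`). -/
def frag (S : List σ) (a b : ℕ) : List σ := (S.take b).drop a

/-- The power `U ^ k` of a string. -/
def strPow (U : List σ) (k : ℕ) : List σ := (List.replicate k U).flatten

/-- A string is primitive if it is not `U ^ k` with `k > 1`
(the empty string is not primitive, being its own square). -/
def IsPrimitive (Q : List σ) : Prop := ∀ (U : List σ) (k : ℕ), 1 < k → Q ≠ strPow U k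

/-- The rotation that moves the last character to the front. -/
def rot (Q : List σ) : List σ := Q.getLast?.toList ++ Q.dropLast

/-- The `i`-th character of the two-sided infinite repetition `Q^∞`;
it is `some _` for every integer `i` as soon as `Q` is non-empty. -/
def infChar (Q : List σ) (i : ℤ) : Option σ := Q[(i % (Q.length : ℤ)).toNat]?

/-- The fragment `Q^∞[i .. j)`, for integers `i ≤ j`. -/
def infFrag (Q : List σ) (i j : ℤ) : List σ :=
  (List.range (j - i).toNat).filterMap fun t => infChar Q (i + (t : ℤ))

/-! ### Alignments and edit distance -/

/-- A step of an alignment: align two characters, delete one, or insert one. -/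
def AlignStep (u v : ℕ × ℕ) : Prop :=
  v = (u.1 + 1, u.2 + 1) ∨ v = (u.1 + 1, u.2) ∨ v = (u.1, u.2 + 1)

/-- `A` is an alignment of `X[x .. x')` onto `Y[y .. y')`, where `s = (x, y)` and `t = (x', y')`:
a sequence of pairs of positions from `s` to `t` made of alignment steps. -/
def IsAlignment (A : List (ℕ × ℕ)) (s t : ℕ × ℕ) : Prop :=
  A.head? = some s ∧ A.getLast? = some t ∧ A.IsChain AlignStep

open Classical in
/-- The cost of an alignment between the strings with characters `X 0, X 1, …` and `Y 0, Y 1, …`: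
every step costs `1`, except that aligning two equal characters is free. -/
def alignCost (X Y : ℕ → Option σ) : List (ℕ × ℕ) → ℕ
  | u :: v :: A =>
      (if v = (u.1 + 1, u.2 + 1) ∧ X u.1 = Y u.2 then 0 else 1) + alignCost X Y (v :: A)
  | _ => 0

/-- The edit distance: the minimum cost of an alignment of `X` onto `Y`. -/
def editDist (X Y : List σ) : ℕ :=
  sInf {c | ∃ A, IsAlignment A (0, 0) (X.length, Y.length) ∧
    alignCost (fun i => X[i]?) (fun i => Y[i]?) A = c}

/-- The set of starting positions of `k`-error occurrences of `P` in `T`. -/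
def Occ (k : ℕ) (P T : List σ) : Set ℕ :=
  {v | ∃ w, v ≤ w ∧ w ≤ T.length ∧ editDist P (frag T v w) ≤ k}

/-- Minimum edit distance between `S` and a prefix of `Q^∞`. -/
def edPrefix (S Q : List σ) : ℕ := sInf {c | ∃ j : ℕ, editDist S (infFrag Q 0 j) = c}

/-- Minimum edit distance between `S` and a substring of `Q^∞`. -/
def edSub (S Q : List σ) : ℕ :=
  sInf {c | ∃ i j : ℕ, i ≤ j ∧ editDist S (infFrag Q i j) = c}

/-- Minimum edit distance between `S` and a substring of `Q^∞` that ends at a multiple of `|Q|`. -/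
def edSuffix (S Q : List σ) : ℕ :=
  sInf {c | ∃ i j : ℕ, i ≤ j * Q.length ∧ editDist S (infFrag Q i (j * Q.length : ℕ)) = c}

/-! ### Locked fragments

A fragment `S[ℓ .. r)` is represented by the pair `(ℓ, r)`. -/

/-- The string at a fragment of `S`. -/
def str (S : List σ) (L : ℕ × ℕ) : List σ := frag S L.1 L.2

/-- The fragment `L` of `S` is locked with respect to `Q`. -/
def IsLocked (S Q : List σ) (L : ℕ × ℕ) : Prop :=
  (∃ α : ℕ, edSub (str S L) Q = editDist (str S L) (strPow Q α)) ∨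
  (L.2 = S.length ∧ edSub (str S L) Q = edPrefix (str S L) Q) ∨
  (L.1 = 0 ∧ edSub (str S L) Q = edSuffix (str S L) Q) ∨
  L = (0, S.length)

/-- The prefix `L` of `S` is `h`-locked with respect to `Q`. -/
def IsLockedPrefix (S Q : List σ) (h : ℕ) (L : ℕ × ℕ) : Prop :=
  L.1 = 0 ∧
  ((∀ p < Q.length, edPrefix (str S L) (rot^[p] Q) ≤ h →
      ∃ j : ℤ, -(p : ℤ) ≤ j * Q.length ∧
        edPrefix (str S L) (rot^[p] Q) = editDist (str S L) (infFrag Q (-p) (j * Q.length))) ∨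
    L = (0, S.length))

/-- `Ls = [L₁, …, L_ℓ]` is a decomposition of `S` into locked fragments, as computed by
`Locked(S, Q, edSub S Q, h)`: `S = L₁ Q^α₁ L₂ Q^α₂ ⋯ L_ℓ` with positive exponents, all `L_i` are
locked, `L₁` is `h`-locked, the distances to `Q^∞` add up, and those of the inner `L_i` are
positive. (The bound on the total length of the `L_i`, which matters for running times, is
not imposed.) -/
structure IsLockedFamily (S Q : List σ) (h : ℕ) (Ls : List (ℕ × ℕ)) : Prop where
  fragments : ∀ L ∈ Ls, L.1 ≤ L.2 ∧ L.2 ≤ S.length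
  locked : ∀ L ∈ Ls, IsLocked S Q L
  first : ∃ L, Ls.head? = some L ∧ IsLockedPrefix S Q h L
  last : ∃ L, Ls.getLast? = some L ∧ L.2 = S.length
  gaps : Ls.IsChain fun L L' => ∃ α : ℕ, 0 < α ∧ L.2 ≤ L'.1 ∧ frag S L.2 L'.1 = strPow Q α
  total : edSub S Q = (Ls.map fun L => edSub (str S L) Q).sum
  inner_pos : ∀ i L, Ls[i]? = some L → 0 < i → i + 1 < Ls.length → 0 < edSub (str S L) Q

/-! ### Puzzles, DPM-sequences and trimming -/

/-- The value of a `Δ`-puzzle: overlaps of length `Δ` are merged. -/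
def val (Δ : ℕ) : List (List σ) → List σ
  | [] => []
  | S :: Ss => S ++ (Ss.map (List.drop Δ)).flatten

/-- `k`-error occurrences represented by a DPM-sequence. -/
def OccDPM (k Δ : ℕ) (I : List (List σ × List σ)) : Set ℕ :=
  Occ k (val Δ (I.map Prod.fst)) (val Δ (I.map Prod.snd))

/-- Auxiliary function for `trim`; `c` is the number of elements kept so far in the current
run of plain elements. -/
def trimAux {α : Type*} (a : ℕ) : ℕ → List (Bool × α) → List α
  | _, [] => []
  | c, (true, x) :: l => if c < a then x :: trimAux a (c + 1) l else trimAux a c l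
  | _, (false, x) :: l => x :: trimAux a 0 l

/-- `trim a l`: in a sequence whose plain elements carry the label `true`, every maximal run of
plain elements longer than `a` is shortened to length `a` (and the labels are dropped).
Plain DPM-pairs all being equal, it does not matter which elements of a run are removed. -/
def trim {α : Type*} (a : ℕ) (l : List (Bool × α)) : List α := trimAux a 0 l

/-! ### Instances of the problem `NewPeriodicMatches` -/

/-- An instance of `NewPeriodicMatches`: pattern `P`, text `T`, threshold `k`, parameter `d`,
primitive string `Q`, and optimal alignments `AP : P ↠ Q^∞[0 .. yP)` and
`AT : T ↠ Q^∞[xT .. yT)`. -/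
structure NewPeriodicMatches (σ : Type*) where
  P : List σ
  T : List σ
  Q : List σ
  k : ℕ
  d : ℕ
  AP : List (ℕ × ℕ)
  AT : List (ℕ × ℕ)
  yP : ℕ
  xT : ℕ
  yT : ℕ
  k_le : k ≤ P.length
  d_pos : 0 < d
  two_k_le : 2 * k ≤ d
  le_n : P.length ≤ T.length + k
  n_lt : T.length < ⌈(3 / 2 : ℚ) * P.length⌉₊ + k
  primitive : IsPrimitive Q
  q_le : 8 * d * Q.length ≤ P.length
  alignP : IsAlignment AP (0, 0) (P.length, yP)
  costP : alignCost (fun i => P[i]?) (fun i => infChar Q i) AP = edSub P Q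
  edP_eq : edSub P Q = edPrefix P Q
  dP_le : edSub P Q ≤ d
  xT_lt : xT < Q.length
  alignT : IsAlignment AT (0, xT) (T.length, yT)
  costT : alignCost (fun i => T[i]?) (fun i => infChar Q i) AT = edSub T Q
  dT_le : edSub T Q ≤ 3 * d

namespace NewPeriodicMatches

variable (N : NewPeriodicMatches σ)

/-- `m = |P|` -/
def m : ℕ := N.P.length

/-- `n = |T|` -/
def n : ℕ := N.T.length

/-- `q = |Q|` -/
def q : ℕ := N.Q.length

/-- `κ = k + d_P + d_T` -/
def kappa : ℕ := N.k + edSub N.P N.Q + edSub N.T N.Q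

/-- `τ = q ⌈κ / 2q⌉` -/
def tau : ℕ := N.q * ⌈(N.kappa : ℚ) / (2 * N.q)⌉₊

/-- Overlap `Δ = 6κ` of neighbouring puzzle pieces. -/
def Delta : ℕ := 6 * N.kappa

/-- Number `β_P = ⌈y_P / τ⌉` of tiles of `P`. -/
def betaP : ℕ := ⌈(N.yP : ℚ) / N.tau⌉₊

/-- Number `z = β_P - 17` of puzzle pieces (used when `β_P ≥ 20`). -/
def z : ℕ := N.betaP - 17

/-- `min J` -/
def minJ : ℤ := ⌈((N.xT : ℚ) - N.kappa) / N.tau⌉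

/-- `max J` -/
def maxJ : ℤ := ⌊((N.yT : ℚ) - N.yP + N.kappa) / N.tau⌋

/-- The index set `J`. -/
def J : Set ℤ := Set.Icc N.minJ N.maxJ

/-- `r_j`, the left end of `R_j = T[r_j .. r'_j)`. -/
def r (j : ℤ) : ℕ :=
  sInf {a | ∃ b : ℕ, (a, b) ∈ N.AT ∧ j * N.tau - N.kappa ≤ (b : ℤ)}

/-- `r'_j`, the right end of `R_j = T[r_j .. r'_j)`. -/
def rEnd (j : ℤ) : ℕ :=
  sSup {a | ∃ b : ℕ, (a, b) ∈ N.AT ∧ (b : ℤ) ≤ j * N.tau + N.yP + N.kappa}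

/-- The boundary `s_i` of the `τ`-tile partition of a string of length `len` with respect to an
alignment `A` onto `Q^∞[x .. y)`, where `x < τ`: the `i`-th tile `[s_{i-1} .. s_i)` is the preimage
under `A` of `Q^∞[max(x, (i-1)τ) .. min(y, iτ))`. In particular `s_0 = 0`. -/
def tileBound (A : List (ℕ × ℕ)) (len y : ℕ) (i : ℤ) : ℕ :=
  if (y : ℤ) ≤ i * N.tau then len else sInf {a | ∃ b : ℕ, (a, b) ∈ A ∧ (b : ℤ) = i * N.tau}

/-- Tile boundaries `p_i` of `P`. -/
def p (i : ℤ) : ℕ := N.tileBound N.AP N.m N.yP i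

/-- Tile boundaries `t_i` of `T`. -/
def t (i : ℤ) : ℕ := N.tileBound N.AT N.n N.yT i

/-- The puzzle piece `P_i`, `1 ≤ i ≤ z`. -/
def pieceP (i : ℕ) : List σ :=
  if i = 1 then frag N.P (N.p 0) (N.p 2 + N.Delta)
  else if i = N.z then frag N.P (N.p N.z) N.m
  else frag N.P (N.p i) (N.p (i + 1) + N.Delta)

/-- The puzzle piece `T_{j,i}`, `1 ≤ i ≤ z`. -/
def pieceT (j : ℤ) (i : ℕ) : List σ :=
  if i = 1 then frag N.T (N.r j) (N.t (j + 2) + N.Delta)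
  else if i = N.z then frag N.T (N.t (j + N.z)) (N.rEnd j)
  else frag N.T (N.t (j + i)) (N.t (j + i + 1) + N.Delta)

/-- The internal piece `T_i = T[t_i .. t_{i+1} + Δ)`, which is `T_{j,i-j}` for all `j`
with `1 < i - j < z`. -/
def internalT (i : ℤ) : List σ := frag N.T (N.t i) (N.t (i + 1) + N.Delta)

/-- The canonical internal piece `Q^∞[0 .. τ + Δ)`. -/
def canonical : List σ := infFrag N.Q 0 ((N.tau + N.Delta : ℕ) : ℤ)

/-- The slack `7d` used for light positions. -/
def slack : ℕ := 7 * N.d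

/-- The two half-open integer intervals `[a .. b)` and `[a' .. b')` intersect. -/
def Meets (a b a' b' : ℤ) : Prop := (Set.Ico a b ∩ Set.Ico a' b').Nonempty

/-- Indices of the red pieces of `P`: the special internal pieces, and the internal pieces close to
a locked fragment. (Pieces are identified with their indices.) -/
def RedP (LP : List (ℕ × ℕ)) : Set ℕ :=
  {i | 1 < i ∧ i < N.z ∧
    (N.pieceP i ≠ N.canonical ∨
      ∃ L ∈ LP, Meets ((L.1 : ℤ) - 13 * N.slack) (L.2 + 13 * N.slack)
        (N.p i) (N.p (i + 1) + N.Delta))}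

/-- Indices of the red pieces of `T`. -/
def RedT (LT : List (ℕ × ℕ)) : Set ℤ :=
  {i | N.minJ + 1 < i ∧ i < N.maxJ + N.z ∧
    (N.internalT i ≠ N.canonical ∨
      ∃ L ∈ LT, Meets ((L.1 : ℤ) - 13 * N.slack) (L.2 + 13 * N.slack)
        (N.t i) (N.t (i + 1) + N.Delta))}

/-- The pair `(P_i, T_{j,i})` is plain: internal, and neither piece is red. -/
def IsPlain (LP LT : List (ℕ × ℕ)) (j : ℤ) (i : ℕ) : Prop :=
  1 < i ∧ i < N.z ∧ i ∉ N.RedP LP ∧ j + i ∉ N.RedT LT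

open Classical in
/-- The DPM-sequence `I_j = (P_1, T_{j,1}) ⋯ (P_z, T_{j,z})`, plain pairs being labelled `true`. -/
def seqI (LP LT : List (ℕ × ℕ)) (j : ℤ) : List (Bool × (List σ × List σ)) :=
  (List.range' 1 N.z).map fun i =>
    (decide (N.IsPlain LP LT j i), (N.pieceP i, N.pieceT j i))

/-- The trimmed DPM-sequence `I'_j`: runs of plain pairs are trimmed to length `2η + 30`. -/
def seqTrim (LP LT : List (ℕ × ℕ)) (η : ℕ) (j : ℤ) : List (List σ × List σ) :=
  trim (2 * η + 30) (N.seqI LP LT j)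

/-- The string `F_j`, the value of the first components of `I'_j`. -/
def F (LP LT : List (ℕ × ℕ)) (η : ℕ) (j : ℤ) : List σ :=
  val N.Delta ((N.seqTrim LP LT η j).map Prod.fst)

/-- The string `G_j`, the value of the second components of `I'_j`. -/
def G (LP LT : List (ℕ × ℕ)) (η : ℕ) (j : ℤ) : List σ :=
  val N.Delta ((N.seqTrim LP LT η j).map Prod.snd)

/-! ### Marks and light positions -/

open Classical in
/-- The marks that the pair of locked fragments `Lp` of `P` and `Lt` of `T` gives to `v`. -/
def markPair (v : ℤ) (Lp Lt : ℕ × ℕ) : ℕ :=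
  if (Lt.1 : ℤ) - N.slack - Lp.2 < v ∧ v < (Lt.2 : ℤ) + N.slack - Lp.1 then
    if Lp.1 = 0 then edSub (str N.T Lt) N.Q
    else min (edSub (str N.T Lt) N.Q) (edSub (str N.P Lp) N.Q)
  else 0

/-- The total number of marks at `v`. -/
def mark (LP LT : List (ℕ × ℕ)) (v : ℤ) : ℕ :=
  (LP.map fun Lp => (LT.map fun Lt => N.markPair v Lp Lt).sum).sum

/-- No locked fragment of the text overlaps `[x - 7d .. x + 7d)`. -/
def FreeAround (LT : List (ℕ × ℕ)) (x : ℤ) : Prop :=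
  ∀ L ∈ LT, ¬ Meets L.1 L.2 (x - N.slack) (x + N.slack)

/-- The set of light positions in `{0, …, n - m + k}`, for the threshold `η`. -/
def light (LP LT : List (ℕ × ℕ)) (η : ℕ) : Set ℕ :=
  {v | v + N.m ≤ N.n + N.k ∧
    N.mark LP LT v < η ∧
    N.FreeAround LT v ∧
    N.FreeAround LT (v + N.m) ∧
    ∀ L₁, LP.head? = some L₁ → N.FreeAround LT (v + (L₁.2 - L₁.1 : ℕ))}

end NewPeriodicMatches

end

end PuzzleMatching

/-! Everything is measured against `Q^∞`. In an optimal alignment of `P` or `T` onto `Q^∞`,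
additivity of the distances over a locked decomposition forces every error into a locked fragment
(`exists_profile`). Both strings thus become annotated strings that are exactly periodic outside
their locked fragments. Fix a light `v`, aligned with position `g v` of `Q^∞`. The weight of a
locked fragment is its distance to `Q^∞`; only the first fragment of `P` is measured against
prefixes of `Q^∞[g v ..)`, because an occurrence at `v` must start there. `potential` adds the
weights of all locked fragments of `P` and of those of `T` inside `[v .. v+m)`.

Lower bound. Take an alignment of cost at most `k` that starts at `v`, and a locked fragment whose
weight exceeds its total number of marks. By the triangle inequality the alignment pays at least
weight minus marks at this fragment, since the locked fragments it meets on the other string absorb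
at most its marks. Two such fragments of opposite strings never meet, so no step is charged twice.
Hence the cost outside locked fragments plus `potential` is at most the cost plus twice the marks
(`Setting.lower_bound`). A cost not above `potential` leaves fewer than `2η` errors outside locked
fragments. So a run of at least `2η+30` plain pairs contains an error-free tile, even after 15 tiles
are given up at each end to absorb drift. Such a tile can be deleted or doubled in both strings for
free (`Setting.transport`), and trimming is a sequence of such deletions (`Good.trim`).

Upper bound. If the weight of the first fragment is at most `2d`, cost `potential` is attained by
going through `Q^∞` (`exists_ed_potential`): the `2d`-locked prefix ends at a multiple of `q`, and
the text is periodic near `v+m`, so the right end can be adjusted. The weight condition follows from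
any alignment of cost at most `k`, trimmed or not (`Setting.first_weight_le`). Hence thresholds
above `potential` need no transport.

Finally, an occurrence has to lie in some `R_j`: a long power of the primitive `Q` can be matched
cheaply only near a shift by a multiple of `q` (`IsPrimitive.synchronize`, `exists_index`). -/

namespace PuzzleMatching

variable {σ : Type*}

/-! ### Edit scripts -/

/-- `Ed X Y c`: the string `X` can be edited into `Y` at cost at most `c`. -/
inductive Ed : List σ → List σ → ℕ → Prop
  | nil (c : ℕ) : Ed [] [] c
  | del {X Y : List σ} {c : ℕ} (x : σ) : Ed X Y c → Ed (x :: X) Y (c + 1)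
  | ins {X Y : List σ} {c : ℕ} (y : σ) : Ed X Y c → Ed X (y :: Y) (c + 1)
  | sub {X Y : List σ} {c : ℕ} (x y : σ) : Ed X Y c → Ed (x :: X) (y :: Y) (c + 1)
  | eq {X Y : List σ} {c : ℕ} (x : σ) : Ed X Y c → Ed (x :: X) (x :: Y) c

namespace Ed

theorem mono {X Y : List σ} {c c' : ℕ} (h : Ed X Y c) (hc : c ≤ c') : Ed X Y c' := by
  induction h generalizing c' with
  | nil c => exact .nil _
  | del x _ ih =>
    obtain ⟨e, rfl⟩ : ∃ e, c' = e + 1 := ⟨c' - 1, by omega⟩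
    exact .del x (ih (by omega))
  | ins x _ ih =>
    obtain ⟨e, rfl⟩ : ∃ e, c' = e + 1 := ⟨c' - 1, by omega⟩
    exact .ins x (ih (by omega))
  | sub x y _ ih =>
    obtain ⟨e, rfl⟩ : ∃ e, c' = e + 1 := ⟨c' - 1, by omega⟩
    exact .sub x y (ih (by omega))
  | eq x _ ih => exact .eq x (ih hc)

theorem refl (X : List σ) (c : ℕ) : Ed X X c := by
  induction X with
  | nil => exact .nil c
  | cons x X ih => exact .eq x ih

theorem symm {X Y : List σ} {c : ℕ} (h : Ed X Y c) : Ed Y X c := by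
  induction h with
  | nil c => exact .nil c
  | del x _ ih => exact .ins x ih
  | ins x _ ih => exact .del x ih
  | sub x y _ ih => exact .sub y x ih
  | eq x _ ih => exact .eq x ih

theorem append {X Y X' Y' : List σ} {c c' : ℕ} (h : Ed X Y c) (h' : Ed X' Y' c') :
    Ed (X ++ X') (Y ++ Y') (c + c') := by
  induction h with
  | nil c => exact h'.mono (by omega)
  | del x _ ih => exact (Ed.del x ih).mono (by omega)
  | ins x _ ih => exact (Ed.ins x ih).mono (by omega)
  | sub x y _ ih => exact (Ed.sub x y ih).mono (by omega)
  | eq x _ ih => exact .eq x ih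

/-- When the first script ends in a step that produces `y`, an inner induction runs through the
insertions of the second script until it reaches the step that consumes `y`. -/
theorem trans {X Y Z : List σ} {c c' : ℕ} (h : Ed X Y c) (h' : Ed Y Z c') : Ed X Z (c + c') := by
  induction h generalizing Z c' with
  | nil c => exact h'.mono (by omega)
  | del x _ ih => exact (Ed.del x (ih h')).mono (by omega)
  | @ins X Y c y _ ih =>
    generalize hW : y :: Y = W at h'
    induction h' with
    | nil c => simp at hW
    | del x h _ => cases hW; exact (ih h).mono (by omega)
    | ins x _ ih' => exact (Ed.ins x (ih' hW)).mono (by omega)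
    | sub x z h _ => cases hW; exact (Ed.ins z (ih h)).mono (by omega)
    | eq x h _ => cases hW; exact (Ed.ins _ (ih h)).mono (by omega)
  | @sub X Y c u y _ ih =>
    generalize hW : y :: Y = W at h'
    induction h' with
    | nil c => simp at hW
    | del x h _ => cases hW; exact (Ed.del u (ih h)).mono (by omega)
    | ins x _ ih' => exact (Ed.ins x (ih' hW)).mono (by omega)
    | sub x z h _ => cases hW; exact (Ed.sub u z (ih h)).mono (by omega)
    | eq x h _ => cases hW; exact (Ed.sub u _ (ih h)).mono (by omega)
  | @eq X Y c y _ ih =>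
    generalize hW : y :: Y = W at h'
    induction h' with
    | nil c => simp at hW
    | del x h _ => cases hW; exact (Ed.del y (ih h)).mono (by omega)
    | ins x _ ih' => exact (Ed.ins x (ih' hW)).mono (by omega)
    | sub x z h _ => cases hW; exact (Ed.sub y z (ih h)).mono (by omega)
    | eq x h _ => cases hW; exact Ed.eq _ (ih h)

theorem length_le {X Y : List σ} {c : ℕ} (h : Ed X Y c) : X.length ≤ Y.length + c := by
  induction h <;> simp <;> omega

theorem length_ge {X Y : List σ} {c : ℕ} (h : Ed X Y c) : Y.length ≤ X.length + c :=
  h.symm.length_le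

theorem length_eq {X Y : List σ} (h : Ed X Y 0) : X.length = Y.length :=
  le_antisymm h.length_le h.length_ge

theorem eq_of_zero {X Y : List σ} (h : Ed X Y 0) : X = Y := by
  generalize hc : 0 = c at h
  induction h with
  | nil c => rfl
  | del x _ ih => omega
  | ins x _ ih => omega
  | sub x y _ ih => omega
  | eq x _ ih => rw [ih hc]

theorem trivial (X Y : List σ) : Ed X Y (X.length + Y.length) := by
  induction X with
  | nil =>
    induction Y with
    | nil => exact .nil _
    | cons y Y ih => exact .ins y ih
  | cons x X ih => exact (Ed.del x ih).mono (by simp only [List.length_cons]; omega)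

end Ed

/-! ### Paths -/

/-- A sequence of naturals that moves by steps `0` and `1`. -/
def Walk (a : ℕ → ℕ) : Prop := ∀ t, a (t + 1) = a t ∨ a (t + 1) = a t + 1

open Classical in
/-- The cost of the `t`-th step of the path `(a, b)`. -/
noncomputable def stepCost (X Y : ℕ → Option σ) (a b : ℕ → ℕ) (t : ℕ) : ℕ :=
  if a (t + 1) = a t + 1 ∧ b (t + 1) = b t + 1 ∧ X (a t) = Y (b t) then 0 else 1

theorem Walk.monotone {a : ℕ → ℕ} (h : Walk a) : Monotone a :=
  monotone_nat_of_le_succ fun t => by rcases h t with h | h <;> omega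

/-- The characters of `X` at the positions in `[i .. j)`. -/
def chars (X : ℕ → Option σ) (i j : ℕ) : List σ := (List.range' i (j - i)).filterMap X

theorem chars_self (X : ℕ → Option σ) (i : ℕ) : chars X i i = [] := by simp [chars]

theorem chars_append (X : ℕ → Option σ) {i j l : ℕ} (hij : i ≤ j) (hjl : j ≤ l) :
    chars X i j ++ chars X j l = chars X i l := by
  unfold chars
  rw [← List.filterMap_append]
  congr 1
  have := List.range'_append_1 (s := i) (m := j - i) (n := l - j)
  rw [show i + (j - i) = j by omega, show j - i + (l - j) = l - i by omega] at this
  exact this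

theorem chars_succ (X : ℕ → Option σ) (i : ℕ) : chars X i (i + 1) = (X i).toList := by
  simp only [chars, Nat.add_sub_cancel_left, List.range'_one]
  cases h : X i <;> simp [h]

theorem ed_subpath (X Y : ℕ → Option σ) {a b : ℕ → ℕ} (ha : Walk a) (hb : Walk b) {s t : ℕ}
    (hst : s ≤ t) :
    Ed (chars X (a s) (a t)) (chars Y (b s) (b t))
      (∑ u ∈ Finset.Ico s t, stepCost X Y a b u) := by
  induction t, hst using Nat.le_induction with
  | base => simp [chars_self]; exact .nil _
  | succ t hst ih =>
    have h1 := ha.monotone hst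
    have h2 := hb.monotone hst
    have h3 := ha.monotone (Nat.le_succ t)
    have h4 := hb.monotone (Nat.le_succ t)
    rw [Finset.sum_Ico_succ_top hst, ← chars_append X h1 h3, ← chars_append Y h2 h4]
    refine ih.append ?_
    unfold stepCost
    split_ifs with h
    · rw [h.1, h.2.1, chars_succ, chars_succ, h.2.2]
      exact .refl _ _
    · have hX : a (t + 1) = a t ∧ chars X (a t) (a (t + 1)) = [] ∨
          chars X (a t) (a (t + 1)) = (X (a t)).toList := by
        rcases ha t with h | h
        · left; rw [h]; exact ⟨rfl, chars_self _ _⟩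
        · right; rw [h, chars_succ]
      have hY : chars Y (b t) (b (t + 1)) = [] ∨
          chars Y (b t) (b (t + 1)) = (Y (b t)).toList := by
        rcases hb t with h | h
        · left; rw [h, chars_self]
        · right; rw [h, chars_succ]
      have key : ∀ u v : Option σ, Ed u.toList v.toList 1 := by
        rintro (_ | u) (_ | v)
        · exact .nil _
        · exact .ins _ (.nil _)
        · exact .del _ (.nil _)
        · exact .sub _ _ (.nil _)
      rcases hX with ⟨-, hX⟩ | hX <;> rcases hY with hY | hY <;> rw [hX, hY]
      · exact key none none
      · exact key none _
      · exact key _ none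
      · exact key _ _

/-- Free steps preserve `a - b`, and a step of cost one changes it by at most one. The two
inequalities are stated additively to avoid truncated subtraction. -/
theorem drift_le {X Y : ℕ → Option σ} {a b : ℕ → ℕ} (ha : Walk a) (hb : Walk b) {s t : ℕ}
    (hst : s ≤ t) :
    a t + b s ≤ a s + b t + ∑ u ∈ Finset.Ico s t, stepCost X Y a b u ∧
    a s + b t ≤ a t + b s + ∑ u ∈ Finset.Ico s t, stepCost X Y a b u := by
  induction t, hst using Nat.le_induction with
  | base => simp
  | succ t hst ih =>
    rw [Finset.sum_Ico_succ_top hst]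
    have := ha t
    have := hb t
    unfold stepCost at *
    split_ifs with h <;> omega

/-- Replaces the list by two total functions of time, so that costs become sums over time intervals
and can be restricted or regrouped freely. -/
theorem exists_path {A : List (ℕ × ℕ)} {s t : ℕ × ℕ} (hA : IsAlignment A s t) :
    ∃ (a b : ℕ → ℕ) (K : ℕ), Walk a ∧ Walk b ∧ a 0 = s.1 ∧ b 0 = s.2 ∧ a K = t.1 ∧ b K = t.2 ∧
      (∀ u ≤ K, (a u, b u) ∈ A) ∧ (∀ x ∈ A, ∃ u ≤ K, x = (a u, b u)) ∧
      ∀ X Y : ℕ → Option σ, alignCost X Y A = ∑ u ∈ Finset.range K, stepCost X Y a b u := by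
  obtain ⟨h1, h2, h3⟩ := hA
  induction A generalizing s with
  | nil => simp at h1
  | cons u A ih =>
    cases A with
    | nil =>
      simp at h1 h2
      subst h1 h2
      refine ⟨fun _ => u.1, fun _ => u.2, 0, fun _ => .inl rfl, fun _ => .inl rfl, rfl, rfl, rfl,
        rfl, ?_, ?_, ?_⟩
      · simp
      · simp
      · simp [alignCost]
    | cons v A =>
      simp at h1
      subst h1
      rw [List.isChain_cons_cons] at h3
      obtain ⟨a, b, K, ha, hb, ha0, hb0, haK, hbK, hm, hm', hc⟩ := ih (s := v) rfl
        (by rw [List.getLast?_cons_cons] at h2; exact h2) h3.2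
      have hst := h3.1
      refine ⟨fun t => Nat.casesOn t u.1 a, fun t => Nat.casesOn t u.2 b, K + 1, ?_, ?_, rfl, rfl,
        haK, hbK, ?_, ?_, ?_⟩
      · rintro (_ | t)
        · simp only [ha0]
          rcases hst with h | h | h <;> simp [h]
        · exact ha t
      · rintro (_ | t)
        · simp only [hb0]
          rcases hst with h | h | h <;> simp [h]
        · exact hb t
      · rintro (_ | t) ht
        · simp
        · exact List.mem_cons_of_mem _ (hm t (by omega))
      · intro x hx
        rcases List.mem_cons.1 hx with rfl | hx
        · exact ⟨0, by omega, rfl⟩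
        · obtain ⟨t, ht, rfl⟩ := hm' x hx
          exact ⟨t + 1, by omega, rfl⟩
      · intro X Y
        rw [alignCost, hc, Finset.sum_range_succ', add_comm]
        congr 1
        have e : (v = (u.1 + 1, u.2 + 1) ∧ X u.1 = Y u.2) ↔
            (a 0 = u.1 + 1 ∧ b 0 = u.2 + 1 ∧ X u.1 = Y u.2) := by
          rw [ha0, hb0, Prod.ext_iff, and_assoc]
        by_cases h : v = (u.1 + 1, u.2 + 1) ∧ X u.1 = Y u.2
        · exact (if_pos h).trans (if_pos (e.1 h)).symm
        · exact (if_neg h).trans (if_neg (mt e.2 h)).symm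

/-- The offsets `i`, `j` and the ambient `FX`, `FY` are there for the induction: consuming a
character moves the start point while the ambient strings stay fixed. -/
theorem isAlignment_of_ed {X Y : List σ} {c : ℕ} (h : Ed X Y c) (FX FY : ℕ → Option σ) (i j : ℕ)
    (hX : ∀ u < X.length, FX (i + u) = X[u]?) (hY : ∀ u < Y.length, FY (j + u) = Y[u]?) :
    ∃ A, IsAlignment A (i, j) (i + X.length, j + Y.length) ∧ alignCost FX FY A ≤ c := by
  have main : ∀ {c c' : ℕ} {s s' t : ℕ × ℕ}, AlignStep s s' →
      (∃ A, IsAlignment A s' t ∧ alignCost FX FY A ≤ c) →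
      ((s' = (s.1 + 1, s.2 + 1) ∧ FX s.1 = FY s.2 ∧ c' = c) ∨ c' = c + 1) →
      ∃ A, IsAlignment A s t ∧ alignCost FX FY A ≤ c' := by
    rintro c c' s s' t hst ⟨A, ⟨h1, h2, h3⟩, hA⟩ hc
    cases A with
    | nil => simp at h1
    | cons u A =>
      simp at h1
      subst h1
      refine ⟨s :: u :: A, ⟨rfl, ?_, ?_⟩, ?_⟩
      · rw [List.getLast?_cons_cons, h2]
      · rw [List.isChain_cons_cons]; exact ⟨hst, h3⟩
      · rw [alignCost]
        rcases hc with ⟨hc1, hc2, rfl⟩ | rfl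
        · rw [if_pos ⟨hc1, hc2⟩]; omega
        · split_ifs <;> omega
  have hXt : ∀ {x : σ} {X : List σ} {i : ℕ},
      (∀ u < (x :: X).length, FX (i + u) = (x :: X)[u]?) →
      ∀ u < X.length, FX (i + 1 + u) = X[u]? := by
    intro x X i h u hu
    have := h (u + 1) (by simpa using hu)
    rw [show i + 1 + u = i + (u + 1) by ring, this]; simp
  have hYt : ∀ {x : σ} {X : List σ} {i : ℕ},
      (∀ u < (x :: X).length, FY (i + u) = (x :: X)[u]?) →
      ∀ u < X.length, FY (i + 1 + u) = X[u]? := by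
    intro x X i h u hu
    have := h (u + 1) (by simpa using hu)
    rw [show i + 1 + u = i + (u + 1) by ring, this]; simp
  induction h generalizing i j with
  | nil c => exact ⟨[(i, j)], ⟨rfl, rfl, by simp⟩, by simp [alignCost]⟩
  | @del X Y c x _ ih =>
    have := ih (i + 1) j (hXt hX) hY
    refine main (s := (i, j)) (s' := (i + 1, j)) (.inr (.inl rfl)) ?_ (.inr rfl)
    simpa [add_assoc, add_comm, add_left_comm] using this
  | @ins X Y c x _ ih =>
    have := ih i (j + 1) hX (hYt hY)
    refine main (s := (i, j)) (s' := (i, j + 1)) (.inr (.inr rfl)) ?_ (.inr rfl)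
    simpa [add_assoc, add_comm, add_left_comm] using this
  | @sub X Y c x y _ ih =>
    have := ih (i + 1) (j + 1) (hXt hX) (hYt hY)
    refine main (s := (i, j)) (s' := (i + 1, j + 1)) (.inl rfl) ?_ (.inr rfl)
    simpa [add_assoc, add_comm, add_left_comm] using this
  | @eq X Y c x _ ih =>
    have := ih (i + 1) (j + 1) (hXt hX) (hYt hY)
    refine main (s := (i, j)) (s' := (i + 1, j + 1)) (.inl rfl) ?_ (.inl ⟨rfl, ?_, rfl⟩)
    · simpa [add_assoc, add_comm, add_left_comm] using this
    · have h1 := hX 0 (by simp)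
      have h2 := hY 0 (by simp)
      simpa using h1.trans h2.symm

theorem frag_eq_chars (S : List σ) {i j : ℕ} (hj : j ≤ S.length) :
    frag S i j = chars (fun u => S[u]?) i j := by
  induction j with
  | zero => simp [frag, chars]
  | succ j ih =>
    rcases Nat.lt_or_ge j i with h | h
    · rw [frag, chars, show j + 1 - i = 0 by omega]
      simp
      omega
    · rw [← chars_append _ h (Nat.le_succ j), ← ih (by omega), chars_succ]
      rw [frag, frag, List.take_add_one, List.drop_append_of_le_length]
      simp
      omega

theorem frag_full (S : List σ) : frag S 0 S.length = S := by simp [frag]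

/-- A minimum-cost path between two strings. -/
theorem Ed.exists_path {X Y : List σ} {c : ℕ} (h : Ed X Y c) :
    ∃ (a b : ℕ → ℕ) (K : ℕ), Walk a ∧ Walk b ∧ a 0 = 0 ∧ b 0 = 0 ∧ a K = X.length ∧
      b K = Y.length ∧
      ∑ u ∈ Finset.range K, stepCost (fun i => X[i]?) (fun i => Y[i]?) a b u ≤ c := by
  obtain ⟨A, hA, hc⟩ := isAlignment_of_ed h (fun i => X[i]?) (fun i => Y[i]?) 0 0
    (by simp) (by simp)
  obtain ⟨a, b, K, ha, hb, h1, h2, h3, h4, -, -, h5⟩ := PuzzleMatching.exists_path (σ := σ) hA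
  refine ⟨a, b, K, ha, hb, h1, h2, by simpa using h3, by simpa using h4, ?_⟩
  rw [← h5]; exact hc

theorem editDist_le_iff {X Y : List σ} {c : ℕ} : editDist X Y ≤ c ↔ Ed X Y c := by
  constructor
  · intro h
    have hne : {c | ∃ A, IsAlignment A (0, 0) (X.length, Y.length) ∧
        alignCost (fun i => X[i]?) (fun i => Y[i]?) A = c}.Nonempty := by
      obtain ⟨A, hA, -⟩ := isAlignment_of_ed (Ed.trivial X Y) (fun i => X[i]?) (fun i => Y[i]?) 0 0
        (by simp) (by simp)
      exact ⟨_, A, by simpa using hA, rfl⟩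
    obtain ⟨A, hA, hc⟩ := Nat.sInf_mem hne
    obtain ⟨a, b, K, ha, hb, h1, h2, h3, h4, -, -, h5⟩ := exists_path (σ := σ) hA
    have := ed_subpath (fun i => X[i]?) (fun i => Y[i]?) ha hb (Nat.zero_le K)
    rw [h1, h2, h3, h4, ← frag_eq_chars _ le_rfl, ← frag_eq_chars _ le_rfl, frag_full, frag_full,
      ← Finset.range_eq_Ico, ← h5, hc] at this
    exact this.mono h
  · intro h
    obtain ⟨A, hA, hc⟩ := isAlignment_of_ed h (fun i => X[i]?) (fun i => Y[i]?) 0 0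
      (by simp) (by simp)
    have hA' : IsAlignment A (0, 0) (X.length, Y.length) := by simpa using hA
    exact le_trans (Nat.sInf_le (show _ ∈ {c | _} from ⟨A, hA', rfl⟩)) hc

theorem ed_editDist (X Y : List σ) : Ed X Y (editDist X Y) := editDist_le_iff.1 le_rfl

/-! ### First visits -/

/-- The first time at which a walk reaches level `x`. -/
noncomputable def hit (a : ℕ → ℕ) (x : ℕ) : ℕ := sInf {t | x ≤ a t}

theorem hit_le {a : ℕ → ℕ} {x t : ℕ} (h : x ≤ a t) : hit a x ≤ t := Nat.sInf_le h

theorem lt_hit {a : ℕ → ℕ} (ha : Walk a) {x t : ℕ} (h : a t < x) (hx : ∃ u, x ≤ a u) :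
    t < hit a x := by
  by_contra hc
  have h1 : x ≤ a (hit a x) := Nat.sInf_mem (s := {t | x ≤ a t}) hx
  have := ha.monotone (not_lt.1 hc)
  omega

theorem at_hit {a : ℕ → ℕ} (ha : Walk a) {x : ℕ} (h0 : a 0 ≤ x) (hx : ∃ u, x ≤ a u) :
    a (hit a x) = x := by
  have h1 : x ≤ a (hit a x) := Nat.sInf_mem (s := {t | x ≤ a t}) hx
  refine le_antisymm ?_ h1
  rcases Nat.eq_zero_or_pos (hit a x) with h | h
  · rw [h]; exact h0
  · obtain ⟨t, ht⟩ : ∃ t, hit a x = t + 1 := ⟨hit a x - 1, by omega⟩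
    have h2 : a t < x := by
      by_contra hc
      have := hit_le (not_lt.1 hc)
      omega
    rw [ht]
    rcases ha t with h | h <;> omega

theorem hit_mono {a : ℕ → ℕ} {x y : ℕ} (hxy : x ≤ y) (hy : ∃ u, y ≤ a u) :
    hit a x ≤ hit a y := by
  have h1 : y ≤ a (hit a y) := Nat.sInf_mem (s := {t | y ≤ a t}) hy
  exact hit_le (hxy.trans h1)

/-- Turns an interval of positions into an interval of times. Insertions made while the walk stands
at a position are thereby charged to that position. -/
theorem mem_Ico_hit {a : ℕ → ℕ} (ha : Walk a) {x y t : ℕ} (hy : ∃ u, y ≤ a u) (hxy : x ≤ y) :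
    t ∈ Finset.Ico (hit a x) (hit a y) ↔ x ≤ a t ∧ a t < y := by
  have hx : ∃ u, x ≤ a u := hy.imp fun u h => hxy.trans h
  rw [Finset.mem_Ico]
  constructor
  · rintro ⟨h1, h2⟩
    constructor
    · by_contra hc
      have := lt_hit ha (not_le.1 hc) hx
      omega
    · by_contra hc
      have := hit_le (not_lt.1 hc)
      omega
  · rintro ⟨h1, h2⟩
    exact ⟨hit_le h1, lt_hit ha h2 hy⟩

/-! ### Fragments of the periodic extension -/

theorem IsPrimitive.length_pos {Q : List σ} (h : IsPrimitive Q) : 0 < Q.length := by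
  rcases Q with _ | ⟨x, Q⟩
  · exact absurd (by simp [strPow]) (h [] 2 (by norm_num))
  · simp

theorem emod_toNat_lt {q : ℕ} (hq : 0 < q) (i : ℤ) : (i % (q : ℤ)).toNat < q := by
  have := Int.emod_nonneg i (b := (q : ℤ)) (by omega)
  have := Int.emod_lt_of_pos i (b := (q : ℤ)) (by omega)
  omega

/-- The `i`-th character of `Q^∞`, for non-empty `Q`. -/
def chr (Q : List σ) (hq : 0 < Q.length) (i : ℤ) : σ :=
  Q[(i % (Q.length : ℤ)).toNat]'(emod_toNat_lt hq i)

theorem infChar_eq {Q : List σ} (hq : 0 < Q.length) (i : ℤ) :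
    infChar Q i = some (chr Q hq i) := by
  simp [infChar, chr]

theorem chr_add {Q : List σ} (hq : 0 < Q.length) {s : ℤ} (hs : (Q.length : ℤ) ∣ s) (i : ℤ) :
    chr Q hq (i + s) = chr Q hq i := by
  obtain ⟨e, rfl⟩ := hs
  simp [chr]

/-- In `infFrag` the index is elaborated as an integer and the range is coerced through the list
monad; this is the form with a natural index. -/
theorem infFrag_eq (Q : List σ) (i j : ℤ) :
    infFrag Q i j =
      (List.range (j - i).toNat).filterMap fun t : ℕ => infChar Q (i + (t : ℤ)) := by
  simp only [infFrag, List.pure_def, List.bind_eq_flatMap]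
  rw [← List.map_eq_flatMap, List.filterMap_map]
  rfl

theorem infFrag_eq_map {Q : List σ} (hq : 0 < Q.length) (i j : ℤ) :
    infFrag Q i j = (List.range (j - i).toNat).map fun t : ℕ => chr Q hq (i + (t : ℤ)) := by
  rw [infFrag_eq, ← List.filterMap_eq_map']
  simp only [infChar_eq hq]

theorem length_infFrag {Q : List σ} (hq : 0 < Q.length) (i j : ℤ) :
    (infFrag Q i j).length = (j - i).toNat := by
  simp [infFrag_eq_map hq]

theorem infFrag_self (Q : List σ) (i : ℤ) : infFrag Q i i = [] := by simp [infFrag]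

theorem infFrag_append {Q : List σ} (hq : 0 < Q.length) {i j l : ℤ} (hij : i ≤ j) (hjl : j ≤ l) :
    infFrag Q i j ++ infFrag Q j l = infFrag Q i l := by
  simp only [infFrag_eq_map hq]
  rw [show (l - i).toNat = (j - i).toNat + (l - j).toNat by omega, List.range_add, List.map_append,
    List.map_map]
  congr 1
  apply List.map_congr_left
  intro t _
  simp only [Function.comp]
  congr 1
  push_cast
  omega

theorem infFrag_shift {Q : List σ} (hq : 0 < Q.length) {s : ℤ} (hs : (Q.length : ℤ) ∣ s)
    (i j : ℤ) : infFrag Q (i + s) (j + s) = infFrag Q i j := by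
  simp only [infFrag_eq_map hq]
  rw [show j + s - (i + s) = j - i by ring]
  apply List.map_congr_left
  intro t _
  rw [show i + s + (t : ℤ) = i + t + s by ring, chr_add hq hs]

theorem infFrag_eq_of_dvd {Q : List σ} (hq : 0 < Q.length) {i i' j j' : ℤ}
    (hs : (Q.length : ℤ) ∣ i' - i) (hj : j' - i' = j - i) : infFrag Q i' j' = infFrag Q i j := by
  rw [← infFrag_shift hq hs i j]
  congr 1 <;> omega

theorem chars_infChar (Q : List σ) (i j : ℕ) :
    chars (fun u => infChar Q (u : ℤ)) i j = infFrag Q i j := by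
  rw [chars, infFrag_eq, List.range'_eq_map_range, List.filterMap_map,
    show ((j : ℤ) - (i : ℤ)).toNat = j - i by omega]
  rfl

theorem infFrag_zero_length {Q : List σ} (hq : 0 < Q.length) : infFrag Q 0 Q.length = Q := by
  rw [infFrag_eq_map hq]
  apply List.ext_getElem
  · simp
  · intro u h1 h2
    simp only [List.getElem_map, List.getElem_range, chr]
    congr 1
    rw [zero_add, Int.emod_eq_of_lt (by omega) (by exact_mod_cast h2)]
    simp

theorem getElem?_infFrag {Q : List σ} (hq : 0 < Q.length) (i j : ℤ) {u : ℕ}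
    (hu : (u : ℤ) < j - i) : (infFrag Q i j)[u]? = infChar Q (i + u) := by
  rw [infFrag_eq_map hq, infChar_eq hq, List.getElem?_map, List.getElem?_range (by omega)]
  rfl

theorem frag_infFrag {Q : List σ} (hq : 0 < Q.length) (i j : ℤ) {a b : ℕ} (hab : a ≤ b)
    (hb : (b : ℤ) ≤ j - i) : frag (infFrag Q i j) a b = infFrag Q (i + a) (i + b) := by
  rw [← infFrag_append hq (i := i) (j := i + b) (l := j) (by omega) (by omega),
    ← infFrag_append hq (i := i) (j := i + a) (l := i + b) (by omega) (by omega), frag,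
    List.take_left', List.drop_left']
  · rw [length_infFrag hq]; omega
  · rw [List.length_append, length_infFrag hq, length_infFrag hq]; omega

theorem chr_rot {Q : List σ} (hq : 0 < Q.length) (hq' : 0 < (rot Q).length)
    (hl : (rot Q).length = Q.length) (i : ℤ) : chr (rot Q) hq' i = chr Q hq (i - 1) := by
  have hne : Q ≠ [] := by rintro rfl; simp at hq
  have hr : rot Q = Q.getLast hne :: Q.dropLast := by
    simp [rot, List.getLast?_eq_getLast_of_ne_nil hne]
  have h0 := Int.emod_nonneg i (b := (Q.length : ℤ)) (by omega)
  have h1 := Int.emod_lt_of_pos i (b := (Q.length : ℤ)) (by omega)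
  have h2 := Int.emod_add_mul_ediv i Q.length
  unfold chr
  have key : ∀ (u : ℕ) (h : u < (rot Q).length) (w : ℕ) (h' : w < Q.length),
      (u = 0 ∧ w = Q.length - 1 ∨ u = w + 1) → (rot Q)[u] = Q[w] := by
    intro u h w h' huw
    rcases huw with ⟨rfl, rfl⟩ | rfl
    · simp only [hr, List.getElem_cons_zero]
      rw [List.getLast_eq_getElem]
    · simp [hr]
  apply key
  rw [hl]
  rcases eq_or_lt_of_le h0 with h | h
  · left
    refine ⟨by omega, ?_⟩
    have : (i - 1) % (Q.length : ℤ) = Q.length - 1 := by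
      rw [Int.emod_eq_iff (by omega)]
      refine ⟨by omega, by omega, ?_⟩
      rw [show (Q.length : ℤ) - 1 - (i - 1) = Q.length - i by ring]
      exact dvd_sub_self_left.2 (Int.dvd_of_emod_eq_zero h.symm)
    omega
  · right
    have : (i - 1) % (Q.length : ℤ) = i % Q.length - 1 := by
      rw [Int.emod_eq_iff (by omega)]
      refine ⟨by omega, by omega, ?_⟩
      exact ⟨-(i / Q.length), by linarith⟩
    omega

theorem length_rot (Q : List σ) : (rot Q).length = Q.length := by
  rcases Q.eq_nil_or_concat with rfl | ⟨Q, x, rfl⟩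
  · rfl
  · simp [rot]

theorem length_rot_iterate (Q : List σ) (p : ℕ) : (rot^[p] Q).length = Q.length := by
  induction p with
  | zero => rfl
  | succ p ih => rw [Function.iterate_succ_apply', length_rot, ih]

theorem chr_rot_iterate {Q : List σ} (hq : 0 < Q.length) (p : ℕ) (hq' : 0 < (rot^[p] Q).length)
    (i : ℤ) : chr (rot^[p] Q) hq' i = chr Q hq (i - p) := by
  induction p generalizing i with
  | zero => simp
  | succ p ih =>
    have h : 0 < (rot^[p] Q).length := by rw [length_rot_iterate]; exact hq
    simp only [Function.iterate_succ_apply']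
    rw [chr_rot h, ih h]
    · congr 1; push_cast; ring
    · exact length_rot _

theorem infFrag_rot {Q : List σ} (hq : 0 < Q.length) (p : ℕ) (i j : ℤ) :
    infFrag (rot^[p] Q) i j = infFrag Q (i - p) (j - p) := by
  have h : 0 < (rot^[p] Q).length := by rw [length_rot_iterate]; exact hq
  rw [infFrag_eq_map hq, infFrag_eq_map h, show j - p - (i - p) = j - i by ring]
  apply List.map_congr_left
  intro t _
  rw [chr_rot_iterate hq]
  congr 1
  ring

/-! ### Primitivity -/

/-- Both `q` and `x` are periods of the two-sided string `Q^∞`, hence so is their gcd by Bézout. If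
the gcd were a proper divisor of `q`, then `Q` would be a proper power. -/
theorem IsPrimitive.dvd_of_infFrag_eq {Q : List σ} (hQ : IsPrimitive Q) {x : ℤ}
    (h : infFrag Q x (x + Q.length) = Q) : (Q.length : ℤ) ∣ x := by
  have hq := hQ.length_pos
  have hper : Function.Periodic (chr Q hq) (Q.length : ℤ) := fun i => chr_add hq dvd_rfl i
  have hx0 : ∀ u : ℕ, u < Q.length → chr Q hq (x + u) = chr Q hq u := by
    intro u hu
    have h1 := getElem?_infFrag hq x (x + Q.length) (u := u) (by omega)
    have h2 := getElem?_infFrag hq 0 Q.length (u := u) (by omega)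
    rw [infFrag_zero_length hq, infChar_eq hq] at h2
    rw [h, h2, infChar_eq hq] at h1
    simpa using (Option.some.inj h1).symm
  have hx : Function.Periodic (chr Q hq) x := by
    intro i
    have h1 := hx0 (i % Q.length).toNat (emod_toNat_lt hq i)
    have h0 := Int.emod_nonneg i (b := (Q.length : ℤ)) (by omega)
    have h2 := Int.emod_add_mul_ediv i Q.length
    rw [Int.toNat_of_nonneg h0] at h1
    rw [show i + x = x + i % Q.length + Q.length * (i / Q.length) by linarith,
      chr_add hq (Dvd.intro _ rfl), h1]
    conv_rhs => rw [← h2]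
    rw [chr_add hq (Dvd.intro _ rfl)]
  set g := Int.gcd x Q.length with hg
  have hgper : Function.Periodic (chr Q hq) (g : ℤ) := by
    rw [hg, Int.gcd_eq_gcd_ab, mul_comm x, mul_comm (Q.length : ℤ)]
    exact (hx.int_mul _).add_period (hper.int_mul _)
  have hgq : g ∣ Q.length := by
    have := Int.gcd_dvd_right x Q.length
    exact_mod_cast this
  obtain ⟨e, he⟩ := hgq
  have hg0 : 0 < g := Nat.pos_of_ne_zero (by rintro h; rw [h] at he; omega)
  have hU : ∀ c : ℕ, infFrag Q 0 (c * g : ℕ) = strPow (infFrag Q 0 g) c := by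
    intro c
    induction c with
    | zero => simp [strPow, infFrag]
    | succ c ih =>
      rw [← infFrag_append hq (j := ((c * g : ℕ) : ℤ)) (by positivity)
        (by push_cast; nlinarith), ih, strPow, strPow, List.replicate_succ', List.flatten_append]
      congr 1
      simp only [infFrag_eq_map hq]
      simp only [List.flatten_cons, List.flatten_nil, List.append_nil]
      rw [show (((c + 1) * g : ℕ) - ((c * g : ℕ) : ℤ)).toNat = ((g : ℤ) - 0).toNat by
        push_cast; congr 1; ring]
      apply List.map_congr_left
      intro t _
      have := hgper.nat_mul c (t : ℤ)
      rw [zero_add, ← this]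
      congr 1
      push_cast
      ring
  by_cases he1 : 1 < e
  · exfalso
    apply hQ (infFrag Q 0 g) e he1
    rw [← hU, mul_comm, ← he, infFrag_zero_length hq]
  · have : e = 1 := by
      rcases Nat.eq_zero_or_pos e with h | h
      · rw [h] at he; omega
      · omega
    rw [this, mul_one] at he
    have := Int.gcd_dvd_left x Q.length
    rw [← hg, ← he] at this
    exact this

/-! ### The distances to the periodic extension -/

theorem edSub_le {S Q : List σ} (hq : 0 < Q.length) {i j : ℤ} {c : ℕ} (hij : i ≤ j)
    (h : Ed S (infFrag Q i j) c) : edSub S Q ≤ c := by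
  -- `edSub` only ranges over natural end points, so the fragment is first moved right by whole
  -- periods.
  obtain ⟨e, he⟩ : ∃ e : ℕ, 0 ≤ i + e * Q.length := ⟨i.natAbs, by
    have : (1 : ℤ) ≤ Q.length := by omega
    have h2 : (0 : ℤ) ≤ i.natAbs := by positivity
    nlinarith [neg_abs_le i, Int.natCast_natAbs i]⟩
  rw [← infFrag_shift hq (s := e * Q.length) (Dvd.intro_left _ rfl)] at h
  obtain ⟨i', hi'⟩ := Int.eq_ofNat_of_zero_le he
  obtain ⟨j', hj'⟩ := Int.eq_ofNat_of_zero_le (a := j + e * Q.length) (by omega)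
  rw [hi', hj'] at h
  refine le_trans (Nat.sInf_le (show _ ∈ {c | _} from ⟨i', j', by omega, rfl⟩))
    (editDist_le_iff.2 h)

theorem edPrefix_le {S Q : List σ} {j c : ℕ}
    (h : Ed S (infFrag Q 0 j) c) : edPrefix S Q ≤ c :=
  le_trans (Nat.sInf_le (show _ ∈ {c | _} from ⟨j, rfl⟩)) (editDist_le_iff.2 h)

theorem edPrefix_spec (S Q : List σ) : ∃ j : ℕ, Ed S (infFrag Q 0 j) (edPrefix S Q) := by
  obtain ⟨j, h⟩ := Nat.sInf_mem (s := {c | ∃ j : ℕ, editDist S (infFrag Q 0 j) = c}) ⟨_, 0, rfl⟩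
  exact ⟨j, editDist_le_iff.1 h.le⟩

/-! ### Annotated strings -/

/-- A character of a string together with the part of an alignment onto `Q^∞` at this character:
its cost, the number of characters of `Q^∞` it is aligned with, and the fragment it is locked in. -/
structure Letter (σ : Type*) where
  ch : σ
  cost : ℕ
  adv : ℕ
  lock : Option (ℕ × ℕ)

/-- The underlying string. -/
def chs (X : List (Letter σ)) : List σ := X.map Letter.ch

/-- The total cost. -/
def cst (X : List (Letter σ)) : ℕ := (X.map Letter.cost).sum

/-- The total advance in `Q^∞`. -/
def advance (X : List (Letter σ)) : ℕ := (X.map Letter.adv).sum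

/-- The locked fragment at position `a`. -/
def lk (X : List (Letter σ)) (a : ℕ) : Option (ℕ × ℕ) := X[a]?.bind Letter.lock

@[simp] theorem chs_append (X Y : List (Letter σ)) : chs (X ++ Y) = chs X ++ chs Y := by
  simp [chs]

@[simp] theorem cst_append (X Y : List (Letter σ)) : cst (X ++ Y) = cst X + cst Y := by
  simp [cst]

@[simp] theorem advance_append (X Y : List (Letter σ)) :
    advance (X ++ Y) = advance X + advance Y := by
  simp [advance]

@[simp] theorem length_chs (X : List (Letter σ)) : (chs X).length = X.length := by simp [chs]

theorem chs_frag (X : List (Letter σ)) (i j : ℕ) : chs (frag X i j) = frag (chs X) i j := by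
  simp [chs, frag]

/-- The annotation starting at position `f` of `Q^∞` describes an alignment onto `Q^∞`. -/
def Valid (Q : List σ) : ℤ → List (Letter σ) → Prop
  | _, [] => True
  | f, e :: X => Ed [e.ch] (infFrag Q f (f + e.adv)) e.cost ∧ Valid Q (f + e.adv) X

theorem valid_append {Q : List σ} {f : ℤ} {X Y : List (Letter σ)} :
    Valid Q f (X ++ Y) ↔ Valid Q f X ∧ Valid Q (f + advance X) Y := by
  induction X generalizing f with
  | nil => simp [Valid, advance]
  | cons e X ih =>
    simp only [List.cons_append, Valid, ih, and_assoc]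
    rw [show f + (e.adv : ℤ) + advance X = f + advance (e :: X) by simp [advance]; ring]

theorem Valid.ed {Q : List σ} (hq : 0 < Q.length) {f : ℤ} {X : List (Letter σ)}
    (h : Valid Q f X) : Ed (chs X) (infFrag Q f (f + advance X)) (cst X) := by
  induction X generalizing f with
  | nil => simp [chs, advance, infFrag]; exact .nil _
  | cons e X ih =>
    have h2 := ih h.2
    have := h.1.append h2
    rw [infFrag_append hq (by omega) (by omega)] at this
    have e1 : f + (e.adv : ℤ) + advance X = f + advance (e :: X) := by simp [advance]; ring
    have e2 : e.cost + cst X = cst (e :: X) := by simp [cst]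
    rw [e1, e2] at this
    exact this

theorem Valid.shift {Q : List σ} (hq : 0 < Q.length) {s : ℤ} (hs : (Q.length : ℤ) ∣ s) {f : ℤ}
    {X : List (Letter σ)} (h : Valid Q f X) : Valid Q (f + s) X := by
  induction X generalizing f with
  | nil => trivial
  | cons e X ih =>
    refine ⟨?_, ?_⟩
    · rw [show f + s + (e.adv : ℤ) = f + e.adv + s by ring, infFrag_shift hq hs]
      exact h.1
    · rw [show f + s + (e.adv : ℤ) = f + e.adv + s by ring]
      exact ih h.2

theorem frag_split (X : List σ) {i j : ℕ} (hij : i ≤ j) :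
    X = X.take i ++ frag X i j ++ X.drop j := by
  conv_lhs => rw [← List.take_append_drop j X, ← List.take_append_drop i (X.take j)]
  rw [List.take_take, min_eq_left hij, frag]

theorem frag_of_split {u m s : List σ} : frag (u ++ m ++ s) u.length (u.length + m.length) = m := by
  rw [frag, List.take_left' (by simp), List.drop_left' rfl]

theorem length_frag (X : List σ) {i j : ℕ} (hj : j ≤ X.length) : (frag X i j).length = j - i := by
  simp [frag, hj]

theorem getElem?_frag (X : List σ) {i j u : ℕ} (hu : i + u < j) :
    (frag X i j)[u]? = X[i + u]? := by
  rw [frag, List.getElem?_drop, List.getElem?_take, if_pos hu]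

theorem cst_le_sum_filter (Z : Finset (ℕ × ℕ)) (X : List (Letter σ))
    (hs : ∀ e ∈ X, e.cost ≠ 0 → e.lock ≠ none)
    (h : ∀ e ∈ X, ∀ L, e.lock = some L → L ∈ Z) :
    cst X ≤ ∑ L ∈ Z, cst (X.filter fun e => e.lock = some L) := by
  induction X with
  | nil => simp [cst]
  | cons e X ih =>
    have ih := ih (fun x hx => hs x (List.mem_cons_of_mem _ hx))
      (fun x hx => h x (List.mem_cons_of_mem _ hx))
    have hle : ∀ L, cst (X.filter fun e => e.lock = some L) ≤
        cst ((e :: X).filter fun e => e.lock = some L) := by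
      intro L
      rw [List.filter_cons]
      split_ifs <;> simp [cst]
    have e1 : cst (e :: X) = e.cost + cst X := by simp [cst]
    rcases hl : e.lock with _ | L0
    · have : e.cost = 0 := by
        by_contra hc
        exact hs e (by simp) hc hl
      rw [e1, this, zero_add]
      exact ih.trans (Finset.sum_le_sum fun L _ => hle L)
    · have hL0 := h e (by simp) L0 hl
      rw [← Finset.add_sum_erase _ _ hL0] at ih ⊢
      have h1 : cst ((e :: X).filter fun e => e.lock = some L0) =
          e.cost + cst (X.filter fun e => e.lock = some L0) := by
        rw [List.filter_cons, if_pos (by simpa using hl)]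
        simp [cst]
      rw [h1, e1]
      have := Finset.sum_le_sum (s := Z.erase L0) fun L _ => hle L
      omega

theorem cst_sublist {X Y : List (Letter σ)} (h : X.Sublist Y) : cst X ≤ cst Y :=
  List.Sublist.sum_le_sum (h.map _) (by simp)

/-- An annotated string with locked fragments `mid L`, `L ∈ I`, outside of which the annotation
has no errors. The fragments `L` with `ini L` are prefixes. -/
structure Side (Q : List σ) (f : ℤ) (I : Finset (ℕ × ℕ)) (mid : ℕ × ℕ → List (Letter σ))
    (ini : ℕ × ℕ → Prop) (X : List (Letter σ)) : Prop where
  valid : Valid Q f X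
  supp : ∀ e ∈ X, e.cost ≠ 0 → e.lock ≠ none
  mem : ∀ e ∈ X, ∀ L, e.lock = some L → L ∈ I
  mid_lock : ∀ L ∈ I, ∀ e ∈ mid L, e.lock = some L
  split : ∀ L ∈ I, ∃ u s, X = u ++ mid L ++ s ∧ (∀ e ∈ u ++ s, e.lock ≠ some L) ∧
    (ini L → u = [])

theorem lk_eq_some_iff {u m s : List (Letter σ)} {L : ℕ × ℕ} (hm : ∀ e ∈ m, e.lock = some L)
    (hus : ∀ e ∈ u ++ s, e.lock ≠ some L) (i : ℕ) :
    lk (u ++ m ++ s) i = some L ↔ u.length ≤ i ∧ i < u.length + m.length := by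
  unfold lk
  rcases lt_or_ge i u.length with h | h
  · rw [List.append_assoc, List.getElem?_append_left h, List.getElem?_eq_getElem h]
    have := hus u[i] (by simp)
    simp only [Option.bind_some]
    constructor
    · intro h'; exact absurd h' this
    · omega
  · rcases lt_or_ge i (u.length + m.length) with h' | h'
    · rw [List.getElem?_append_left (by simpa using h'), List.getElem?_append_right h,
        List.getElem?_eq_getElem (by omega)]
      simp only [Option.bind_some]
      have := hm m[i - u.length] (by simp)
      tauto
    · rw [List.getElem?_append_right (by simpa using h')]
      constructor
      · intro h2
        exfalso
        rcases h3 : s[i - (u ++ m).length]? with _ | e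
        · rw [h3] at h2; simp at h2
        · rw [h3] at h2
          exact hus e (by simp [List.mem_of_getElem? h3]) (by simpa using h2)
      · omega

theorem Walk.exists_eq {b : ℕ → ℕ} (hb : Walk b) {s t β : ℕ} (hst : s ≤ t) (h1 : b s ≤ β)
    (h2 : β < b t) : ∃ u, s ≤ u ∧ u < t ∧ b u = β := by
  induction t, hst using Nat.le_induction with
  | base => omega
  | succ t hst ih =>
    rcases lt_or_ge β (b t) with h | h
    · obtain ⟨u, h3, h4, h5⟩ := ih h
      exact ⟨u, h3, by omega, h5⟩
    · refine ⟨t, hst, by omega, ?_⟩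
      rcases hb t with h' | h' <;> omega

theorem Side.filter_eq {Q : List σ} {f : ℤ} {I : Finset (ℕ × ℕ)}
    {mid : ℕ × ℕ → List (Letter σ)} {ini : ℕ × ℕ → Prop} {X : List (Letter σ)}
    (h : Side Q f I mid ini X) {L : ℕ × ℕ} (hL : L ∈ I) :
    X.filter (fun e => e.lock = some L) = mid L := by
  obtain ⟨u, s, h1, h2, -⟩ := h.split L hL
  rw [h1, List.filter_append, List.filter_append]
  rw [List.filter_eq_nil_iff (l := u).2 (fun e he => by simpa using h2 e (by simp [he])),
    List.filter_eq_nil_iff (l := s).2 (fun e he => by simpa using h2 e (by simp [he])),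
    List.filter_eq_self.2 (fun e he => by simpa using h.mid_lock L hL e he)]
  simp

theorem Side.cst_le {Q : List σ} {f : ℤ} {I : Finset (ℕ × ℕ)}
    {mid : ℕ × ℕ → List (Letter σ)} {ini : ℕ × ℕ → Prop} {X : List (Letter σ)}
    (h : Side Q f I mid ini X) {M : List (Letter σ)} (hM : M.Sublist X) {Z : Finset (ℕ × ℕ)}
    (hZ : ∀ e ∈ M, ∀ L, e.lock = some L → L ∈ Z) (hZI : Z ⊆ I) {W : ℕ × ℕ → ℕ}
    (hW : ∀ L ∈ Z, cst (mid L) ≤ W L) : cst M ≤ ∑ L ∈ Z, W L := by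
  refine (cst_le_sum_filter Z M (fun e he => h.supp e (hM.subset he)) hZ).trans
    (Finset.sum_le_sum fun L hL => ?_)
  refine le_trans ?_ (hW L hL)
  rw [← h.filter_eq (hZI hL)]
  exact cst_sublist (hM.filter _)

/-- The part of an alignment at a locked fragment. -/
theorem Side.window {Q : List σ} (hq : 0 < Q.length) {f g : ℤ} {I I' : Finset (ℕ × ℕ)}
    {mid mid' : ℕ × ℕ → List (Letter σ)} {ini ini' : ℕ × ℕ → Prop} {X Y : List (Letter σ)}
    (hX : Side Q f I mid ini X) (hY : Side Q g I' mid' ini' Y) {L : ℕ × ℕ} (hL : L ∈ I)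
    {a b d : ℕ → ℕ} {K : ℕ} (ha : Walk a) (hb : Walk b) (ha0 : a 0 = 0) (hb0 : b 0 = 0)
    (hbK : b K ≤ Y.length) (hc : ∀ i, lk X i = some L → i < a K)
    (hd : ∀ s t, s ≤ t → t ≤ K → Ed (frag (chs X) (a s) (a t)) (frag (chs Y) (b s) (b t))
      (∑ u ∈ Finset.Ico s t, d u))
    {Z : Finset (ℕ × ℕ)} (hZ : ∀ t < K, lk X (a t) = some L → ∀ L', lk Y (b t) = some L' → L' ∈ Z)
    (hZI : Z ⊆ I') {W : ℕ × ℕ → ℕ} (hW : ∀ L' ∈ Z, cst (mid' L') ≤ W L') :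
    ∃ j₁ j₂, j₁ ≤ j₂ ∧ (ini L → j₁ = g) ∧ Ed (chs (mid L)) (infFrag Q j₁ j₂)
      (∑ t ∈ (Finset.range K).filter (fun t => lk X (a t) = some L), d t + ∑ L' ∈ Z, W L') := by
  obtain ⟨u, s, h1, h2, h3⟩ := hX.split L hL
  have hlk : ∀ i, lk X i = some L ↔ u.length ≤ i ∧ i < u.length + (mid L).length := by
    intro i
    rw [h1]
    exact lk_eq_some_iff (hX.mid_lock L hL) h2 i
  rcases Nat.eq_zero_or_pos (mid L).length with h0 | h0
  -- An empty fragment is matched with the empty substring at `g`, which also satisfies the clause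
  -- on `ini`.
  · refine ⟨g, g, le_rfl, fun _ => rfl, ?_⟩
    rw [List.length_eq_zero_iff.1 h0, infFrag_self]
    exact .nil _
  have hr := hc (u.length + (mid L).length - 1) ((hlk _).2 (by omega))
  have hrK : ∃ t, u.length + (mid L).length ≤ a t := ⟨K, by omega⟩
  have hlK : ∃ t, u.length ≤ a t := ⟨K, by omega⟩
  set t₁ := hit a u.length with ht₁
  set t₂ := hit a (u.length + (mid L).length) with ht₂
  have ht₂K : t₂ ≤ K := hit_le (by omega)
  have ht₁₂ : t₁ ≤ t₂ := hit_mono (by omega) hrK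
  have hat₁ : a t₁ = u.length := at_hit ha (by omega) hlK
  have hat₂ : a t₂ = u.length + (mid L).length := at_hit ha (by omega) hrK
  have hset : (Finset.range K).filter (fun t => lk X (a t) = some L) = Finset.Ico t₁ t₂ := by
    ext t
    rw [mem_Ico_hit ha hrK (by omega), Finset.mem_filter, Finset.mem_range, hlk]
    constructor
    · exact fun h => h.2
    · intro h
      refine ⟨?_, h⟩
      by_contra hK
      have := ha.monotone (not_lt.1 hK)
      omega
  have hbm : b t₁ ≤ b t₂ := hb.monotone ht₁₂
  have hb2 : b t₂ ≤ Y.length := (hb.monotone ht₂K).trans hbK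
  have hEd := hd t₁ t₂ ht₁₂ ht₂K
  rw [hat₁, hat₂, ← chs_frag, ← chs_frag, h1, frag_of_split] at hEd
  have hv := hY.valid
  rw [frag_split Y hbm, valid_append, valid_append] at hv
  have hEd' := hv.1.2.ed hq
  -- Every position of the window of `Y` is visited at a time in `[t₁, t₂)`, when the walk on `X`
  -- stands in `L`; so the locked fragments occurring in the window belong to `Z`.
  have hcst : cst (frag Y (b t₁) (b t₂)) ≤ ∑ L' ∈ Z, W L' := by
    apply hY.cst_le _ _ hZI hW
    · exact (List.drop_sublist _ _).trans (List.take_sublist _ _)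
    · intro e he L' hL'
      obtain ⟨i, hi, rfl⟩ := List.mem_iff_getElem.1 he
      rw [length_frag Y hb2] at hi
      obtain ⟨t, hs1, hs2, hs3⟩ := hb.exists_eq ht₁₂ (β := b t₁ + i) (by omega) (by omega)
      refine hZ t (by omega) ?_ L' ?_
      · rw [hlk, ← mem_Ico_hit ha hrK (by omega)]
        exact Finset.mem_Ico.2 ⟨hs1, hs2⟩
      · rw [lk, hs3, ← getElem?_frag Y (j := b t₂) (by omega),
          List.getElem?_eq_getElem (by rw [length_frag Y hb2]; exact hi)]
        exact hL'
  -- Triangle inequality: from `L` to the window of `Y` by the given alignment, then to `Q^∞` by the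
  -- annotation of `Y`.
  refine ⟨_, _, ?_, ?_, (hEd.trans hEd').mono ?_⟩
  · omega
  · intro hi
    have : t₁ = 0 := by
      have h5 := h3 hi
      have : t₁ ≤ 0 := hit_le (by rw [h5]; simp)
      omega
    rw [this, hb0]
    simp [advance]
  · rw [hset]
    omega

theorem drift_le_of_cost {X Y : ℕ → Option σ} {a b : ℕ → ℕ} (ha : Walk a) (hb : Walk b)
    (ha0 : a 0 = 0) (hb0 : b 0 = 0) {K k : ℕ}
    (hk : ∑ t ∈ Finset.range K, stepCost X Y a b t ≤ k) {t : ℕ} (ht : t ≤ K) :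
    a t ≤ b t + k ∧ b t ≤ a t + k := by
  have h1 := drift_le (X := X) (Y := Y) ha hb (Nat.zero_le t)
  have h2 : ∑ u ∈ Finset.Ico 0 t, stepCost X Y a b u ≤ k := by
    rw [← Finset.range_eq_Ico]
    exact (Finset.sum_le_sum_of_subset (Finset.range_subset_range.2 ht)).trans hk
  omega

/-- The path is priced against all of `Y` rather than its prefix. Before time `K` a diagonal step
reads a position below `y`, where the two agree. -/
theorem Ed.exists_path_take {X Y : List σ} {y c : ℕ} (hy : y ≤ Y.length)
    (h : Ed X (Y.take y) c) :
    ∃ (a b : ℕ → ℕ) (K : ℕ), Walk a ∧ Walk b ∧ a 0 = 0 ∧ b 0 = 0 ∧ a K = X.length ∧ b K = y ∧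
      ∑ u ∈ Finset.range K, stepCost (fun i => X[i]?) (fun i => Y[i]?) a b u ≤ c := by
  obtain ⟨a, b, K, ha, hb, ha0, hb0, haK, hbK, hcost⟩ := h.exists_path
  rw [List.length_take, min_eq_left hy] at hbK
  refine ⟨a, b, K, ha, hb, ha0, hb0, haK, hbK, le_trans (Finset.sum_le_sum fun t ht => ?_) hcost⟩
  have ht := Finset.mem_range.1 ht
  by_cases h : a (t + 1) = a t + 1 ∧ b (t + 1) = b t + 1 ∧ X[a t]? = (Y.take y)[b t]?
  · have : b (t + 1) ≤ b K := hb.monotone ht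
    have h2 := h.2.2
    rw [List.getElem?_take, if_pos (by omega)] at h2
    rw [stepCost, if_pos ⟨h.1, h.2.1, h2⟩]
    exact Nat.zero_le _
  · unfold stepCost
    rw [if_neg h]
    split_ifs <;> omega

/-- The setting of the lower bound: two annotated strings, weights of the locked fragments, and
marks `μ` that dominate the smaller weight of each pair of locked fragments that come close. -/
structure Setting (Q : List σ) (k : ℕ) (f g : ℤ) (I I' S : Finset (ℕ × ℕ))
    (mid mid' : ℕ × ℕ → List (Letter σ)) (L₀ : ℕ × ℕ) (W W' : ℕ × ℕ → ℕ)
    (μ : ℕ × ℕ → ℕ × ℕ → ℕ) (X Y : List (Letter σ)) : Prop where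
  left : Side Q f I mid (· = L₀) X
  right : Side Q g I' mid' (fun _ => False) Y
  near : ∀ a b L L', lk X a = some L → lk Y b = some L' → a ≤ b + k → b ≤ a + k →
    (L ≠ L₀ ∧ W L ≤ μ L L') ∨ W' L' ≤ μ L L'
  -- A path of cost at most `k` that ends at `X.length` passes all of these positions, so the whole
  -- of `L'` is aligned.
  inside : ∀ L' ∈ S, ∀ b, lk Y b = some L' → b + k < X.length

/-- The weights are the distances of the locked fragments to `Q^∞`; the weight of the
first fragment of the left string is measured from a fixed starting position. -/
structure Weights (Q : List σ) (g : ℤ) (I I' S : Finset (ℕ × ℕ))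
    (mid mid' : ℕ × ℕ → List (Letter σ)) (L₀ : ℕ × ℕ) (W W' : ℕ × ℕ → ℕ) : Prop where
  memL : L₀ ∈ I
  sub : S ⊆ I'
  costW : ∀ L ∈ I, L ≠ L₀ → cst (mid L) ≤ W L
  leW : ∀ L ∈ I, L ≠ L₀ → W L ≤ edSub (chs (mid L)) Q
  -- The alignment starts at the beginning of `Y`, where the annotation is at position `g` of `Q^∞`,
  -- so `L₀` cannot choose its starting point.
  leW0 : ∀ j c, g ≤ j → Ed (chs (mid L₀)) (infFrag Q g j) c → W L₀ ≤ c
  costW' : ∀ L ∈ I', cst (mid' L) ≤ W' L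
  leW' : ∀ L ∈ I', W' L ≤ edSub (chs (mid' L)) Q

/-- After exchanging sums, each time contributes at most once: a label is unique on each side,
labels of `A` and `A'` never occur together, and the first sum only sees unlabelled times. -/
theorem sum_winner_le {ι : Type*} [DecidableEq ι] {K : ℕ} (d : ℕ → ℕ) (l l' : ℕ → Option ι)
    (A A' : Finset ι)
    (h : ∀ t < K, ∀ L ∈ A, ∀ L' ∈ A', l t = some L → l' t = some L' → False) :
    ∑ t ∈ (Finset.range K).filter (fun t => l t = none ∧ l' t = none), d t +
      ∑ L ∈ A, ∑ t ∈ (Finset.range K).filter (fun t => l t = some L), d t +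
      ∑ L ∈ A', ∑ t ∈ (Finset.range K).filter (fun t => l' t = some L), d t ≤
    ∑ t ∈ Finset.range K, d t := by
  simp only [Finset.sum_filter]
  rw [Finset.sum_comm (s := A), Finset.sum_comm (s := A'), ← Finset.sum_add_distrib,
    ← Finset.sum_add_distrib]
  apply Finset.sum_le_sum
  intro t ht
  have key : ∀ (B : Finset ι) (o : Option ι), (∑ L ∈ B, if o = some L then d t else 0) ≤ d t ∧
      ((∑ L ∈ B, if o = some L then d t else 0) ≠ 0 → ∃ L ∈ B, o = some L) := by
    intro B o
    constructor
    · rcases o with _ | L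
      · simp
      · simp only [Option.some.injEq]
        rw [Finset.sum_ite_eq]
        split_ifs <;> omega
    · intro hne
      obtain ⟨L, hL, h⟩ := Finset.exists_ne_zero_of_sum_ne_zero hne
      exact ⟨L, hL, by by_contra hc; simp [hc] at h⟩
  obtain ⟨h1, h2⟩ := key A (l t)
  obtain ⟨h3, h4⟩ := key A' (l' t)
  by_cases hz : (∑ L ∈ A, if l t = some L then d t else 0) = 0
  · rw [hz]
    by_cases hz' : (∑ L ∈ A', if l' t = some L then d t else 0) = 0
    · rw [hz']; split_ifs <;> omega
    · obtain ⟨L, hL, hl⟩ := h4 hz'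
      rw [if_neg (by rw [hl]; simp)]
      omega
  · obtain ⟨L, hL, hl⟩ := h2 hz
    have : (∑ L ∈ A', if l' t = some L then d t else 0) = 0 := by
      by_contra hz'
      obtain ⟨L', hL', hl'⟩ := h4 hz'
      exact h t (Finset.mem_range.1 ht) L hL L' hL' hl hl'
    rw [this, if_neg (by rw [hl]; simp)]
    omega

/-! ### The lower bound for the cost of an alignment at a position with few marks. -/

section Core

variable {Q : List σ} {k : ℕ} {f g : ℤ} {I I' S : Finset (ℕ × ℕ)}
  {mid mid' : ℕ × ℕ → List (Letter σ)} {L₀ : ℕ × ℕ} {W W' : ℕ × ℕ → ℕ}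
  {μ : ℕ × ℕ → ℕ × ℕ → ℕ} {X Y : List (Letter σ)} {a b : ℕ → ℕ} {K : ℕ}

/-- As `L` outweighs its marks, `near` says that every locked fragment `L'` of `Y` met by `L` has
weight at most `μ L L'`. The detour through `Q^∞` in `Side.window` therefore costs at most the marks
of `L`. -/
theorem Setting.left_window (hq : 0 < Q.length)
    (h : Setting Q k f g I I' S mid mid' L₀ W W' μ X Y)
    (hw : Weights Q g I I' S mid mid' L₀ W W') (ha : Walk a) (hb : Walk b) (ha0 : a 0 = 0)
    (hb0 : b 0 = 0) (haK : a K = X.length) (hbK : b K ≤ Y.length)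
    (hk : ∑ t ∈ Finset.range K, stepCost (fun i => (chs X)[i]?) (fun i => (chs Y)[i]?) a b t ≤ k)
    {L : ℕ × ℕ} (hL : L ∈ I) (hwin : ∑ L' ∈ I', μ L L' < W L) :
    W L ≤ ∑ L' ∈ I', μ L L' + ∑ t ∈ (Finset.range K).filter (fun t => lk X (a t) = some L),
      stepCost (fun i => (chs X)[i]?) (fun i => (chs Y)[i]?) a b t := by
  classical
  set d := stepCost (fun i => (chs X)[i]?) (fun i => (chs Y)[i]?) a b with hd
  have hXl : (chs X).length = X.length := length_chs X
  have hYl : (chs Y).length = Y.length := length_chs Y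
  have hdr := fun t ht => drift_le_of_cost ha hb ha0 hb0 hk (t := t) ht
  let Z := I'.filter fun L' => W' L' ≤ μ L L'
  obtain ⟨j₁, j₂, hj, hini, hEd⟩ := h.left.window hq h.right hL (d := d) (K := K) ha hb ha0 hb0 hbK
    (by
      intro i hi
      rw [haK]
      by_contra hc
      rw [lk, List.getElem?_eq_none (by omega)] at hi
      simp at hi)
    (by
      intro s t hst ht
      have := ed_subpath (fun i => (chs X)[i]?) (fun i => (chs Y)[i]?) ha hb hst
      rwa [← frag_eq_chars, ← frag_eq_chars] at this
      · have := hb.monotone ht; omega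
      · have := ha.monotone ht; omega)
    (Z := Z)
    (by
      intro t ht h1 L' h2
      have h3 := hdr t ht.le
      have hL' : L' ∈ I' := by
        rw [lk] at h2
        rcases h4 : Y[b t]? with _ | e
        · rw [h4] at h2; simp at h2
        · rw [h4] at h2
          exact h.right.mem e (List.mem_of_getElem? h4) L' (by simpa using h2)
      refine Finset.mem_filter.2 ⟨hL', ?_⟩
      rcases h.near _ _ _ _ h1 h2 h3.1 h3.2 with h4 | h4
      · have := Finset.single_le_sum (f := μ L) (fun _ _ => Nat.zero_le _) hL'
        omega
      · exact h4)
    (Finset.filter_subset _ _) (W := W')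
    (fun L' hL' => hw.costW' L' (Finset.filter_subset _ _ hL'))
  have hle : W L ≤ ∑ t ∈ (Finset.range K).filter (fun t => lk X (a t) = some L), d t +
      ∑ L' ∈ Z, W' L' := by
    by_cases h0 : L = L₀
    · subst h0
      rw [hini rfl] at hEd hj
      exact hw.leW0 _ _ hj hEd
    · exact (hw.leW L hL h0).trans (edSub_le hq hj hEd)
  have h5 : ∑ L' ∈ Z, W' L' ≤ ∑ L' ∈ I', μ L L' :=
    (Finset.sum_le_sum fun L' hL' => (Finset.mem_filter.1 hL').2).trans
      (Finset.sum_le_sum_of_subset (Finset.filter_subset _ _))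
  omega

/-- The mirror image of `Setting.left_window`, with the walks exchanged. Here `near` also excludes
`L₀` from the fragments met, whose annotated cost `Weights` does not control, and `inside`
guarantees that the path crosses all of `L'`. -/
theorem Setting.right_window (hq : 0 < Q.length)
    (h : Setting Q k f g I I' S mid mid' L₀ W W' μ X Y)
    (hw : Weights Q g I I' S mid mid' L₀ W W') (ha : Walk a) (hb : Walk b) (ha0 : a 0 = 0)
    (hb0 : b 0 = 0) (haK : a K = X.length) (hbK : b K ≤ Y.length)
    (hk : ∑ t ∈ Finset.range K, stepCost (fun i => (chs X)[i]?) (fun i => (chs Y)[i]?) a b t ≤ k)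
    {L' : ℕ × ℕ} (hL' : L' ∈ S) (hwin : ∑ L ∈ I, μ L L' < W' L') :
    W' L' ≤ ∑ L ∈ I, μ L L' + ∑ t ∈ (Finset.range K).filter (fun t => lk Y (b t) = some L'),
      stepCost (fun i => (chs X)[i]?) (fun i => (chs Y)[i]?) a b t := by
  classical
  set d := stepCost (fun i => (chs X)[i]?) (fun i => (chs Y)[i]?) a b with hd
  have hXl : (chs X).length = X.length := length_chs X
  have hYl : (chs Y).length = Y.length := length_chs Y
  have hdr := fun t ht => drift_le_of_cost ha hb ha0 hb0 hk (t := t) ht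
  let Z := I.filter fun L => L ≠ L₀ ∧ W L ≤ μ L L'
  obtain ⟨j₁, j₂, hj, -, hEd⟩ := h.right.window hq h.left (hw.sub hL') (d := d) (K := K) hb ha hb0 ha0
    haK.le
    (by
      intro i hi
      have h1 := h.inside L' hL' i hi
      have h2 := hdr K le_rfl
      omega)
    (by
      intro s t hst ht
      have := ed_subpath (fun i => (chs X)[i]?) (fun i => (chs Y)[i]?) ha hb hst
      rw [← frag_eq_chars, ← frag_eq_chars] at this
      · exact this.symm
      · have := hb.monotone ht; omega
      · have := ha.monotone ht; omega)
    (Z := Z)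
    (by
      intro t ht h1 L h2
      have h3 := hdr t ht.le
      have hL : L ∈ I := by
        rw [lk] at h2
        rcases h4 : X[a t]? with _ | e
        · rw [h4] at h2; simp at h2
        · rw [h4] at h2
          exact h.left.mem e (List.mem_of_getElem? h4) L (by simpa using h2)
      refine Finset.mem_filter.2 ⟨hL, ?_⟩
      rcases h.near _ _ _ _ h2 h1 h3.1 h3.2 with h4 | h4
      · exact h4
      · have := Finset.single_le_sum (f := fun L => μ L L') (fun _ _ => Nat.zero_le _) hL
        omega)
    (Finset.filter_subset _ _) (W := W)
    (fun L hL => hw.costW L (Finset.filter_subset _ _ hL) (Finset.mem_filter.1 hL).2.1)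
  have hle := (hw.leW' L' (hw.sub hL')).trans (edSub_le hq hj hEd)
  have h5 : ∑ L ∈ Z, W L ≤ ∑ L ∈ I, μ L L' :=
    (Finset.sum_le_sum fun L hL => (Finset.mem_filter.1 hL).2.2).trans
      (Finset.sum_le_sum_of_subset (Finset.filter_subset _ _))
  omega

/-- Call a fragment a winner if its weight exceeds its marks. Losers are paid for by their marks,
winners by their marks and the cost at their positions; the total of the marks is used once for each
string. Winners of opposite strings cannot meet, since `near` would make one of them a loser. -/
theorem Setting.lower_bound (hq : 0 < Q.length)
    (h : Setting Q k f g I I' S mid mid' L₀ W W' μ X Y)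
    (hw : Weights Q g I I' S mid mid' L₀ W W') (ha : Walk a) (hb : Walk b) (ha0 : a 0 = 0)
    (hb0 : b 0 = 0) (haK : a K = X.length) (hbK : b K ≤ Y.length)
    (hk : ∑ t ∈ Finset.range K, stepCost (fun i => (chs X)[i]?) (fun i => (chs Y)[i]?) a b t ≤ k) :
    ∑ t ∈ (Finset.range K).filter (fun t => lk X (a t) = none ∧ lk Y (b t) = none),
        stepCost (fun i => (chs X)[i]?) (fun i => (chs Y)[i]?) a b t +
      (∑ L ∈ I, W L + ∑ L' ∈ S, W' L') ≤
    ∑ t ∈ Finset.range K, stepCost (fun i => (chs X)[i]?) (fun i => (chs Y)[i]?) a b t +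
      2 * ∑ L ∈ I, ∑ L' ∈ I', μ L L' := by
  classical
  have hl := fun {L} => h.left_window hq hw ha hb ha0 hb0 haK hbK hk (L := L)
  have hr := fun {L} => h.right_window hq hw ha hb ha0 hb0 haK hbK hk (L' := L)
  set d := stepCost (fun i => (chs X)[i]?) (fun i => (chs Y)[i]?) a b with hd
  have hdr := fun t ht => drift_le_of_cost ha hb ha0 hb0 hk (t := t) ht
  let A := I.filter fun L => ∑ L' ∈ I', μ L L' < W L
  let A' := S.filter fun L' => ∑ L ∈ I, μ L L' < W' L'
  have hmain := sum_winner_le (K := K) d (fun t => lk X (a t)) (fun t => lk Y (b t)) A A' (by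
    intro t ht L hL L' hL' h1 h2
    obtain ⟨hL, hL2⟩ := Finset.mem_filter.1 hL
    obtain ⟨hL', hL2'⟩ := Finset.mem_filter.1 hL'
    have h3 := hdr t ht.le
    have h5 := Finset.single_le_sum (f := μ L) (fun _ _ => Nat.zero_le _) (hw.sub hL')
    have h6 := Finset.single_le_sum (f := fun L => μ L L') (fun _ _ => Nat.zero_le _) hL
    rcases h.near _ _ _ _ h1 h2 h3.1 h3.2 with h4 | h4 <;> omega)
  have e1 : ∑ L ∈ I, W L ≤ ∑ L ∈ I, ∑ L' ∈ I', μ L L' +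
      ∑ L ∈ A, ∑ t ∈ (Finset.range K).filter (fun t => lk X (a t) = some L), d t := by
    rw [Finset.sum_filter, ← Finset.sum_add_distrib]
    apply Finset.sum_le_sum
    intro L hL
    split_ifs with hc
    · exact hl hL hc
    · omega
  have e2 : ∑ L' ∈ S, W' L' ≤ ∑ L ∈ I, ∑ L' ∈ I', μ L L' +
      ∑ L ∈ A', ∑ t ∈ (Finset.range K).filter (fun t => lk Y (b t) = some L), d t := by
    have e3 : ∑ L' ∈ S, ∑ L ∈ I, μ L L' ≤ ∑ L ∈ I, ∑ L' ∈ I', μ L L' := by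
      rw [Finset.sum_comm (s := I)]
      exact Finset.sum_le_sum_of_subset hw.sub
    refine le_trans ?_ (Nat.add_le_add_right e3 _)
    rw [Finset.sum_filter, ← Finset.sum_add_distrib]
    apply Finset.sum_le_sum
    intro L hL
    split_ifs with hc
    · exact hr hL hc
    · omega
  omega

/-- Makes the hypothesis of the `2d`-locked prefix available: an alignment of small cost bounds the
weight of the first fragment, whether that fragment is a winner or is dominated by its marks. -/
theorem Setting.first_weight_le (hq : 0 < Q.length)
    (h : Setting Q k f g I I' S mid mid' L₀ W W' μ X Y)
    (hw : Weights Q g I I' S mid mid' L₀ W W') {y c : ℕ} (hy : y ≤ Y.length)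
    (hEd : Ed (chs X) ((chs Y).take y) c) (hc : c ≤ k) :
    W L₀ ≤ c + ∑ L ∈ I, ∑ L' ∈ I', μ L L' := by
  classical
  obtain ⟨a, b, K, ha, hb, ha0, hb0, haK, hbK, hle⟩ :=
    hEd.exists_path_take (by rwa [length_chs])
  rw [length_chs] at haK
  by_cases hwin : ∑ L' ∈ I', μ L₀ L' < W L₀
  · have := h.left_window hq hw ha hb ha0 hb0 haK (by omega)
      (hle.trans hc) hw.memL hwin
    have h2 : ∑ L' ∈ I', μ L₀ L' ≤ ∑ L ∈ I, ∑ L' ∈ I', μ L L' :=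
      Finset.single_le_sum (f := fun L => ∑ L' ∈ I', μ L L') (fun _ _ => Nat.zero_le _) hw.memL
    have h3 : ∑ t ∈ (Finset.range K).filter (fun t => lk X (a t) = some L₀),
      stepCost (fun i => (chs X)[i]?) (fun i => (chs Y)[i]?) a b t ≤
      ∑ t ∈ Finset.range K, stepCost (fun i => (chs X)[i]?) (fun i => (chs Y)[i]?) a b t :=
      Finset.sum_le_sum_of_subset (Finset.filter_subset _ _)
    omega
  · have h2 : ∑ L' ∈ I', μ L₀ L' ≤ ∑ L ∈ I, ∑ L' ∈ I', μ L L' :=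
      Finset.single_le_sum (f := fun L => ∑ L' ∈ I', μ L L') (fun _ _ => Nat.zero_le _) hw.memL
    omega

end Core

end PuzzleMatching

namespace PuzzleMatching

variable {σ : Type*}

/-! ### Removing and duplicating tiles of a periodic run -/

theorem strPow_add (V : List σ) (i j : ℕ) : strPow V (i + j) = strPow V i ++ strPow V j := by
  rw [strPow, List.replicate_add, List.flatten_append]
  rfl

theorem strPow_one (V : List σ) : strPow V 1 = V := by simp [strPow]

theorem length_strPow (V : List σ) (i : ℕ) : (strPow V i).length = i * V.length := by
  simp [strPow]

theorem append_strPow_comm (U V : List σ) (r : ℕ) :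
    U ++ strPow (V ++ U) r = strPow (U ++ V) r ++ U := by
  induction r with
  | zero => simp [strPow]
  | succ r ih =>
    rw [strPow_add, strPow_add, strPow_one, strPow_one, ← List.append_assoc, ih]
    simp only [List.append_assoc]

/-- A window of length `|V|` in the run need not be in phase with the tiles: it is a rotation `V₂V₁`
of `V = V₁V₂`. Since `V₁(V₂V₁)^r = (V₁V₂)^r V₁`, replacing it by `r` copies of itself still only
changes the exponent. -/
theorem replace_tile (A V B : List σ) {n y : ℕ} (hV : 0 < V.length) (h1 : A.length ≤ y)
    (h2 : y + V.length ≤ A.length + n * V.length) (r : ℕ) :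
    (A ++ strPow V n ++ B).take y ++
        strPow (frag (A ++ strPow V n ++ B) y (y + V.length)) r ++
        (A ++ strPow V n ++ B).drop (y + V.length) =
      A ++ strPow V (n - 1 + r) ++ B := by
  set τ := V.length with hτ
  set s := (y - A.length) / τ with hs
  set ρ := (y - A.length) % τ with hρ
  have hy : y = A.length + s * τ + ρ := by
    have := Nat.div_add_mod (y - A.length) τ
    rw [← hs, ← hρ, mul_comm] at this
    omega
  have hρτ : ρ < τ := Nat.mod_lt _ hV
  have hsn : s + 1 ≤ n := by
    by_contra hc
    have : n * τ ≤ s * τ := Nat.mul_le_mul_right _ (by omega)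
    omega
  clear_value s ρ
  obtain ⟨H, hH⟩ : ∃ H, strPow V (n - s - 1) ++ B = V.take ρ ++ H := by
    rcases Nat.eq_zero_or_pos ρ with h0 | h0
    · exact ⟨_, by rw [h0]; simp; rfl⟩
    · have : s + 2 ≤ n := by
        by_contra hc
        have : n * τ ≤ (s + 1) * τ := Nat.mul_le_mul_right _ (by omega)
        rw [add_mul] at this
        omega
      refine ⟨V.drop ρ ++ (strPow V (n - s - 2) ++ B), ?_⟩
      rw [show n - s - 1 = 1 + (n - s - 2) by omega, strPow_add, strPow_one]
      rw [← List.append_assoc (V.take ρ), List.take_append_drop, List.append_assoc]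
  have hX : A ++ strPow V n ++ B =
      (A ++ strPow V s ++ V.take ρ) ++ (V.drop ρ ++ V.take ρ) ++ H := by
    have e1 : strPow V n = strPow V s ++ (V ++ strPow V (n - s - 1)) := by
      conv_rhs => rw [← strPow_one V]
      simp only [strPow_one]
      conv_rhs => enter [2, 1]; rw [← strPow_one V]
      rw [← strPow_add, ← strPow_add]
      congr 1
      omega
    have e2 : V ++ (V.take ρ ++ H) = V.take ρ ++ (V.drop ρ ++ (V.take ρ ++ H)) := by
      rw [← List.append_assoc (V.take ρ), List.take_append_drop]
    rw [e1]
    simp only [List.append_assoc]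
    rw [hH, e2]
  have hl1 : (A ++ strPow V s ++ V.take ρ).length = y := by
    simp only [List.length_append, length_strPow, List.length_take, ← hτ]
    rw [min_eq_left hρτ.le]
    omega
  have hl2 : (V.drop ρ ++ V.take ρ).length = τ := by
    simp only [List.length_append, List.length_take, List.length_drop, ← hτ]
    omega
  have hfr : frag (A ++ strPow V n ++ B) y (y + τ) = V.drop ρ ++ V.take ρ := by
    have := frag_of_split (u := A ++ strPow V s ++ V.take ρ) (m := V.drop ρ ++ V.take ρ) (s := H)
    rw [hl1, hl2] at this
    rw [hX, this]
  have e3 : n - 1 + r = s + (r + (n - s - 1)) := by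
    omega
  rw [hfr, hX, List.append_assoc _ _ H, List.take_left' hl1, ← List.append_assoc _ _ H,
    List.drop_left' (by rw [List.length_append, hl1, hl2]), List.append_assoc (A ++ strPow V s),
    append_strPow_comm, List.take_append_drop, List.append_assoc, List.append_assoc _ _ H, ← hH,
    e3, strPow_add, strPow_add]
  simp only [List.append_assoc]

/-- A periodic string annotated by an error-free alignment. -/
def plainTile (V : List σ) : List (Letter σ) := V.map fun x => ⟨x, 0, 1, none⟩

@[simp] theorem chs_plainTile (V : List σ) : chs (plainTile V) = V := by
  simp [chs, plainTile, Function.comp_def]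

@[simp] theorem length_plainTile (V : List σ) : (plainTile V).length = V.length := by
  simp [plainTile]

theorem advance_plainTile (V : List σ) : advance (plainTile V) = V.length := by
  simp [advance, plainTile, Function.comp_def]

theorem lock_plainTile {V : List σ} {e : Letter σ} (he : e ∈ plainTile V) : e.lock = none := by
  simp only [plainTile, List.mem_map] at he
  obtain ⟨x, -, rfl⟩ := he
  rfl

theorem chs_strPow (X : List (Letter σ)) (n : ℕ) : chs (strPow X n) = strPow (chs X) n := by
  simp [chs, strPow, List.map_flatten]

theorem mem_strPow {X : List σ} {n : ℕ} {e : σ} (h : e ∈ strPow X n) : e ∈ X := by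
  simp only [strPow, List.mem_flatten, List.mem_replicate] at h
  obtain ⟨l, ⟨-, rfl⟩, h⟩ := h
  exact h

theorem lk_eq_none_of_mid {A M B : List (Letter σ)} (hM : ∀ e ∈ M, e.lock = none) {i : ℕ}
    (h1 : A.length ≤ i) (h2 : i < A.length + M.length) : lk (A ++ M ++ B) i = none := by
  rw [lk, List.getElem?_append_left (by simpa using h2), List.getElem?_append_right h1,
    List.getElem?_eq_getElem (by omega)]
  exact hM _ (by simp)

/-- What follows `V` is shifted in `Q^∞` by a multiple of `q`, so its annotation stays valid. A
non-empty locked fragment is contiguous and avoids `V`, hence survives whole on one side. -/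
theorem Side.remove {Q : List σ} (hq : 0 < Q.length) {f : ℤ} {I : Finset (ℕ × ℕ)}
    {mid : ℕ × ℕ → List (Letter σ)} {ini : ℕ × ℕ → Prop} {A V B : List (Letter σ)}
    (h : Side Q f I mid ini (A ++ V ++ B)) (hV : V ≠ []) (hlock : ∀ e ∈ V, e.lock = none)
    (hadv : (Q.length : ℤ) ∣ advance V) : Side Q f I mid ini (A ++ B) where
  valid := by
    have h1 := h.valid
    rw [valid_append, valid_append] at h1
    rw [valid_append]
    refine ⟨h1.1.1, ?_⟩
    have h2 := h1.2.shift hq (s := -(advance V : ℤ)) (by simpa using hadv)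
    rw [advance_append] at h2
    convert h2 using 1
    push_cast
    ring
  supp e he := h.supp e (by grind)
  mem e he := h.mem e (by grind)
  mid_lock := h.mid_lock
  split L hL := by
    obtain ⟨u, s, h1, h2, h3⟩ := h.split L hL
    have hm := h.mid_lock L hL
    rcases eq_or_ne (mid L) [] with h0 | h0
    -- An empty fragment may sit inside the removed block; since no letter carries its label, it can
    -- be placed at the front.
    · refine ⟨[], A ++ B, by simp [h0], ?_, fun _ => rfl⟩
      intro e he
      apply h2
      have : e ∈ A ++ V ++ B := by grind
      rw [h1, h0] at this
      simpa using this
    have hlk := fun i => lk_eq_some_iff (hm) h2 i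
    rw [← h1] at hlk
    have hnone := fun i => lk_eq_none_of_mid (A := A) (B := B) hlock (i := i)
    have hm0 := List.length_pos_of_ne_nil h0
    have hV0 := List.length_pos_of_ne_nil hV
    have c1 : ¬ (u.length ≤ A.length ∧ A.length < u.length + (mid L).length) := by
      rw [← hlk, hnone _ le_rfl (by omega)]; simp
    have c2 : ¬ (A.length ≤ u.length ∧ u.length < A.length + V.length) := by
      rintro ⟨h4, h5⟩
      have := (hlk u.length).2 (by omega)
      rw [hnone _ h4 h5] at this
      simp at this
    rcases (show u.length + (mid L).length ≤ A.length ∨ A.length + V.length ≤ u.length by omega)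
      with hc | hc
    · rw [List.append_assoc A, List.append_eq_append_iff] at h1
      have h1' : ∃ c, A = u ++ mid L ++ c ∧ s = c ++ (V ++ B) := by
        rcases h1 with ⟨c, h4, h5⟩ | ⟨c, h4, h5⟩
        · have hl := congrArg List.length h4
          simp only [List.length_append] at hl
          have : c = [] := List.length_eq_zero_iff.1 (by omega)
          subst this
          exact ⟨[], by simpa using h4.symm, by simpa using h5.symm⟩
        · exact ⟨c, h4, h5⟩
      obtain ⟨c, h4, h5⟩ := h1'
      refine ⟨u, c ++ B, by rw [h4]; simp, ?_, h3⟩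
      intro e he
      apply h2
      rw [h5]
      grind
    · rw [List.append_assoc u, List.append_eq_append_iff] at h1
      have h1' : ∃ c, u = A ++ V ++ c ∧ B = c ++ (mid L ++ s) := by
        rcases h1 with ⟨c, h4, h5⟩ | ⟨c, h4, h5⟩
        · exact ⟨c, h4, h5⟩
        · have hl := congrArg List.length h4
          simp only [List.length_append] at hl
          have : c = [] := List.length_eq_zero_iff.1 (by omega)
          subst this
          exact ⟨[], by simpa using h4.symm, by simpa using h5.symm⟩
      obtain ⟨c, h4, h5⟩ := h1'
      refine ⟨A ++ c, s, by rw [h5]; simp, ?_, ?_⟩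
      · intro e he
        apply h2
        rw [h4]
        grind
      · intro hi
        have := h3 hi
        rw [h4] at this
        simp at this
        exact absurd this.2.1 hV

section Transport

variable {Q : List σ} {k : ℕ} {f g : ℤ} {I I' S : Finset (ℕ × ℕ)}
  {mid mid' : ℕ × ℕ → List (Letter σ)} {L₀ : ℕ × ℕ} {W W' : ℕ × ℕ → ℕ}
  {μ : ℕ × ℕ → ℕ × ℕ → ℕ} {V : List σ}

theorem lk_run {A B : List (Letter σ)} {n a : ℕ} {L : ℕ × ℕ}
    (h : lk (A ++ strPow (plainTile V) n ++ B) a = some L) :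
    (a < A.length ∧ lk (A ++ strPow (plainTile V) (n + 1) ++ B) a = some L) ∨
    (A.length + n * V.length ≤ a ∧
      lk (A ++ strPow (plainTile V) (n + 1) ++ B) (a + V.length) = some L) := by
  have hl : ∀ i, (strPow (plainTile V) i).length = i * V.length := by
    intro i; rw [length_strPow, length_plainTile]
  rcases lt_or_ge a A.length with h1 | h1
  · left
    refine ⟨h1, ?_⟩
    rw [lk, List.append_assoc, List.getElem?_append_left h1] at h ⊢
    exact h
  rcases lt_or_ge a (A.length + n * V.length) with h2 | h2
  · rw [lk_eq_none_of_mid (fun e he => lock_plainTile (mem_strPow he)) h1 (by rwa [hl])] at h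
    simp at h
  · right
    refine ⟨h2, ?_⟩
    rw [lk, List.getElem?_append_right (by rw [List.length_append, hl]; exact h2),
      List.length_append, hl] at h
    rw [lk, List.getElem?_append_right (by rw [List.length_append, hl, add_mul]; omega),
      List.length_append, hl]
    rw [show a + V.length - (A.length + (n + 1) * V.length) = a - (A.length + n * V.length) by
      rw [add_mul]; omega]
    exact h

theorem Side.remove_tile (hq : 0 < Q.length) {I : Finset (ℕ × ℕ)} {f : ℤ}
    {mid : ℕ × ℕ → List (Letter σ)} {ini : ℕ × ℕ → Prop} {A B : List (Letter σ)} {n : ℕ}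
    (hV : 0 < V.length) (hVq : Q.length ∣ V.length)
    (h : Side Q f I mid ini (A ++ strPow (plainTile V) (n + 1) ++ B)) :
    Side Q f I mid ini (A ++ strPow (plainTile V) n ++ B) := by
  rw [strPow_add, strPow_one, ← List.append_assoc] at h
  apply h.remove hq
  · rw [← List.length_pos_iff, length_plainTile]; exact hV
  · exact fun e he => lock_plainTile he
  · rw [advance_plainTile]; exact_mod_cast hVq

/-- The remaining run has length at least `D + k`. So two locked positions within `k` of each other
are both before it or both after it, and restoring the tile shifts both or neither. -/
theorem Setting.remove_tile (hq : 0 < Q.length) {A A' B B' : List (Letter σ)} {n D : ℕ}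
    (hV : 0 < V.length) (hVq : Q.length ∣ V.length)
    (h : Setting Q k f g I I' S mid mid' L₀ W W' μ (A ++ strPow (plainTile V) (n + 1) ++ B)
      (A' ++ strPow (plainTile V) (n + 1) ++ B'))
    (hD : A.length ≤ A'.length + D) (hD' : A'.length ≤ A.length + D)
    (hn : D + k ≤ n * V.length) :
    Setting Q k f g I I' S mid mid' L₀ W W' μ (A ++ strPow (plainTile V) n ++ B)
      (A' ++ strPow (plainTile V) n ++ B') where
  left := h.left.remove_tile hq hV hVq
  right := h.right.remove_tile hq hV hVq
  near a b L L' ha hb h1 h2 := by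
    rcases lk_run ha with ⟨h3, h4⟩ | ⟨h3, h4⟩ <;> rcases lk_run hb with ⟨h5, h6⟩ | ⟨h5, h6⟩
    · exact h.near _ _ _ _ h4 h6 h1 h2
    · omega
    · omega
    · exact h.near _ _ _ _ h4 h6 (by omega) (by omega)
  inside L' hL' b hb := by
    have hl : ∀ i, (strPow (plainTile V) i).length = i * V.length := by
      intro i; rw [length_strPow, length_plainTile]
    simp only [List.length_append, hl]
    rcases lk_run hb with ⟨h5, h6⟩ | ⟨h5, h6⟩
    · omega
    · have := h.inside L' hL' _ h6
      simp only [List.length_append, hl, add_mul] at this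
      omega

/-- The tiles are disjoint, so choosing one costly time in each is injective. Used contrapositively
to find an error-free tile. -/
theorem le_sum_of_tiles {a d : ℕ → ℕ} {K x τ i j : ℕ}
    (h : ∀ s, i ≤ s → s < j → ∃ t < K, x + s * τ ≤ a t ∧ a t < x + s * τ + τ ∧ d t ≠ 0) :
    j - i ≤ ∑ t ∈ (Finset.range K).filter (fun t => x + i * τ ≤ a t ∧ a t < x + j * τ), d t := by
  classical
  choose! φ hφ using h
  have hcard : (Finset.Ico i j).card ≤ ((Finset.range K).filter
      (fun t => (x + i * τ ≤ a t ∧ a t < x + j * τ) ∧ d t ≠ 0)).card := by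
    refine Finset.card_le_card_of_injOn φ ?_ ?_
    · intro s hs
      rw [Finset.coe_Ico, Set.mem_Ico] at hs
      obtain ⟨h1, h2, h3, h4⟩ := hφ s hs.1 hs.2
      have h5 : s * τ + τ ≤ j * τ := by
        rw [← Nat.succ_mul]
        exact Nat.mul_le_mul_right _ hs.2
      have h6 : i * τ ≤ s * τ := Nat.mul_le_mul_right _ hs.1
      rw [Finset.mem_coe, Finset.mem_filter]
      exact ⟨Finset.mem_range.2 h1, ⟨by omega, by omega⟩, h4⟩
    · intro s hs s' hs' hss
      rw [Finset.coe_Ico, Set.mem_Ico] at hs hs'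
      obtain ⟨-, h2, h3, -⟩ := hφ s hs.1 hs.2
      obtain ⟨-, h2', h3', -⟩ := hφ s' hs'.1 hs'.2
      rw [hss] at h2 h3
      by_contra hne
      rcases Nat.lt_or_gt_of_ne hne with h | h
      · have : (s + 1) * τ ≤ s' * τ := Nat.mul_le_mul_right _ h
        rw [add_mul] at this
        omega
      · have : (s' + 1) * τ ≤ s * τ := Nat.mul_le_mul_right _ h
        rw [add_mul] at this
        omega
  rw [Nat.card_Ico] at hcard
  refine hcard.trans ?_
  rw [← Finset.filter_filter, Finset.card_eq_sum_ones]
  refine le_trans (Finset.sum_le_sum (g := d) fun t ht => ?_)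
    (Finset.sum_le_sum_of_subset (Finset.filter_subset _ _))
  have := (Finset.mem_filter.1 ht).2
  omega

/-- An error-free tile of `X` is aligned with an equal string in the run of `Y`, possibly in another
phase. Replacing both by `r` copies changes neither cost nor the unread end of `Y`. -/
theorem Setting.transport (hq : 0 < Q.length) {A A' B B' : List (Letter σ)} {n D : ℕ}
    (hV : 0 < V.length) (hw : Weights Q g I I' S mid mid' L₀ W W')
    (h : Setting Q k f g I I' S mid mid' L₀ W W' μ (A ++ strPow (plainTile V) n ++ B)
      (A' ++ strPow (plainTile V) n ++ B'))
    (hD : A.length ≤ A'.length + D) (hD' : A'.length ≤ A.length + D)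
    (hDk : D + k ≤ 15 * V.length) (hμ : 30 + 2 * ∑ L ∈ I, ∑ L' ∈ I', μ L L' < n)
    {y c : ℕ} (hy : y ≤ (A' ++ strPow (plainTile V) n ++ B').length)
    (hc : c ≤ k) (hcW : c ≤ ∑ L ∈ I, W L + ∑ L' ∈ S, W' L')
    (hEd : Ed (chs (A ++ strPow (plainTile V) n ++ B))
      ((chs (A' ++ strPow (plainTile V) n ++ B')).take y) c) (r : ℕ) :
    ∃ y', y' + (A' ++ strPow (plainTile V) n ++ B').length =
        y + (A' ++ strPow (plainTile V) (n - 1 + r) ++ B').length ∧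
      Ed (chs (A ++ strPow (plainTile V) (n - 1 + r) ++ B))
        ((chs (A' ++ strPow (plainTile V) (n - 1 + r) ++ B')).take y') c := by
  classical
  have hl : ∀ i, (strPow (plainTile V) i).length = i * V.length := by
    intro i; rw [length_strPow, length_plainTile]
  set X := A ++ strPow (plainTile V) n ++ B with hX
  set Y := A' ++ strPow (plainTile V) n ++ B' with hY
  obtain ⟨a, b, K, ha, hb, ha0, hb0, haK, hbK, hcost⟩ :=
    hEd.exists_path_take (by rwa [length_chs])
  rw [length_chs] at haK
  have hlow := h.lower_bound hq hw ha hb ha0 hb0 haK (by omega) (hcost.trans hc)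
  have hdr := fun t ht => drift_le_of_cost ha hb ha0 hb0 (hcost.trans hc) (t := t) ht
  have hsub := fun s t (hst : s ≤ t) =>
    ed_subpath (fun i => (chs X)[i]?) (fun i => (chs Y)[i]?) ha hb hst
  set d := stepCost (fun i => (chs X)[i]?) (fun i => (chs Y)[i]?) a b with hd
  set τ := V.length with hτ
  have hXlen : X.length = A.length + n * τ + B.length := by
    simp only [hX, List.length_append, hl]
  -- an error-free tile
  obtain ⟨s, hs1, hs2, hs⟩ : ∃ s, 15 ≤ s ∧ s + 15 < n ∧
      ∀ t < K, A.length + s * τ ≤ a t → a t < A.length + s * τ + τ → d t = 0 := by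
    by_contra! hcon
    have hle := le_sum_of_tiles (K := K) (a := a) (d := d) (x := A.length) (τ := τ) (i := 15)
      (j := n - 15) (fun s h1 h2 => hcon s h1 (by omega))
    have hsub : ∑ t ∈ (Finset.range K).filter
        (fun t => A.length + 15 * τ ≤ a t ∧ a t < A.length + (n - 15) * τ), d t ≤
        ∑ t ∈ (Finset.range K).filter (fun t => lk X (a t) = none ∧ lk Y (b t) = none), d t := by
      refine Finset.sum_le_sum_of_subset fun t ht => ?_
      rw [Finset.mem_filter, Finset.mem_range] at ht ⊢
      have h5 : (n - 15) * τ + 15 * τ = n * τ := by rw [← add_mul]; congr 1; omega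
      have h7 := hdr _ ht.1.le
      refine ⟨ht.1, ?_, ?_⟩
      · apply lk_eq_none_of_mid (fun e he => lock_plainTile (mem_strPow he))
        · omega
        · rw [hl]; omega
      · apply lk_eq_none_of_mid (fun e he => lock_plainTile (mem_strPow he))
        · omega
        · rw [hl]; omega
    omega
  have h5 : s * τ + τ + 15 * τ ≤ n * τ := by
    rw [← Nat.succ_mul, ← add_mul]
    exact Nat.mul_le_mul_right _ (by omega)
  have h6 : 15 * τ ≤ s * τ := Nat.mul_le_mul_right _ hs1
  set x := A.length + s * τ with hx
  have hx2 : ∃ u, x + τ ≤ a u := ⟨K, by omega⟩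
  have hx1 : ∃ u, x ≤ a u := ⟨K, by omega⟩
  set t₁ := hit a x with ht₁
  set t₂ := hit a (x + τ) with ht₂
  have ht₂K : t₂ ≤ K := hit_le (by omega)
  have ht₁₂ : t₁ ≤ t₂ := hit_mono (by omega) hx2
  have hat₁ : a t₁ = x := at_hit ha (by omega) hx1
  have hat₂ : a t₂ = x + τ := at_hit ha (by omega) hx2
  have hz : ∑ u ∈ Finset.Ico t₁ t₂, d u = 0 := by
    apply Finset.sum_eq_zero
    intro u hu
    have h1 := (mem_Ico_hit ha hx2 (by omega)).1 hu
    have h2 := Finset.mem_Ico.1 hu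
    exact hs u (by omega) h1.1 h1.2
  have hsum : ∑ u ∈ Finset.Ico 0 t₁, d u + ∑ u ∈ Finset.Ico t₂ K, d u ≤ c := by
    rw [Finset.range_eq_Ico, ← Finset.sum_Ico_consecutive _ (Nat.zero_le t₁) (ht₁₂.trans ht₂K),
      ← Finset.sum_Ico_consecutive _ ht₁₂ ht₂K, hz] at hcost
    omega
  have hb₁ : b t₁ ≤ b t₂ := hb.monotone ht₁₂
  have hb₂ : b t₂ ≤ b K := hb.monotone ht₂K
  have hXl : (chs X).length = X.length := length_chs X
  have hYl : (chs Y).length = Y.length := length_chs Y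
  have e1 := hsub 0 t₁ (Nat.zero_le _)
  have e2 := hsub t₁ t₂ ht₁₂
  have e3 := hsub t₂ K ht₂K
  rw [← frag_eq_chars _ (by omega), ← frag_eq_chars _ (by omega)] at e1 e2 e3
  rw [hz] at e2
  have hbτ : b t₂ = b t₁ + τ := by
    have := e2.length_eq
    rw [length_frag _ (by omega), length_frag _ (by omega)] at this
    omega
  have hdt₁ := hdr t₁ (ht₁₂.trans ht₂K)
  rw [ha0, hb0, hat₁] at e1
  rw [hat₁, hat₂, hbτ] at e2
  rw [hat₂, haK, hbτ, hbK] at e3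
  have hcX : ∀ i, chs (A ++ strPow (plainTile V) i ++ B) = chs A ++ strPow V i ++ chs B := by
    intro i; simp [chs_strPow]
  have hcY : ∀ i, chs (A' ++ strPow (plainTile V) i ++ B') = chs A' ++ strPow V i ++ chs B' := by
    intro i; simp [chs_strPow]
  have rX := replace_tile (chs A) V (chs B) (n := n) (y := x) hV (by rw [length_chs]; omega)
    (by rw [length_chs, ← hτ]; omega) r
  have rY := replace_tile (chs A') V (chs B') (n := n) (y := b t₁) hV (by rw [length_chs]; omega)
    (by rw [length_chs, ← hτ]; omega) r
  rw [← hcX, ← hcX, ← hX, ← hτ] at rX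
  rw [← hcY, ← hcY, ← hY, ← hτ] at rY
  have hlU : (strPow (frag (chs Y) (b t₁) (b t₁ + τ)) r).length = r * τ := by
    rw [length_strPow, length_frag _ (by omega)]
    congr 1
    omega
  refine ⟨b t₁ + r * τ + (y - (b t₁ + τ)), ?_, ?_⟩
  · simp only [hY, List.length_append, hl]
    have : (n - 1 + r) * τ + τ = n * τ + r * τ := by
      rw [← Nat.succ_mul, ← add_mul]
      congr 1
      omega
    omega
  · rw [← rX, ← rY]
    have hlt : (List.take (b t₁) (chs Y) ++
        strPow (frag (chs Y) (b t₁) (b t₁ + τ)) r).length = b t₁ + r * τ := by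
      rw [List.length_append, hlU, List.length_take]
      omega
    rw [← hlt, List.take_length_add_append]
    have e3' : (chs X).drop (x + τ) = frag (chs X) (x + τ) X.length := by
      rw [frag, ← length_chs, List.take_length]
    have e4 : ((chs Y).drop (b t₁ + τ)).take (y - (b t₁ + τ)) = frag (chs Y) (b t₁ + τ) y := by
      rw [frag, List.drop_take]
    have e5 : ∀ (Z : List σ) i, Z.take i = frag Z 0 i := by intro Z i; simp [frag]
    rw [e3', e4, e5, e5, e2.eq_of_zero]
    exact ((e1.append (Ed.refl _ 0)).append e3).mono (by omega)

end Transport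

/-! ### Trimming of annotated sequences -/

/-- `trimAux`, keeping the labels. -/
def keepAux {α : Type*} (a : ℕ) : ℕ → List (Bool × α) → List (Bool × α)
  | _, [] => []
  | c, (true, x) :: l => if c < a then (true, x) :: keepAux a (c + 1) l else keepAux a c l
  | _, (false, x) :: l => (false, x) :: keepAux a 0 l

theorem map_snd_keepAux {α : Type*} (a c : ℕ) (l : List (Bool × α)) :
    (keepAux a c l).map Prod.snd = trimAux a c l := by
  induction l generalizing c with
  | nil => rfl
  | cons e l ih =>
    obtain ⟨_ | _, x⟩ := e
    · simp [keepAux, trimAux, ih]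
    · simp only [keepAux, trimAux]
      split_ifs <;> simp [ih]

theorem trimAux_map {α β : Type*} (h : α → β) (a c : ℕ) (l : List (Bool × α)) :
    trimAux a c (l.map (Prod.map id h)) = (trimAux a c l).map h := by
  induction l generalizing c with
  | nil => rfl
  | cons e l ih =>
    obtain ⟨_ | _, x⟩ := e
    · simp [trimAux, ih]
    · simp only [List.map_cons, Prod.map_apply, id, trimAux]
      split_ifs <;> simp [ih]

theorem trimAux_concat {α : Type*} (a c : ℕ) (l : List (Bool × α)) (x : α) :
    trimAux a c (l ++ [(false, x)]) = trimAux a c l ++ [x] := by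
  induction l generalizing c with
  | nil => rfl
  | cons e l ih =>
    obtain ⟨_ | _, x⟩ := e
    · simp [trimAux, ih]
    · simp only [List.cons_append, trimAux]
      split_ifs <;> simp [ih]

theorem mem_of_mem_trimAux {α : Type*} {a c : ℕ} {l : List (Bool × α)} {x : α}
    (h : x ∈ trimAux a c l) : x ∈ l.map Prod.snd := by
  induction l generalizing c with
  | nil => simp [trimAux] at h
  | cons e l ih =>
    obtain ⟨_ | _, y⟩ := e
    · simp only [trimAux, List.mem_cons] at h
      rcases h with h | h
      · simp [h]
      · exact List.mem_cons_of_mem _ (ih h)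
    · simp only [trimAux] at h
      split_ifs at h
      · rcases List.mem_cons.1 h with h | h
        · simp [h]
        · exact List.mem_cons_of_mem _ (ih h)
      · exact List.mem_cons_of_mem _ (ih h)

/-- Removing one of more than `a` consecutive copies of `e`. -/
def TrimStep {α : Type*} (a : ℕ) (e : α) (l l' : List α) : Prop :=
  ∃ u w n, a ≤ n ∧ l = u ++ List.replicate (n + 1) e ++ w ∧ l' = u ++ List.replicate n e ++ w

/-- The `c` plain elements just kept are displayed in front of the unread list. When `c = a`,
skipping the next plain element is therefore one `TrimStep`. -/
theorem trimSteps_keepAux {α : Type*} (a : ℕ) (x : α) (l : List (Bool × α))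
    (hl : ∀ e ∈ l, e.1 = true → e.2 = x) (c : ℕ) (hc : c ≤ a) (u : List (Bool × α)) :
    Relation.ReflTransGen (TrimStep a (true, x)) (u ++ List.replicate c (true, x) ++ l)
      (u ++ List.replicate c (true, x) ++ keepAux a c l) := by
  induction l generalizing c u with
  | nil => exact .refl
  | cons e l ih =>
    have ih := ih (fun e he => hl e (List.mem_cons_of_mem _ he))
    obtain ⟨_ | _, y⟩ := e
    · simp only [keepAux]
      have := ih 0 (Nat.zero_le _) (u ++ List.replicate c (true, x) ++ [(false, y)])
      simpa using this
    · have hy : y = x := hl (true, y) (by simp) rfl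
      subst hy
      simp only [keepAux]
      split_ifs with h
      · have := ih (c + 1) h u
        simpa [List.replicate_succ'] using this
      · have hca : c = a := by omega
        subst hca
        refine .head ⟨u, l, c, le_rfl, ?_, rfl⟩ (ih c le_rfl u)
        simp [List.replicate_succ']

/-- The concatenation of the first components. -/
def catX (l : List (Bool × (List (Letter σ) × List (Letter σ)))) : List (Letter σ) :=
  (l.map fun e => e.2.1).flatten

/-- The concatenation of the second components. -/
def catY (l : List (Bool × (List (Letter σ) × List (Letter σ)))) : List (Letter σ) :=
  (l.map fun e => e.2.2).flatten

theorem catX_append (l l' : List (Bool × (List (Letter σ) × List (Letter σ)))) :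
    catX (l ++ l') = catX l ++ catX l' := by simp [catX]

theorem catY_append (l l' : List (Bool × (List (Letter σ) × List (Letter σ)))) :
    catY (l ++ l') = catY l ++ catY l' := by simp [catY]

theorem catX_replicate (n : ℕ) (e : Bool × (List (Letter σ) × List (Letter σ))) :
    catX (List.replicate n e) = strPow e.2.1 n := by simp [catX, strPow]

theorem catY_replicate (n : ℕ) (e : Bool × (List (Letter σ) × List (Letter σ))) :
    catY (List.replicate n e) = strPow e.2.2 n := by simp [catY, strPow]

/-- A sequence of annotated pairs whose values satisfy the assumptions of the lower bound and
in which plain pairs are copies of `V`, with corresponding pieces at distance at most `D`. -/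
structure Good (Q : List σ) (k : ℕ) (f g : ℤ) (I I' S : Finset (ℕ × ℕ))
    (mid mid' : ℕ × ℕ → List (Letter σ)) (L₀ : ℕ × ℕ) (W W' : ℕ × ℕ → ℕ)
    (μ : ℕ × ℕ → ℕ × ℕ → ℕ) (V : List σ) (D : ℕ)
    (l : List (Bool × (List (Letter σ) × List (Letter σ)))) : Prop where
  setting : Setting Q k f g I I' S mid mid' L₀ W W' μ (catX l) (catY l)
  drift : ∀ u w, l = u ++ w → w ≠ [] →
    (catX u).length ≤ (catY u).length + D ∧ (catY u).length ≤ (catX u).length + D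
  plain : ∀ e ∈ l, e.1 = true → e.2 = (plainTile V, plainTile V)

/-- The left value can be edited into the right value without its last `e` characters. -/
def Reach (c e : ℕ) (l : List (Bool × (List (Letter σ) × List (Letter σ)))) : Prop :=
  ∃ y, y + e = (catY l).length ∧ Ed (chs (catX l)) ((chs (catY l)).take y) c

section Trim

variable {Q : List σ} {k : ℕ} {f g : ℤ} {I I' S : Finset (ℕ × ℕ)}
  {mid mid' : ℕ × ℕ → List (Letter σ)} {L₀ : ℕ × ℕ} {W W' : ℕ × ℕ → ℕ}
  {μ : ℕ × ℕ → ℕ × ℕ → ℕ} {V : List σ} {D a : ℕ}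
  {l l' : List (Bool × (List (Letter σ) × List (Letter σ)))}

theorem Good.step (hq : 0 < Q.length) (hV : 0 < V.length) (hVq : Q.length ∣ V.length)
    (hD : D + k ≤ 15 * V.length) (ha : 15 ≤ a)
    (h : Good Q k f g I I' S mid mid' L₀ W W' μ V D l)
    (hl : TrimStep a (true, (plainTile V, plainTile V)) l l') :
    Good Q k f g I I' S mid mid' L₀ W W' μ V D l' := by
  obtain ⟨u, w, n, hn, rfl, rfl⟩ := hl
  have hs := h.setting
  simp only [catX_append, catY_append, catX_replicate, catY_replicate] at hs
  have hd := h.drift u (List.replicate (n + 1) (true, (plainTile V, plainTile V)) ++ w) (by simp)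
    (by simp)
  have hnD : D + k ≤ n * V.length := hD.trans (Nat.mul_le_mul_right _ (by omega))
  refine ⟨?_, ?_, ?_⟩
  · simp only [catX_append, catY_append, catX_replicate, catY_replicate]
    exact hs.remove_tile hq hV hVq hd.1 hd.2 hnD
  · intro u₀ w₀ he hw
    rw [List.append_assoc, List.append_eq_append_iff] at he
    rcases he with ⟨c, rfl, h2⟩ | ⟨c, rfl, rfl⟩
    · rw [List.append_eq_append_iff] at h2
      rcases h2 with ⟨c', h3, h4⟩ | ⟨c', h3, h4⟩
      · subst h3 h4
        have := h.drift (u ++ List.replicate (n + 1) (true, (plainTile V, plainTile V)) ++ c') w₀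
          (by simp) hw
        simp only [catX_append, catY_append, catX_replicate, catY_replicate, List.length_append,
          length_strPow, length_plainTile, add_mul] at this ⊢
        omega
      -- The cut falls inside the shortened run, so both prefixes extend those before the run by
      -- equally many tiles and the drift does not change.
      · have hcr : c = List.replicate c.length (true, (plainTile V, plainTile V)) := by
          rw [List.eq_replicate_iff]
          refine ⟨rfl, fun b hb => ?_⟩
          have : b ∈ List.replicate n (true, (plainTile V, plainTile V)) := by
            rw [h3]; simp [hb]
          exact List.eq_of_mem_replicate this
        rw [hcr]
        simp only [catX_append, catY_append, catX_replicate, catY_replicate, List.length_append,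
          length_strPow, length_plainTile]
        omega
    · exact h.drift u₀ (c ++ List.replicate (n + 1) (true, (plainTile V, plainTile V)) ++ w)
        (by simp) (by simp)
  · intro e he
    apply h.plain
    simp only [List.mem_append, List.mem_replicate] at he ⊢
    rcases he with (he | he) | he
    · exact .inl (.inl he)
    · exact .inl (.inr ⟨by omega, he.2⟩)
    · exact .inr he

/-- `Setting.transport` deletes a tile with `r = 0`; in the converse direction, `r = 2` doubles an
error-free tile of the shorter run. Counting the unread characters `e` from the right makes the
statement independent of the number of tiles. -/
theorem Good.reach_iff (hq : 0 < Q.length) (hV : 0 < V.length) (hVq : Q.length ∣ V.length)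
    (hD : D + k ≤ 15 * V.length) (ha : 30 + 2 * ∑ L ∈ I, ∑ L' ∈ I', μ L L' < a)
    (hw : Weights Q g I I' S mid mid' L₀ W W')
    (h : Good Q k f g I I' S mid mid' L₀ W W' μ V D l)
    (hl : TrimStep a (true, (plainTile V, plainTile V)) l l') {c e : ℕ} (hc : c ≤ k)
    (hcW : c ≤ ∑ L ∈ I, W L + ∑ L' ∈ S, W' L') : Reach c e l ↔ Reach c e l' := by
  have h' := h.step hq hV hVq hD (by omega) hl
  obtain ⟨u, w, n, hn, rfl, rfl⟩ := hl
  have hs := h.setting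
  have hs' := h'.setting
  have hd := h.drift u (List.replicate (n + 1) (true, (plainTile V, plainTile V)) ++ w) (by simp)
    (by simp)
  unfold Reach
  simp only [catX_append, catY_append, catX_replicate, catY_replicate] at hs hs' ⊢
  constructor
  · rintro ⟨y, hy, hE⟩
    obtain ⟨y', h1, h2⟩ := hs.transport hq hV hw hd.1 hd.2 hD (by omega) (y := y) (by omega) hc hcW
      hE 0
    exact ⟨y', by simp only [Nat.add_sub_cancel, add_zero] at h1; omega, h2⟩
  · rintro ⟨y, hy, hE⟩
    obtain ⟨y', h1, h2⟩ := hs'.transport hq hV hw hd.1 hd.2 hD (by omega) (y := y) (by omega) hc hcW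
      hE 2
    rw [show n - 1 + 2 = n + 1 by omega] at h1 h2
    exact ⟨y', by omega, h2⟩

theorem Good.trim (hq : 0 < Q.length) (hV : 0 < V.length) (hVq : Q.length ∣ V.length)
    (hD : D + k ≤ 15 * V.length) (ha : 30 + 2 * ∑ L ∈ I, ∑ L' ∈ I', μ L L' < a)
    (hw : Weights Q g I I' S mid mid' L₀ W W')
    (h : Good Q k f g I I' S mid mid' L₀ W W' μ V D l) :
    Good Q k f g I I' S mid mid' L₀ W W' μ V D (keepAux a 0 l) ∧
    ∀ c e, c ≤ k → c ≤ ∑ L ∈ I, W L + ∑ L' ∈ S, W' L' →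
      (Reach c e l ↔ Reach c e (keepAux a 0 l)) := by
  have hst := trimSteps_keepAux a (plainTile V, plainTile V) l h.plain 0 (Nat.zero_le _) []
  simp only [List.replicate_zero, List.append_nil, List.nil_append] at hst
  generalize keepAux a 0 l = l' at hst
  induction hst with
  | refl => exact ⟨h, fun c e _ _ => Iff.rfl⟩
  | tail _ hs ih =>
    refine ⟨ih.1.step hq hV hVq hD (by omega) hs, fun c e h1 h2 => ?_⟩
    exact (ih.2 c e h1 h2).trans (ih.1.reach_iff hq hV hVq hD ha hw hs h1 h2)

end Trim

end PuzzleMatching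

namespace PuzzleMatching

variable {σ : Type*}

/-! ### Annotations from optimal alignments -/

theorem frag_append (X : List σ) {i j l : ℕ} (hij : i ≤ j) (hjl : j ≤ l) :
    frag X i j ++ frag X j l = frag X i l := by
  unfold frag
  have h : X.take j = (X.take l).take j := by rw [List.take_take, min_eq_left hjl]
  rw [h, List.drop_take]
  conv_lhs => rw [show j = i + (j - i) by omega, ← List.drop_drop, Nat.add_sub_cancel_left]
  rw [List.take_append_drop]

theorem mem_frag {X : List σ} {i j : ℕ} {e : σ} (h : e ∈ frag X i j) :
    ∃ u, i ≤ u ∧ u < j ∧ X[u]? = some e := by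
  obtain ⟨u, hu, rfl⟩ := List.mem_iff_getElem.1 h
  have hl : u < min j X.length - i := by simpa [frag] using hu
  refine ⟨i + u, by omega, by omega, ?_⟩
  rw [← getElem?_frag X (j := j) (by omega), List.getElem?_eq_getElem hu]

theorem sum_map_eq_of_le {α : Type*} {l : List α} {F G : α → ℕ} (h : ∀ x ∈ l, F x ≤ G x)
    (hs : (l.map G).sum ≤ (l.map F).sum) : ∀ x ∈ l, F x = G x := by
  induction l with
  | nil => simp
  | cons y l ih =>
    simp only [List.map_cons, List.sum_cons, List.mem_cons, forall_eq_or_imp] at h hs ⊢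
    have := List.sum_le_sum h.2
    exact ⟨by omega, ih h.2 (by omega)⟩

theorem sum_disjoint_le (c : ℕ → ℕ) (n : ℕ) (Ls : List (ℕ × ℕ))
    (h : ∀ L ∈ Ls, L.1 ≤ L.2 ∧ L.2 ≤ n) (hp : Ls.Pairwise fun L L' => L.2 < L'.1) {i : ℕ}
    (hin : i ≤ n) (hi : ∀ L ∈ Ls, i ≤ L.1) :
    (Ls.map fun L => ∑ u ∈ Finset.Ico L.1 L.2, c u).sum ≤ ∑ u ∈ Finset.Ico i n, c u := by
  induction Ls generalizing i with
  | nil => simp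
  | cons L Ls ih =>
    simp only [List.mem_cons, forall_eq_or_imp] at h hi
    rw [List.pairwise_cons] at hp
    have := ih h.2 hp.2 (i := L.2) h.1.2 (fun L' hL' => (hp.1 L' hL').le)
    rw [List.map_cons, List.sum_cons,
      ← Finset.sum_Ico_consecutive c (hi.1.trans h.1.1) h.1.2,
      ← Finset.sum_Ico_consecutive c hi.1 h.1.1]
    omega

theorem IsLockedFamily.pairwise {S Q : List σ} {h : ℕ} {Ls : List (ℕ × ℕ)} (hq : 0 < Q.length)
    (hL : IsLockedFamily S Q h Ls) : Ls.Pairwise fun L L' => L.2 < L'.1 := by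
  have h1 : Ls.IsChain fun L L' => L.1 ≤ L.2 ∧ L.2 < L'.1 ∧ L'.1 ≤ L'.2 := by
    refine List.IsChain.imp_of_mem_imp ?_ hL.gaps
    rintro L L' hm hm' ⟨α, hα, hle, hfr⟩
    have h2 := hL.fragments L hm
    have h3 := hL.fragments L' hm'
    refine ⟨h2.1, ?_, h3.1⟩
    have h4 := congrArg List.length hfr
    rw [length_frag _ (h3.1.trans h3.2), length_strPow] at h4
    have := Nat.mul_pos hα hq
    omega
  have : Trans (fun L L' : ℕ × ℕ => L.1 ≤ L.2 ∧ L.2 < L'.1 ∧ L'.1 ≤ L'.2)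
      (fun L L' : ℕ × ℕ => L.1 ≤ L.2 ∧ L.2 < L'.1 ∧ L'.1 ≤ L'.2)
      (fun L L' : ℕ × ℕ => L.1 ≤ L.2 ∧ L.2 < L'.1 ∧ L'.1 ≤ L'.2) :=
    ⟨fun {a b c} h h' => by omega⟩
  exact (List.isChain_iff_pairwise.1 h1).imp fun h => h.2.1

/-- The restriction of an optimal alignment onto `Q^∞` to the single characters of `S`:
`f u` is a position aligned with `u` and `c u` is the cost at the character `u`. -/
structure Profile (S Q : List σ) (A : List (ℕ × ℕ)) (Ls : List (ℕ × ℕ)) (f c : ℕ → ℕ) :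
    Prop where
  mem : ∀ u ≤ S.length, (u, f u) ∈ A
  mono : ∀ u u', u ≤ u' → u' ≤ S.length → f u ≤ f u'
  ed : ∀ u u', u ≤ u' → u' ≤ S.length →
    Ed (frag S u u') (infFrag Q (f u) (f u')) (∑ w ∈ Finset.Ico u u', c w)
  lock : ∀ L ∈ Ls, ∑ w ∈ Finset.Ico L.1 L.2, c w = edSub (str S L) Q
  free : ∀ u < S.length, (∀ L ∈ Ls, ¬ (L.1 ≤ u ∧ u < L.2)) → c u = 0

/-- The alignment costs at least `edSub` on each locked fragment, these fragments are disjoint, and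
the sum of these distances is already the total cost. Hence equality holds on each fragment and
nothing is paid elsewhere. -/
theorem exists_profile {S Q : List σ} (hq : 0 < Q.length) {A : List (ℕ × ℕ)} {x y h : ℕ}
    {Ls : List (ℕ × ℕ)} (hA : IsAlignment A (0, x) (S.length, y))
    (hcost : alignCost (fun i => S[i]?) (fun i => infChar Q i) A = edSub S Q)
    (hLs : IsLockedFamily S Q h Ls) : ∃ f c, Profile S Q A Ls f c := by
  classical
  obtain ⟨a, b, K, ha, hb, ha0, hb0, haK, hbK, hm, -, hc⟩ := exists_path (σ := σ) hA
  have hsub := fun s t (hst : s ≤ t) =>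
    ed_subpath (fun i => S[i]?) (fun i : ℕ => infChar Q i) ha hb hst
  rw [hc] at hcost
  set d := stepCost (fun i => S[i]?) (fun i : ℕ => infChar Q i) a b with hd
  simp only at ha0 hb0 haK hbK
  let f := fun u => b (hit a u)
  let c := fun u => ∑ t ∈ Finset.Ico (hit a u) (hit a (u + 1)), d t
  have hex : ∀ u ≤ S.length, ∃ t, u ≤ a t := fun u hu => ⟨K, by omega⟩
  have hat : ∀ u ≤ S.length, a (hit a u) = u := fun u hu => at_hit ha (by omega) (hex u hu)
  have hhK : ∀ u ≤ S.length, hit a u ≤ K := fun u hu => hit_le (by omega)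
  have hmono : ∀ u u', u ≤ u' → u' ≤ S.length → f u ≤ f u' := fun u u' h1 h2 =>
    hb.monotone (hit_mono h1 (hex u' h2))
  have hsum : ∀ u u', u ≤ u' → u' ≤ S.length →
      ∑ w ∈ Finset.Ico u u', c w = ∑ t ∈ Finset.Ico (hit a u) (hit a u'), d t := by
    intro u u' huu'
    induction u', huu' using Nat.le_induction with
    | base => simp
    | succ u' huu' ih =>
      intro hu'
      rw [Finset.sum_Ico_succ_top huu', ih (by omega), Finset.sum_Ico_consecutive]
      · exact hit_mono huu' (hex _ (by omega))
      · exact hit_mono (by omega) (hex _ (by omega))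
  have hed : ∀ u u', u ≤ u' → u' ≤ S.length →
      Ed (frag S u u') (infFrag Q (f u) (f u')) (∑ w ∈ Finset.Ico u u', c w) := by
    intro u u' h1 h2
    have := hsub (hit a u) (hit a u') (hit_mono h1 (hex _ h2))
    rw [hat _ (h1.trans h2), hat _ h2, ← frag_eq_chars _ h2, chars_infChar] at this
    rwa [hsum u u' h1 h2]
  have hfr := hLs.fragments
  have hle : ∀ L ∈ Ls, edSub (str S L) Q ≤ ∑ w ∈ Finset.Ico L.1 L.2, c w := by
    intro L hL
    refine edSub_le hq ?_ (hed L.1 L.2 (hfr L hL).1 (hfr L hL).2)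
    exact_mod_cast hmono L.1 L.2 (hfr L hL).1 (hfr L hL).2
  -- Only an inequality: steps after the first arrival at `S.length` are charged to no character.
  have htot : ∑ w ∈ Finset.Ico 0 S.length, c w ≤ edSub S Q := by
    rw [hsum 0 _ (Nat.zero_le _) le_rfl, ← hcost, Finset.range_eq_Ico]
    exact Finset.sum_le_sum_of_subset (Finset.Ico_subset_Ico (Nat.zero_le _) (hhK _ le_rfl))
  have hdis := sum_disjoint_le c S.length Ls hfr (hLs.pairwise hq) (Nat.zero_le _)
    (fun L _ => Nat.zero_le _)
  refine ⟨f, c, ⟨fun u hu => ?_, hmono, hed, ?_, ?_⟩⟩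
  · have := hm (hit a u) (hhK u hu)
    rwa [hat u hu] at this
  · intro L hL
    refine (sum_map_eq_of_le hle ?_ L hL).symm
    rw [← hLs.total]
    exact hdis.trans htot
  · intro u hu hL
    let c' := fun u => if ∃ L ∈ Ls, L.1 ≤ u ∧ u < L.2 then c u else 0
    have hdis' := sum_disjoint_le c' S.length Ls hfr (hLs.pairwise hq) (Nat.zero_le _)
      (fun L _ => Nat.zero_le _)
    have hcc : ∀ L ∈ Ls, ∑ w ∈ Finset.Ico L.1 L.2, c' w = ∑ w ∈ Finset.Ico L.1 L.2, c w := by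
      intro L hL
      refine Finset.sum_congr rfl fun w hw => if_pos ⟨L, hL, Finset.mem_Ico.1 hw⟩
    rw [List.map_congr_left hcc] at hdis'
    have h1 := List.sum_le_sum hle
    rw [← hLs.total] at h1
    have h2 : ∑ w ∈ Finset.Ico 0 S.length, c' w < ∑ w ∈ Finset.Ico 0 S.length, c w ∨ c u = 0 := by
      by_cases hz : c u = 0
      · exact .inr hz
      · left
        refine Finset.sum_lt_sum (fun w _ => ?_) ⟨u, by simpa using hu, ?_⟩
        · simp only [c']; split_ifs <;> simp
        · simp only [c']
          rw [if_neg (by push Not; exact fun L hL' => by have := hL L hL'; omega)]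
          omega
    rcases h2 with h2 | h2
    · omega
    · exact h2

/-- The annotated string. -/
def annotate (S : List σ) (Ls : List (ℕ × ℕ)) (f c : ℕ → ℕ) : List (Letter σ) :=
  S.zipIdx.map fun p =>
    ⟨p.1, c p.2, f (p.2 + 1) - f p.2, Ls.find? fun L => decide (L.1 ≤ p.2 ∧ p.2 < L.2)⟩

theorem getElem?_annotate (S : List σ) (Ls : List (ℕ × ℕ)) (f c : ℕ → ℕ) (u : ℕ) :
    (annotate S Ls f c)[u]? = S[u]?.map fun x =>
      ⟨x, c u, f (u + 1) - f u, Ls.find? fun L => decide (L.1 ≤ u ∧ u < L.2)⟩ := by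
  simp [annotate, List.getElem?_zipIdx, Function.comp_def]

@[simp] theorem length_annotate (S : List σ) (Ls : List (ℕ × ℕ)) (f c : ℕ → ℕ) :
    (annotate S Ls f c).length = S.length := by simp [annotate]

@[simp] theorem chs_annotate (S : List σ) (Ls : List (ℕ × ℕ)) (f c : ℕ → ℕ) :
    chs (annotate S Ls f c) = S := by
  simp only [chs, annotate, List.map_map]
  exact List.zipIdx_map_fst 0 S

theorem mem_frag_annotate {S : List σ} {Ls : List (ℕ × ℕ)} {f c : ℕ → ℕ} {i j : ℕ}
    {e : Letter σ} (h : e ∈ frag (annotate S Ls f c) i j) :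
    ∃ u, i ≤ u ∧ u < j ∧ u < S.length ∧ S[u]? = some e.ch ∧ e.cost = c u ∧
      e.adv = f (u + 1) - f u ∧ e.lock = Ls.find? fun L => decide (L.1 ≤ u ∧ u < L.2) := by
  obtain ⟨u, h1, h2, h3⟩ := mem_frag h
  rw [getElem?_annotate, Option.map_eq_some_iff] at h3
  obtain ⟨x, h4, rfl⟩ := h3
  exact ⟨u, h1, h2, (List.getElem?_eq_some_iff.1 h4).1, h4, rfl, rfl, rfl⟩

theorem find_lock_eq {Ls : List (ℕ × ℕ)} (hp : Ls.Pairwise fun L L' => L.2 < L'.1)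
    (hle : ∀ L ∈ Ls, L.1 ≤ L.2) {u : ℕ} {L : ℕ × ℕ} :
    (Ls.find? fun L => decide (L.1 ≤ u ∧ u < L.2)) = some L ↔ L ∈ Ls ∧ L.1 ≤ u ∧ u < L.2 := by
  constructor
  · intro h
    exact ⟨List.mem_of_find?_eq_some h, by simpa using List.find?_some h⟩
  · rintro ⟨h1, h2⟩
    induction Ls with
    | nil => simp at h1
    | cons M Ls ih =>
      rw [List.pairwise_cons] at hp
      rcases List.mem_cons.1 h1 with rfl | h1
      · rw [List.find?_cons_of_pos (by simpa using h2)]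
      · have h3 := hp.1 L h1
        have h4 := hle M (by simp)
        rw [List.find?_cons_of_neg (by simp; omega)]
        exact ih hp.2 (fun L hL => hle L (List.mem_cons_of_mem _ hL)) h1

theorem valid_of_getElem {Q : List σ} (F : ℕ → ℤ) (X : List (Letter σ))
    (h : ∀ u e, X[u]? = some e → F (u + 1) = F u + e.adv ∧
      Ed [e.ch] (infFrag Q (F u) (F (u + 1))) e.cost) : Valid Q (F 0) X := by
  induction X generalizing F with
  | nil => trivial
  | cons e X ih =>
    obtain ⟨h1, h2⟩ := h 0 e rfl
    simp only [zero_add] at h1 h2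
    refine ⟨h1 ▸ h2, ?_⟩
    rw [← h1]
    exact ih (fun u => F (u + 1)) fun u e he => h (u + 1) e (by simpa using he)

section Profile

variable {S Q : List σ} {A Ls : List (ℕ × ℕ)} {f c : ℕ → ℕ}

theorem Profile.valid (h : Profile S Q A Ls f c) (v j : ℕ) (hj : j ≤ S.length) :
    Valid Q (f v) (frag (annotate S Ls f c) v j) := by
  apply valid_of_getElem (fun u => (f (v + u) : ℤ))
  intro u e he
  have hu : u < j - v := by
    have := (List.getElem?_eq_some_iff.1 he).1
    rwa [length_frag _ (by simpa using hj)] at this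
  rw [getElem?_frag _ (by omega), getElem?_annotate, Option.map_eq_some_iff] at he
  obtain ⟨x, h4, rfl⟩ := he
  have h5 := h.mono (v + u) (v + u + 1) (by omega) (by omega)
  refine ⟨by simp only [← add_assoc]; omega, ?_⟩
  have h6 := h.ed (v + u) (v + u + 1) (by omega) (by omega)
  rw [Nat.Ico_succ_singleton, Finset.sum_singleton] at h6
  rw [frag_eq_chars _ (by omega), chars_succ, h4] at h6
  exact h6

theorem cst_frag_annotate (v j : ℕ) (hvj : v ≤ j) (hj : j ≤ S.length) :
    cst (frag (annotate S Ls f c) v j) = ∑ w ∈ Finset.Ico v j, c w := by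
  induction j, hvj using Nat.le_induction with
  | base => simp [frag, cst]
  | succ j hvj ih =>
    rw [← frag_append _ hvj (Nat.le_succ j), cst_append, ih (by omega),
      Finset.sum_Ico_succ_top hvj, frag_eq_chars _ (by simpa using hj), chars_succ,
      getElem?_annotate, List.getElem?_eq_getElem (by omega)]
    simp [cst]

theorem Profile.side (h : Profile S Q A Ls f c) (hp : Ls.Pairwise fun L L' => L.2 < L'.1)
    (hfr : ∀ L ∈ Ls, L.1 ≤ L.2 ∧ L.2 ≤ S.length) {v : ℕ} (ini : ℕ × ℕ → Prop)
    (hini : ∀ L, ini L → L.1 = v) (hv : ∀ L ∈ Ls, v ≤ L.1 ∨ L.2 ≤ v) :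
    Side Q (f v) (Ls.toFinset.filter fun L => v ≤ L.1)
      (fun L => frag (annotate S Ls f c) L.1 L.2) ini
      (frag (annotate S Ls f c) v S.length) := by
  have hfind := fun u L => find_lock_eq (u := u) (L := L) hp fun L hL => (hfr L hL).1
  refine ⟨h.valid v _ le_rfl, ?_, ?_, ?_, ?_⟩
  · intro e he hc hlock
    obtain ⟨u, h1, h2, -, h3, h4, h5, h6⟩ := mem_frag_annotate he
    rw [h6, List.find?_eq_none] at hlock
    rw [h4] at hc
    exact hc (h.free u h2 fun L hL => by simpa using hlock L hL)
  · intro e he L hL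
    obtain ⟨u, h1, h2, -, h3, h4, h5, h6⟩ := mem_frag_annotate he
    rw [h6, hfind] at hL
    simp only [Finset.mem_filter, List.mem_toFinset]
    refine ⟨hL.1, ?_⟩
    have := hv L hL.1
    omega
  · intro L hL e he
    simp only [Finset.mem_filter, List.mem_toFinset] at hL
    obtain ⟨u, h1, h2, -, h3, h4, h5, h6⟩ := mem_frag_annotate he
    rw [h6, hfind]
    exact ⟨hL.1, h1, h2⟩
  · intro L hL
    simp only [Finset.mem_filter, List.mem_toFinset] at hL
    have hL2 := hfr L hL.1
    refine ⟨frag (annotate S Ls f c) v L.1, frag (annotate S Ls f c) L.2 S.length, ?_, ?_, ?_⟩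
    · rw [frag_append _ hL.2 hL2.1, frag_append _ (hL.2.trans hL2.1) hL2.2]
    · intro e he hlock
      rw [List.mem_append] at he
      rcases he with he | he <;>
      · obtain ⟨u, h1, h2, -, h3, h4, h5, h6⟩ := mem_frag_annotate he
        rw [h6, hfind] at hlock
        omega
    · intro hi
      rw [← hini L hi]
      simp [frag]

end Profile

/-! ### Pairs of an alignment -/

theorem IsAlignment.compare {A : List (ℕ × ℕ)} {s t : ℕ × ℕ} (hA : IsAlignment A s t)
    (X Y : ℕ → Option σ) {x y : ℕ × ℕ} (hx : x ∈ A) (hy : y ∈ A) :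
    (x.1 ≤ y.1 ∧ x.2 ≤ y.2 ∨ y.1 ≤ x.1 ∧ y.2 ≤ x.2) ∧
    x.1 + y.2 ≤ y.1 + x.2 + alignCost X Y A ∧ y.1 + x.2 ≤ x.1 + y.2 + alignCost X Y A := by
  obtain ⟨a, b, K, ha, hb, -, -, -, -, -, hm, hc⟩ := PuzzleMatching.exists_path (σ := σ) hA
  obtain ⟨u, hu, rfl⟩ := hm x hx
  obtain ⟨w, hw, rfl⟩ := hm y hy
  have key : ∀ u w, u ≤ w → w ≤ K → a u ≤ a w ∧ b u ≤ b w ∧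
      a w + b u ≤ a u + b w + alignCost X Y A ∧ a u + b w ≤ a w + b u + alignCost X Y A := by
    intro u w huw hwK
    have h1 := drift_le (X := X) (Y := Y) ha hb huw
    have h2 : ∑ t ∈ Finset.Ico u w, stepCost X Y a b t ≤ alignCost X Y A := by
      rw [hc, Finset.range_eq_Ico]
      exact Finset.sum_le_sum_of_subset (Finset.Ico_subset_Ico (Nat.zero_le _) hwK)
    exact ⟨ha.monotone huw, hb.monotone huw, by omega, by omega⟩
  rcases le_total u w with h | h
  · have := key u w h hw
    simp only
    omega
  · have := key w u h hu
    simp only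
    omega

theorem IsAlignment.exists_fst {A : List (ℕ × ℕ)} {s t : ℕ × ℕ} (hA : IsAlignment A s t) {y : ℕ}
    (h1 : s.2 ≤ y) (h2 : y ≤ t.2) : ∃ x, (x, y) ∈ A := by
  obtain ⟨a, b, K, ha, hb, -, hb0, -, hbK, hm, -, -⟩ := PuzzleMatching.exists_path (σ := ℕ) hA
  have hex : ∃ u, y ≤ b u := ⟨K, by omega⟩
  refine ⟨a (hit b y), ?_⟩
  have := hm (hit b y) (hit_le (by omega))
  rwa [at_hit hb (by omega) hex] at this

theorem IsAlignment.head_mem {A : List (ℕ × ℕ)} {s t : ℕ × ℕ} (hA : IsAlignment A s t) :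
    s ∈ A := List.mem_of_head? hA.1

theorem IsAlignment.last_mem {A : List (ℕ × ℕ)} {s t : ℕ × ℕ} (hA : IsAlignment A s t) :
    t ∈ A := List.mem_of_getLast? hA.2.1

end PuzzleMatching

namespace PuzzleMatching

variable {σ : Type*}

/-! ### Synchronization -/

/-- Among `κ + 1` copies of `Q` one is matched without error, and by primitivity its image starts at
a multiple of `q`. The drifts before and after this copy bound the two end-point errors, and they
share the budget `κ`. -/
theorem IsPrimitive.synchronize {Q : List σ} (hQ : IsPrimitive Q) {y κ : ℕ} {s s' : ℤ}
    (hss : s ≤ s') (hy : (κ + 1) * Q.length ≤ y)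
    (h : Ed (infFrag Q 0 y) (infFrag Q s s') κ) :
    ∃ Z : ℤ, (Q.length : ℤ) ∣ Z ∧ |s - Z| + |s' - (Z + y)| ≤ κ := by
  classical
  have hq := hQ.length_pos
  obtain ⟨a, b, K, ha, hb, ha0, hb0, haK, hbK, hcost⟩ := h.exists_path
  have hsub := fun (u v : ℕ) (huv : u ≤ v) =>
    ed_subpath (fun i => (infFrag Q 0 y)[i]?) (fun i => (infFrag Q s s')[i]?) ha hb huv
  have hdr := fun (u v : ℕ) (huv : u ≤ v) => drift_le (X := fun i => (infFrag Q 0 y)[i]?)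
    (Y := fun i => (infFrag Q s s')[i]?) ha hb huv
  set d := stepCost (fun i => (infFrag Q 0 y)[i]?) (fun i => (infFrag Q s s')[i]?) a b with hd
  have hX : (infFrag Q 0 y).length = y := by rw [length_infFrag hq]; omega
  have hY : (infFrag Q s s').length = (s' - s).toNat := length_infFrag hq _ _
  rw [hX] at haK
  rw [hY] at hbK
  obtain ⟨i, hi, hfree⟩ : ∃ i, i < κ + 1 ∧
      ∀ t < K, 0 + i * Q.length ≤ a t → a t < 0 + i * Q.length + Q.length → d t = 0 := by
    by_contra! hcon
    have h1 := le_sum_of_tiles (K := K) (a := a) (d := d) (x := 0) (τ := Q.length) (i := 0)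
      (j := κ + 1) (fun s _ h2 => hcon s h2)
    have h2 := Finset.sum_le_sum_of_subset (f := d) (Finset.filter_subset
      (fun t => 0 + 0 * Q.length ≤ a t ∧ a t < 0 + (κ + 1) * Q.length) (Finset.range K))
    omega
  have hiq : i * Q.length + Q.length ≤ y := by
    refine le_trans ?_ hy
    rw [← Nat.succ_mul]
    exact Nat.mul_le_mul_right _ hi
  generalize hx : i * Q.length = x at hfree hiq
  rw [zero_add] at hfree
  have hx2 : ∃ u, x + Q.length ≤ a u := ⟨K, by omega⟩
  have hx1 : ∃ u, x ≤ a u := ⟨K, by omega⟩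
  have ht₂K : hit a (x + Q.length) ≤ K := hit_le (by omega)
  have ht₁₂ : hit a x ≤ hit a (x + Q.length) := hit_mono (by omega) hx2
  have hat₁ : a (hit a x) = x := at_hit ha (by omega) hx1
  have hat₂ : a (hit a (x + Q.length)) = x + Q.length := at_hit ha (by omega) hx2
  have hmem := fun t => mem_Ico_hit (t := t) ha hx2 (show x ≤ x + Q.length by omega)
  generalize hit a x = t₁ at *
  generalize hit a (x + Q.length) = t₂ at *
  have hz : ∑ u ∈ Finset.Ico t₁ t₂, d u = 0 := by
    apply Finset.sum_eq_zero
    intro u hu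
    have h1 := (hmem u).1 hu
    have h2 := Finset.mem_Ico.1 hu
    exact hfree u (by omega) h1.1 h1.2
  have hsum : ∑ u ∈ Finset.Ico 0 t₁, d u + ∑ u ∈ Finset.Ico t₂ K, d u ≤ κ := by
    rw [Finset.range_eq_Ico, ← Finset.sum_Ico_consecutive _ (Nat.zero_le t₁) (ht₁₂.trans ht₂K),
      ← Finset.sum_Ico_consecutive _ ht₁₂ ht₂K, hz] at hcost
    omega
  have hb₁ : b t₁ ≤ b t₂ := hb.monotone ht₁₂
  have hb₂ : b t₂ ≤ b K := hb.monotone ht₂K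
  have e2 := hsub t₁ t₂ ht₁₂
  rw [← frag_eq_chars _ (by omega), ← frag_eq_chars _ (by omega), hz, hat₁, hat₂] at e2
  have hbq : b t₂ = b t₁ + Q.length := by
    have := e2.length_eq
    rw [length_frag _ (by omega), length_frag _ (by omega)] at this
    omega
  have e3 := e2.eq_of_zero
  rw [frag_infFrag hq _ _ (by omega) (by omega), frag_infFrag hq _ _ hb₁ (by omega), hbq] at e3
  have e4 : infFrag Q (0 + (x : ℤ)) (0 + ((x + Q.length : ℕ) : ℤ)) = Q := by
    rw [infFrag_eq_of_dvd hq (i := 0) (j := Q.length) (by rw [← hx]; push_cast; simp)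
      (by push_cast; ring), infFrag_zero_length hq]
  have hdvd : (Q.length : ℤ) ∣ s + b t₁ := by
    apply hQ.dvd_of_infFrag_eq
    rw [show s + b t₁ + (Q.length : ℤ) = s + ((b t₁ + Q.length : ℕ) : ℤ) by push_cast; ring]
    exact e3.symm.trans e4
  refine ⟨s + b t₁ - x, hdvd.sub (by rw [← hx]; push_cast; exact Dvd.intro_left _ rfl), ?_⟩
  have d1 := hdr 0 t₁ (Nat.zero_le _)
  have d2 := hdr t₂ K ht₂K
  rw [ha0, hb0, hat₁] at d1
  rw [hat₂, hbq, haK, hbK] at d2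
  have e4 : |s - (s + b t₁ - x)| ≤ ((∑ u ∈ Finset.Ico 0 t₁, d u : ℕ) : ℤ) := by
    rw [abs_le]; constructor <;> omega
  have e5 : |s' - (s + b t₁ - x + y)| ≤ ((∑ u ∈ Finset.Ico t₂ K, d u : ℕ) : ℤ) := by
    rw [abs_le]; constructor <;> omega
  omega

theorem IsAlignment.mem_bounds {A : List (ℕ × ℕ)} {s t x : ℕ × ℕ} (hA : IsAlignment A s t)
    (hx : x ∈ A) : (s.1 ≤ x.1 ∧ x.1 ≤ t.1) ∧ s.2 ≤ x.2 ∧ x.2 ≤ t.2 := by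
  obtain ⟨a, b, K, ha, hb, ha0, hb0, haK, hbK, -, hmem, -⟩ := exists_path (σ := Unit) hA
  obtain ⟨u, hu, rfl⟩ := hmem x hx
  have h1 := ha.monotone (Nat.zero_le u)
  have h2 := ha.monotone hu
  have h3 := hb.monotone (Nat.zero_le u)
  have h4 := hb.monotone hu
  simp only
  omega

theorem ed_of_alignment {S Q : List σ} {A : List (ℕ × ℕ)} {x y : ℕ}
    (hA : IsAlignment A (0, x) (S.length, y)) :
    Ed S (infFrag Q x y) (alignCost (fun i => S[i]?) (fun i => infChar Q i) A) := by
  obtain ⟨a, b, K, ha, hb, ha0, hb0, haK, hbK, -, -, hc⟩ := exists_path (σ := σ) hA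
  have := ed_subpath (fun i => S[i]?) (fun i : ℕ => infChar Q i) ha hb (Nat.zero_le K)
  rw [ha0, hb0, haK, hbK, ← frag_eq_chars _ le_rfl, frag_full, chars_infChar,
    ← Finset.range_eq_Ico, ← hc] at this
  exact this

namespace NewPeriodicMatches

variable (N : NewPeriodicMatches σ)

/-! ### Parameters of an instance -/

theorem q_pos : 0 < N.q := N.primitive.length_pos

theorem q_dvd_tau : N.q ∣ N.tau := ⟨_, rfl⟩

theorem kappa_le_two_tau : N.kappa ≤ 2 * N.tau := by
  have hq : (0 : ℚ) < 2 * N.q := by have := N.q_pos; positivity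
  have h := Nat.le_ceil ((N.kappa : ℚ) / (2 * N.q))
  rw [div_le_iff₀ hq] at h
  have h' : N.kappa ≤ ⌈(N.kappa : ℚ) / (2 * N.q)⌉₊ * (2 * N.q) := by exact_mod_cast h
  unfold tau
  nlinarith

theorem two_tau_lt : 2 * N.tau < N.kappa + 2 * N.q := by
  have hq : (0 : ℚ) < 2 * N.q := by have := N.q_pos; positivity
  have h := Nat.ceil_lt_add_one (a := (N.kappa : ℚ) / (2 * N.q)) (by positivity)
  have h2 : (⌈(N.kappa : ℚ) / (2 * N.q)⌉₊ : ℚ) * (2 * N.q) < N.kappa + 2 * N.q := by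
    calc _ < ((N.kappa : ℚ) / (2 * N.q) + 1) * (2 * N.q) := by gcongr
      _ = _ := by rw [add_mul, div_mul_cancel₀ _ hq.ne', one_mul]
  have h' : ⌈(N.kappa : ℚ) / (2 * N.q)⌉₊ * (2 * N.q) < N.kappa + 2 * N.q := by exact_mod_cast h2
  unfold tau
  nlinarith

variable {N}

theorem tau_pos (hκ : 0 < N.kappa) : 0 < N.tau := by
  have := N.kappa_le_two_tau
  omega

/-- If `τ ≥ 2q`, then `2τ < κ + 2q ≤ κ + τ`. The dichotomy is what makes an index `j` available in
`exists_index`. -/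
theorem tau_eq_or_le (hκ : 0 < N.kappa) : N.tau = N.q ∨ N.tau ≤ N.kappa := by
  obtain ⟨c, hc⟩ := N.q_dvd_tau
  have h1 := tau_pos hκ
  have h2 := N.two_tau_lt
  rcases Nat.lt_or_ge c 2 with h | h
  · left
    have : c = 1 := by
      rcases Nat.eq_zero_or_pos c with h0 | h0
      · rw [h0, mul_zero] at hc; omega
      · omega
    rw [hc, this, mul_one]
  · right
    have : N.q * 2 ≤ N.tau := by rw [hc]; exact Nat.mul_le_mul_left _ h
    omega

theorem three_le_z (hβ : 20 ≤ N.betaP) : 3 ≤ N.z := by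
  unfold z
  omega

theorem z_mul_tau_lt (hκ : 0 < N.kappa) (hβ : 20 ≤ N.betaP) :
    N.z * N.tau + 16 * N.tau < N.yP := by
  have hτ : (0 : ℚ) < N.tau := by exact_mod_cast tau_pos hκ
  have h : N.z + 16 < ⌈(N.yP : ℚ) / N.tau⌉₊ := by
    have : N.z + 17 = N.betaP := by unfold z; omega
    unfold betaP at this
    omega
  rw [Nat.lt_ceil, lt_div_iff₀ hτ] at h
  rw [← add_mul]
  exact_mod_cast h

theorem mem_J (hκ : 0 < N.kappa) {j : ℤ} : j ∈ N.J ↔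
    (N.xT : ℤ) - N.kappa ≤ j * N.tau ∧ j * N.tau ≤ (N.yT : ℤ) - N.yP + N.kappa := by
  have hτ : (0 : ℚ) < N.tau := by exact_mod_cast tau_pos hκ
  rw [J, Set.mem_Icc, minJ, maxJ, Int.ceil_le, Int.le_floor, div_le_iff₀ hτ, le_div_iff₀ hτ]
  constructor
  · rintro ⟨h1, h2⟩
    exact ⟨by exact_mod_cast h1, by exact_mod_cast h2⟩
  · rintro ⟨h1, h2⟩
    exact ⟨by exact_mod_cast h1, by exact_mod_cast h2⟩

theorem two_kappa_le : 2 * N.kappa ≤ 9 * N.d := by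
  have h1 := N.two_k_le
  have h2 := N.dP_le
  have h3 := N.dT_le
  unfold kappa
  omega

theorem eight_mul_d_le : 8 * N.d ≤ N.m := by
  have h1 := N.q_le
  have h2 : 0 < N.Q.length := N.q_pos
  have := Nat.le_mul_of_pos_right (8 * N.d) h2
  unfold m
  omega

theorem kappa_eq : N.k + edSub N.P N.Q + edSub N.T N.Q = N.kappa := rfl

/-- Any two pairs of the alignment of the pattern. -/
theorem compareP {x y : ℕ × ℕ} (hx : x ∈ N.AP) (hy : y ∈ N.AP) :
    (x.1 ≤ y.1 ∧ x.2 ≤ y.2 ∨ y.1 ≤ x.1 ∧ y.2 ≤ x.2) ∧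
    x.1 + y.2 ≤ y.1 + x.2 + edSub N.P N.Q ∧ y.1 + x.2 ≤ x.1 + y.2 + edSub N.P N.Q := by
  have := N.alignP.compare (fun i => N.P[i]?) (fun i => infChar N.Q i) hx hy
  rwa [N.costP] at this

/-- Any two pairs of the alignment of the text. -/
theorem compareT {x y : ℕ × ℕ} (hx : x ∈ N.AT) (hy : y ∈ N.AT) :
    (x.1 ≤ y.1 ∧ x.2 ≤ y.2 ∨ y.1 ≤ x.1 ∧ y.2 ≤ x.2) ∧
    x.1 + y.2 ≤ y.1 + x.2 + edSub N.T N.Q ∧ y.1 + x.2 ≤ x.1 + y.2 + edSub N.T N.Q := by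
  have := N.alignT.compare (fun i => N.T[i]?) (fun i => infChar N.Q i) hx hy
  rwa [N.costT] at this

theorem headP : (0, 0) ∈ N.AP := N.alignP.head_mem
theorem lastP : (N.m, N.yP) ∈ N.AP := N.alignP.last_mem
theorem headT : (0, N.xT) ∈ N.AT := N.alignT.head_mem
theorem lastT : (N.n, N.yT) ∈ N.AT := N.alignT.last_mem

/-- The length condition of `synchronize`: `2κ ≤ 9d`, while `y_P ≥ m - d ≥ 8dq - d`. -/
theorem le_yP : (N.kappa + 1) * N.q ≤ N.yP := by
  have h1 := (compareP (headP (N := N)) lastP).2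
  have h2 := N.dP_le
  have h3 := N.q_le
  have h4 : 0 < N.Q.length := N.q_pos
  have h5 := two_kappa_le (N := N)
  have h6 := N.d_pos
  simp only at h1
  unfold q
  unfold m at h1
  nlinarith

/-- Pairs of the alignment of the text lie between its end points. -/
theorem bounds_of_mem_AT {a b : ℕ} (h : (a, b) ∈ N.AT) :
    a ≤ N.n ∧ N.xT ≤ b ∧ b ≤ N.yT :=
  have h := N.alignT.mem_bounds h
  ⟨h.1.2, h.2⟩

/-! ### End points of the pieces -/

theorem tileBound_mem {A : List (ℕ × ℕ)} {len x y : ℕ} (hA : IsAlignment A (0, x) (len, y)) {i : ℤ}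
    (h1 : (x : ℤ) ≤ i * N.tau) (h2 : i * N.tau < y) :
    ∃ b : ℕ, (b : ℤ) = i * N.tau ∧ (N.tileBound A len y i, b) ∈ A := by
  rw [tileBound, if_neg (by omega)]
  obtain ⟨b, hb⟩ := Int.eq_ofNat_of_zero_le (show 0 ≤ i * (N.tau : ℤ) by omega)
  obtain ⟨a, ha⟩ := hA.exists_fst (y := b) (by simp only; omega) (by simp only; omega)
  obtain ⟨b', h, hb'⟩ := Nat.sInf_mem (s := {a | ∃ b : ℕ, (a, b) ∈ A ∧ (b : ℤ) = i * N.tau})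
    ⟨a, b, ha, hb.symm⟩
  exact ⟨b', hb', h⟩

theorem p_mem (hκ : 0 < N.kappa) (hβ : 20 ≤ N.betaP) {i : ℕ} (hi : i ≤ N.z) :
    (N.p i, i * N.tau) ∈ N.AP := by
  have h1 := z_mul_tau_lt hκ hβ
  have h2 := Nat.mul_le_mul_right N.tau hi
  have h3 : (i : ℤ) * N.tau = ((i * N.tau : ℕ) : ℤ) := by push_cast; rfl
  obtain ⟨b, hb, h⟩ := tileBound_mem (N := N) N.alignP (i := i)
    (by rw [h3]; exact Int.natCast_nonneg _) (by omega)
  have : b = i * N.tau := by omega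
  rwa [this] at h

theorem p_zero (hκ : 0 < N.kappa) (hβ : 20 ≤ N.betaP) : N.p 0 = 0 := by
  have h1 := z_mul_tau_lt hκ hβ
  rw [p, tileBound, if_neg (by simp; omega)]
  refine Nat.sInf_eq_zero.2 (.inl ⟨0, headP, ?_⟩)
  simp

/-- For `j ∈ J`, `jτ` may lie below `x_T` by up to `κ ≤ 2τ`. From `i = 2` on, the boundary is a
genuine point of the alignment and not a default value. -/
theorem t_mem (hκ : 0 < N.kappa) (hβ : 20 ≤ N.betaP) {j : ℤ} (hj : j ∈ N.J) {i : ℕ} (h2i : 2 ≤ i)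
    (hi : i ≤ N.z) : ∃ b : ℕ, (b : ℤ) = j * N.tau + i * N.tau ∧ (N.t (j + i), b) ∈ N.AT := by
  have h1 := z_mul_tau_lt hκ hβ
  have h2 := Nat.mul_le_mul_right N.tau hi
  have h2' := Nat.mul_le_mul_right N.tau h2i
  have h3 : (i : ℤ) * N.tau = ((i * N.tau : ℕ) : ℤ) := by push_cast; rfl
  have h4 := (mem_J hκ).1 hj
  have h5 := N.kappa_le_two_tau
  have h6 : (j + i) * (N.tau : ℤ) = j * N.tau + i * N.tau := by ring
  have := tileBound_mem (N := N) N.alignT (i := j + i) (by omega) (by omega)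
  rwa [h6] at this

theorem r_mem (hκ : 0 < N.kappa) {j : ℤ} (hj : j ∈ N.J) :
    ∃ b : ℕ, (N.r j, b) ∈ N.AT ∧ j * N.tau - N.kappa ≤ (b : ℤ) := by
  have h4 := (mem_J hκ).1 hj
  exact Nat.sInf_mem (s := {a | ∃ b : ℕ, (a, b) ∈ N.AT ∧ j * N.tau - N.kappa ≤ (b : ℤ)})
    ⟨N.n, N.yT, lastT, by omega⟩

theorem r_le {j : ℤ} {a b : ℕ} (h : (a, b) ∈ N.AT) (hb : j * N.tau - N.kappa ≤ (b : ℤ)) :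
    N.r j ≤ a :=
  Nat.sInf_le (s := {a | ∃ b : ℕ, (a, b) ∈ N.AT ∧ j * N.tau - N.kappa ≤ (b : ℤ)}) ⟨b, h, hb⟩

theorem bddAbove_rEnd (j : ℤ) :
    BddAbove {a | ∃ b : ℕ, (a, b) ∈ N.AT ∧ (b : ℤ) ≤ j * N.tau + N.yP + N.kappa} :=
  ⟨N.n, fun _ ⟨_, h, _⟩ => (bounds_of_mem_AT h).1⟩

theorem rEnd_mem (hκ : 0 < N.kappa) {j : ℤ} (hj : j ∈ N.J) :
    ∃ b : ℕ, (N.rEnd j, b) ∈ N.AT ∧ (b : ℤ) ≤ j * N.tau + N.yP + N.kappa := by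
  have h4 := (mem_J hκ).1 hj
  exact Nat.sSup_mem (s := {a | ∃ b : ℕ, (a, b) ∈ N.AT ∧ (b : ℤ) ≤ j * N.tau + N.yP + N.kappa})
    ⟨0, N.xT, headT, by omega⟩ (bddAbove_rEnd j)

theorem le_rEnd {j : ℤ} {a b : ℕ} (h : (a, b) ∈ N.AT)
    (hb : (b : ℤ) ≤ j * N.tau + N.yP + N.kappa) : a ≤ N.rEnd j :=
  le_csSup (bddAbove_rEnd j) ⟨b, h, hb⟩

theorem rEnd_le_n (hκ : 0 < N.kappa) {j : ℤ} (hj : j ∈ N.J) : N.rEnd j ≤ N.n := by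
  obtain ⟨b, h, -⟩ := rEnd_mem hκ hj
  exact (bounds_of_mem_AT h).1

theorem rEnd_le (hκ : 0 < N.kappa) {j : ℤ} (hj : j ∈ N.J) :
    N.rEnd j + N.k ≤ N.r j + N.m + 3 * N.kappa := by
  obtain ⟨b, h, hb⟩ := rEnd_mem hκ hj
  obtain ⟨b', h', hb'⟩ := r_mem hκ hj
  have h1 := compareT h h'
  have h2 := compareP (headP (N := N)) lastP
  have h3 := N.kappa_eq
  simp only at h1 h2
  omega

theorem p_bounds (hκ : 0 < N.kappa) (hβ : 20 ≤ N.betaP) {i : ℕ} (hi : i ≤ N.z) :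
    N.p i ≤ i * N.tau + edSub N.P N.Q ∧ i * N.tau ≤ N.p i + edSub N.P N.Q := by
  have h := compareP (headP (N := N)) (p_mem hκ hβ hi)
  simp only at h
  omega

theorem p_mono (hκ : 0 < N.kappa) (hβ : 20 ≤ N.betaP) {i i' : ℕ} (hii : i < i') (hi : i' ≤ N.z) :
    N.p i ≤ N.p i' := by
  have h := compareP (p_mem hκ hβ (hii.le.trans hi)) (p_mem hκ hβ hi)
  have h1 : (i + 1) * N.tau ≤ i' * N.tau := Nat.mul_le_mul_right _ hii
  have h2 := tau_pos hκ
  rw [add_mul] at h1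
  simp only at h
  omega

theorem p_add_le (hκ : 0 < N.kappa) (hβ : 20 ≤ N.betaP) : N.p N.z + N.Delta ≤ N.m := by
  have h := compareP (p_mem hκ hβ le_rfl) lastP
  have h1 := z_mul_tau_lt hκ hβ
  have h3 := N.kappa_eq
  have h5 := N.kappa_le_two_tau
  unfold Delta
  simp only at h
  omega

theorem t_mono (hκ : 0 < N.kappa) (hβ : 20 ≤ N.betaP) {j : ℤ} (hj : j ∈ N.J) {i i' : ℕ}
    (h2i : 2 ≤ i) (hii : i < i') (hi : i' ≤ N.z) : N.t (j + i) ≤ N.t (j + i') := by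
  obtain ⟨b, hb, hm⟩ := t_mem hκ hβ hj h2i (hii.le.trans hi)
  obtain ⟨b', hb', hm'⟩ := t_mem hκ hβ hj (h2i.trans hii.le) hi
  have h := compareT hm hm'
  have h1 : ((i + 1) * N.tau : ℤ) ≤ i' * N.tau := by
    exact_mod_cast Nat.mul_le_mul_right N.tau hii
  have h2 := tau_pos hκ
  rw [add_mul] at h1
  simp only at h
  omega

theorem t_bounds (hκ : 0 < N.kappa) (hβ : 20 ≤ N.betaP) {j : ℤ} (hj : j ∈ N.J) {i : ℕ}
    (h2i : 2 ≤ i) (hi : i ≤ N.z) :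
    N.t (j + i) ≤ N.r j + i * N.tau + N.kappa + edSub N.T N.Q ∧
    N.r j + i * N.tau ≤ N.t (j + i) + N.kappa + edSub N.T N.Q := by
  obtain ⟨b, hb, hm⟩ := t_mem hκ hβ hj h2i hi
  obtain ⟨b', h', hb'⟩ := r_mem hκ hj
  have h1 := compareT hm h'
  have hi' : (i : ℤ) * N.tau = ((i * N.tau : ℕ) : ℤ) := by push_cast; rfl
  rw [hi'] at hb
  refine ⟨by simp only at h1; omega, ?_⟩
  rcases Nat.eq_zero_or_pos (N.r j) with h0 | h0
  · have h2 := compareT hm headT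
    have h4 := (mem_J hκ).1 hj
    simp only at h2
    omega
  -- The pair at `r_j` may lie far beyond `jτ - κ`. Minimality says that a pair at position `r_j -
  -- 1` lies below `jτ - κ`, and that pair gives the bound.
  · obtain ⟨f, c, K, hf, -, hf0, -, -, -, hmem, hmem', -⟩ := exists_path (σ := σ) N.alignT
    obtain ⟨u, hu, huv⟩ := hmem' _ h'
    have hu1 : f u = N.r j := by rw [Prod.mk.injEq] at huv; exact huv.1.symm
    obtain ⟨w, -, hw, hfw⟩ := hf.exists_eq (Nat.zero_le u) (β := N.r j - 1)
      (by simp only at hf0; omega) (by omega)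
    have hm2 := hmem w (by omega)
    have h3 := compareT hm hm2
    by_contra hcon
    have h5 : ¬ (j * N.tau - N.kappa ≤ (c w : ℤ)) := fun h => by
      have := r_le hm2 h
      omega
    simp only at h3
    omega

theorem t_add_le (hκ : 0 < N.kappa) (hβ : 20 ≤ N.betaP) {j : ℤ} (hj : j ∈ N.J) :
    N.t (j + N.z) + N.Delta ≤ N.rEnd j := by
  have h1 := z_mul_tau_lt hκ hβ
  have h2 := three_le_z hβ
  obtain ⟨b, hb, hm⟩ := t_mem hκ hβ hj (by omega) (le_refl N.z)
  have h3 := N.kappa_eq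
  have h4 := (mem_J hκ).1 hj
  have h5 := N.kappa_le_two_tau
  have h6 := (bounds_of_mem_AT (lastT (N := N))).2.1
  have hi' : (N.z : ℤ) * N.tau = ((N.z * N.tau : ℕ) : ℤ) := by push_cast; rfl
  rw [hi'] at hb
  obtain ⟨y, hy⟩ := Int.eq_ofNat_of_zero_le
    (show 0 ≤ min (N.yT : ℤ) (j * N.tau + N.yP + N.kappa) by omega)
  obtain ⟨x, hx⟩ := N.alignT.exists_fst (y := y) (by simp only; omega) (by simp only; omega)
  have h7 := le_rEnd (j := j) hx (by omega)
  have h8 := compareT hm hx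
  simp only at h8
  unfold Delta
  omega

end NewPeriodicMatches

/-! ### Cutting strings into consecutive fragments -/

theorem drop_frag (X : List σ) (i j D : ℕ) : (frag X i j).drop D = frag X (i + D) j := by
  rw [frag, frag, List.drop_drop]

theorem flatten_frag (X : List σ) (cut : ℕ → ℕ) {i : ℕ} (h : ∀ u < i, cut u ≤ cut (u + 1)) :
    ((List.range' 1 i).map fun u => frag X (cut (u - 1)) (cut u)).flatten =
      frag X (cut 0) (cut i) := by
  have key : ∀ i', i' ≤ i → cut 0 ≤ cut i' ∧
      ((List.range' 1 i').map fun u => frag X (cut (u - 1)) (cut u)).flatten =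
        frag X (cut 0) (cut i') := by
    intro i'
    induction i' with
    | zero => intro _; simp [frag]
    | succ i' ih =>
      intro hi'
      obtain ⟨h1, h2⟩ := ih (by omega)
      have h3 := h i' (by omega)
      refine ⟨h1.trans h3, ?_⟩
      rw [List.range'_concat, List.map_append, List.flatten_append, h2]
      have : 1 + 1 * i' = i' + 1 := by omega
      simp only [this, List.map_cons, List.map_nil, List.flatten_cons, List.flatten_nil,
        List.append_nil, Nat.add_sub_cancel]
      exact frag_append X h1 h3
  exact (key i le_rfl).2

theorem take_of_map_range' {α : Type*} {F : ℕ → α} {z : ℕ} {u w : List α}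
    (h : (List.range' 1 z).map F = u ++ w) (hw : w ≠ []) :
    u.length < z ∧ u = (List.range' 1 u.length).map F := by
  have hl := congrArg List.length h
  rw [List.length_map, List.length_range', List.length_append] at hl
  have hw' := List.length_pos_of_ne_nil hw
  refine ⟨by omega, ?_⟩
  have h2 : ((List.range' 1 z).map F).take u.length = u := by
    rw [h, List.take_left' rfl]
  rw [hl, ← List.range'_append, List.map_append, List.take_left' (by simp)] at h2
  exact h2.symm

theorem chs_flatten (L : List (List (Letter σ))) : chs L.flatten = (L.map chs).flatten := by
  rw [chs, List.map_flatten]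
  rfl

theorem catX_eq (l : List (Bool × (List (Letter σ) × List (Letter σ)))) :
    catX l = ((l.map Prod.snd).map Prod.fst).flatten := by
  rw [List.map_map]; rfl

theorem catY_eq (l : List (Bool × (List (Letter σ) × List (Letter σ)))) :
    catY l = ((l.map Prod.snd).map Prod.snd).flatten := by
  rw [List.map_map]; rfl

/-- Each deleted pair removes one copy of `V` from both sides, so the difference of the two lengths
is invariant. -/
theorem length_keepAux {V : List σ} (a : ℕ)
    (l : List (Bool × (List (Letter σ) × List (Letter σ))))
    (hl : ∀ e ∈ l, e.1 = true → e.2 = (plainTile V, plainTile V)) :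
    (catX (keepAux a 0 l)).length + (catY l).length =
      (catX l).length + (catY (keepAux a 0 l)).length := by
  have h := trimSteps_keepAux a _ l hl 0 (Nat.zero_le _) []
  simp only [List.nil_append, List.replicate_zero] at h
  generalize keepAux a 0 l = l' at h
  induction h with
  | refl => rfl
  | tail _ hs ih =>
    obtain ⟨u, w, n, -, rfl, rfl⟩ := hs
    simp only [catX_append, catY_append, catX_replicate, catY_replicate, List.length_append,
      length_strPow] at ih ⊢
    omega

theorem Profile.frag_annotate_eq_plainTile {S Q : List σ} {A Ls : List (ℕ × ℕ)} {f c : ℕ → ℕ}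
    (h : Profile S Q A Ls f c) (hq : 0 < Q.length) {i j : ℕ} (hj : j ≤ S.length)
    (hfree : ∀ u, i ≤ u → u < j → ∀ L ∈ Ls, ¬ (L.1 ≤ u ∧ u < L.2)) :
    frag (annotate S Ls f c) i j = plainTile (frag S i j) := by
  apply List.ext_getElem?
  intro u
  rw [plainTile, List.getElem?_map]
  rcases Nat.lt_or_ge (i + u) j with hu | hu
  · rw [getElem?_frag _ hu, getElem?_frag _ hu, getElem?_annotate]
    have h0 := h.free (i + u) (by omega) (hfree _ (by omega) hu)
    have h1 := (h.ed (i + u) (i + u + 1) (by omega) (by omega)).mono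
      (show _ ≤ 0 by rw [Nat.Ico_succ_singleton, Finset.sum_singleton, h0])
    have h2 := h1.length_eq
    have h3 := h.mono (i + u) (i + u + 1) (by omega) (by omega)
    rw [length_frag _ (by omega), length_infFrag hq] at h2
    have h4 : Ls.find? (fun L => decide (L.1 ≤ i + u ∧ i + u < L.2)) = none := by
      rw [List.find?_eq_none]
      intro L hL
      simpa using hfree _ (by omega) hu L hL
    have h5 : f (i + u + 1) - f (i + u) = 1 := by omega
    rw [h0, h4, h5]
  · rw [List.getElem?_eq_none, List.getElem?_eq_none] <;> simp [frag] <;> omega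

/-! ### The pieces without their overlaps, as consecutive fragments of the pattern and of the text
from `v`. -/

namespace NewPeriodicMatches

variable {N : NewPeriodicMatches σ}

/-- Right end of the part of the pattern which is covered by `P_1, …, P_i`, without the overlap
with `P_{i+1}`. -/
noncomputable def cutP (N : NewPeriodicMatches σ) (i : ℕ) : ℕ :=
  if i = 0 then 0 else if i < N.z then N.p (i + 1 : ℕ) + N.Delta else N.m

/-- Right end of the part of the text after `v` which is covered by `T_{j,1}, …, T_{j,i}`; the last
part extends to the end of the text. -/
noncomputable def cutT (N : NewPeriodicMatches σ) (j : ℤ) (v i : ℕ) : ℕ :=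
  if i = 0 then v else if i < N.z then N.t (j + (i + 1 : ℕ)) + N.Delta else N.n

theorem p_add_Delta_le (hκ : 0 < N.kappa) (hβ : 20 ≤ N.betaP) {i : ℕ} (hi : i ≤ N.z) :
    N.p i + N.Delta ≤ N.m := by
  rcases hi.lt_or_eq with h | h
  · exact (Nat.add_le_add_right (p_mono hκ hβ h le_rfl) _).trans (p_add_le hκ hβ)
  · rw [h]
    exact p_add_le hκ hβ

theorem t_add_Delta_le (hκ : 0 < N.kappa) (hβ : 20 ≤ N.betaP) {j : ℤ} (hj : j ∈ N.J) {i : ℕ}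
    (h2i : 2 ≤ i) (hi : i ≤ N.z) : N.t (j + i) + N.Delta ≤ N.n := by
  refine le_trans ?_ ((t_add_le hκ hβ hj).trans (rEnd_le_n hκ hj))
  rcases hi.lt_or_eq with h | h
  · exact Nat.add_le_add_right (t_mono hκ hβ hj h2i h le_rfl) _
  · rw [h]

theorem cutP_le (hκ : 0 < N.kappa) (hβ : 20 ≤ N.betaP) {i : ℕ} (hi : i < N.z) :
    N.cutP i ≤ N.cutP (i + 1) := by
  have hz := three_le_z hβ
  have h := p_add_le hκ hβ
  unfold cutP
  rcases Nat.eq_zero_or_pos i with h0 | h0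
  · simp [h0]
  rw [if_neg (by omega), if_pos hi, if_neg (by omega)]
  split_ifs with h1
  · have := p_mono hκ hβ (show i + 1 < i + 1 + 1 by omega) (by omega)
    omega
  · have h2 : i + 1 = N.z := by omega
    rw [h2]
    exact h

theorem cutT_le (hκ : 0 < N.kappa) (hβ : 20 ≤ N.betaP) {j : ℤ} (hj : j ∈ N.J) {v : ℕ}
    (hv : v ≤ N.r j + 3 * N.kappa) {i : ℕ} (hi : i < N.z) :
    N.cutT j v i ≤ N.cutT j v (i + 1) := by
  have hz := three_le_z hβ
  have h := t_add_le hκ hβ hj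
  have h' := rEnd_le_n hκ hj
  unfold cutT
  rcases Nat.eq_zero_or_pos i with h0 | h0
  · have h1 := t_bounds hκ hβ hj le_rfl (show 2 ≤ N.z by omega)
    have h2 := N.kappa_le_two_tau
    have h3 := N.kappa_eq
    rw [h0, if_pos rfl, if_neg (by omega), if_pos (by omega)]
    simp only [zero_add, Nat.reduceAdd]
    unfold Delta
    omega
  rw [if_neg (by omega), if_pos hi, if_neg (by omega)]
  split_ifs with h1
  · have := t_mono hκ hβ hj (show 2 ≤ i + 1 by omega) (show i + 1 < i + 1 + 1 by omega) (by omega)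
    omega
  · have h2 : i + 1 = N.z := by omega
    rw [h2]
    omega

open Classical in
/-- The sequence of pairs of annotated pieces, without their overlaps. -/
noncomputable def chunks (N : NewPeriodicMatches σ) (LP LT : List (ℕ × ℕ)) (j : ℤ) (v : ℕ)
    (X Y : List (Letter σ)) : List (Bool × (List (Letter σ) × List (Letter σ))) :=
  (List.range' 1 N.z).map fun i => (decide (N.IsPlain LP LT j i),
    (frag X (N.cutP (i - 1)) (N.cutP i), frag Y (N.cutT j v (i - 1)) (N.cutT j v i)))

variable {LP LT : List (ℕ × ℕ)} {j : ℤ} {v : ℕ} {X Y : List (Letter σ)}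

theorem catX_map_chunk (hκ : 0 < N.kappa) (hβ : 20 ≤ N.betaP) (b : ℕ → Bool)
    (Z : ℕ → List (Letter σ)) {i : ℕ} (hi : i ≤ N.z) :
    catX ((List.range' 1 i).map fun i => (b i, (frag X (N.cutP (i - 1)) (N.cutP i), Z i))) =
      frag X 0 (N.cutP i) := by
  rw [catX, List.map_map]
  exact flatten_frag X N.cutP fun u hu => cutP_le hκ hβ (by omega)

theorem catY_map_chunk (hκ : 0 < N.kappa) (hβ : 20 ≤ N.betaP) (hj : j ∈ N.J)
    (hv : v ≤ N.r j + 3 * N.kappa) (b : ℕ → Bool)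
    (Z : ℕ → List (Letter σ)) {i : ℕ} (hi : i ≤ N.z) :
    catY ((List.range' 1 i).map fun i => (b i, (Z i, frag Y (N.cutT j v (i - 1)) (N.cutT j v i)))) =
      frag Y v (N.cutT j v i) := by
  rw [catY, List.map_map]
  exact flatten_frag Y (N.cutT j v) fun u hu => cutT_le hκ hβ hj hv (by omega)

theorem catX_chunks (hκ : 0 < N.kappa) (hβ : 20 ≤ N.betaP) :
    catX (N.chunks LP LT j v X Y) = frag X 0 N.m := by
  have hz := three_le_z hβ
  rw [chunks, catX_map_chunk hκ hβ _ _ le_rfl, cutP, if_neg (by omega), if_neg (by omega)]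

theorem catY_chunks (hκ : 0 < N.kappa) (hβ : 20 ≤ N.betaP) (hj : j ∈ N.J)
    (hv : v ≤ N.r j + 3 * N.kappa) :
    catY (N.chunks LP LT j v X Y) = frag Y v N.n := by
  have hz := three_le_z hβ
  rw [chunks, catY_map_chunk hκ hβ hj hv _ _ le_rfl, cutT, if_neg (by omega), if_neg (by omega)]

/-- Boundaries of `P` deviate from multiples of `τ` by at most `d_P`, those of `T` relative to `r_j`
by `κ + d_T`, and `v` exceeds `r_j` by at most `3κ`. Together this is `5κ - k`. -/
theorem chunks_drift (hκ : 0 < N.kappa) (hβ : 20 ≤ N.betaP) (hj : j ∈ N.J) (hrv : N.r j ≤ v)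
    (hv : v ≤ N.r j + 3 * N.kappa) (hX : X.length = N.m) (hY : Y.length = N.n)
    {u w : List (Bool × (List (Letter σ) × List (Letter σ)))}
    (h : N.chunks LP LT j v X Y = u ++ w) (hw : w ≠ []) :
    (catX u).length ≤ (catY u).length + (5 * N.kappa - N.k) ∧
      (catY u).length ≤ (catX u).length + (5 * N.kappa - N.k) := by
  obtain ⟨h1, h2⟩ := take_of_map_range' h hw
  rw [h2, catX_map_chunk hκ hβ _ _ h1.le, catY_map_chunk hκ hβ hj hv _ _ h1.le]
  rcases Nat.eq_zero_or_pos u.length with h0 | h0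
  · rw [h0]
    simp [cutP, cutT, frag]
  have h3 := t_bounds hκ hβ hj (show 2 ≤ u.length + 1 by omega) (by omega)
  have h4 := p_bounds hκ hβ (show u.length + 1 ≤ N.z by omega)
  have h5 := p_add_Delta_le hκ hβ (show u.length + 1 ≤ N.z by omega)
  have h6 := t_add_Delta_le hκ hβ hj (show 2 ≤ u.length + 1 by omega) (by omega)
  have h7 := N.kappa_eq
  have h8 : N.cutP u.length = N.p (u.length + 1 : ℕ) + N.Delta := by
    rw [cutP, if_neg (by omega), if_pos h1]
  have h9 : N.cutT j v u.length = N.t (j + (u.length + 1 : ℕ)) + N.Delta := by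
    rw [cutT, if_neg (by omega), if_pos h1]
  rw [h8, h9, length_frag _ (by omega), length_frag _ (by omega)]
  have h10 := N.kappa_le_two_tau
  have h11 : 2 * N.tau ≤ (u.length + 1) * N.tau := Nat.mul_le_mul_right _ (by omega)
  unfold Delta
  omega

theorem chunks_plain (hκ : 0 < N.kappa) (hβ : 20 ≤ N.betaP) (hj : j ∈ N.J)
    {f c g c' : ℕ → ℕ} (hP : Profile N.P N.Q N.AP LP f c) (hT : Profile N.T N.Q N.AT LT g c')
    {e : Bool × (List (Letter σ) × List (Letter σ))}
    (he : e ∈ N.chunks LP LT j v (annotate N.P LP f c) (annotate N.T LT g c')) (h1 : e.1 = true) :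
    e.2 = (plainTile (infFrag N.Q N.Delta (N.Delta + N.tau)),
      plainTile (infFrag N.Q N.Delta (N.Delta + N.tau))) := by
  have hq : 0 < N.Q.length := N.q_pos
  classical
  obtain ⟨i, -, rfl⟩ := List.mem_map.1 he
  obtain ⟨h1i, hiz, hRP, hRT⟩ : N.IsPlain LP LT j i := by simpa using h1
  have hcan : N.canonical.drop N.Delta = infFrag N.Q N.Delta (N.Delta + N.tau) := by
    have hl : N.canonical.length = N.tau + N.Delta := by
      rw [canonical, length_infFrag hq]; omega
    have : N.canonical.drop N.Delta = frag N.canonical N.Delta (N.tau + N.Delta) := by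
      rw [← hl, frag, List.take_length]
    rw [this, canonical, frag_infFrag hq _ _ (by omega) (by simp)]
    simp [add_comm]
  have hP1 : N.cutP (i - 1) = N.p i + N.Delta := by
    rw [cutP, if_neg (by omega), if_pos (by omega), Nat.sub_add_cancel (by omega)]
  have hP2 : N.cutP i = N.p (i + 1 : ℕ) + N.Delta := by
    rw [cutP, if_neg (by omega), if_pos (by omega)]
  have hT1 : N.cutT j v (i - 1) = N.t (j + i) + N.Delta := by
    rw [cutT, if_neg (by omega), if_pos (by omega), Nat.sub_add_cancel (by omega)]
  have hT2 : N.cutT j v i = N.t (j + (i + 1 : ℕ)) + N.Delta := by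
    rw [cutT, if_neg (by omega), if_pos (by omega)]
  have hPm := p_add_Delta_le hκ hβ (show i + 1 ≤ N.z by omega)
  have hTn := t_add_Delta_le hκ hβ hj (show 2 ≤ i + 1 by omega) (show i + 1 ≤ N.z by omega)
  have hRP' : N.pieceP i = N.canonical ∧ ∀ L ∈ LP, ¬ Meets ((L.1 : ℤ) - 13 * N.slack)
      (L.2 + 13 * N.slack) (N.p i) (N.p (i + 1) + N.Delta) := by
    constructor
    · by_contra hne
      exact hRP ⟨h1i, hiz, .inl hne⟩
    · intro L hL hM
      exact hRP ⟨h1i, hiz, .inr ⟨L, hL, hM⟩⟩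
  have hJ : N.minJ ≤ j ∧ j ≤ N.maxJ := hj
  have hRT' : N.internalT (j + i) = N.canonical ∧ ∀ L ∈ LT, ¬ Meets ((L.1 : ℤ) - 13 * N.slack)
      (L.2 + 13 * N.slack) (N.t (j + i)) (N.t (j + i + 1) + N.Delta) := by
    constructor
    · by_contra hne
      exact hRT ⟨by omega, by omega, .inl hne⟩
    · intro L hL hM
      exact hRT ⟨by omega, by omega, .inr ⟨L, hL, hM⟩⟩
  have e1 : ((i + 1 : ℕ) : ℤ) = i + 1 := by push_cast; rfl
  have e2 : j + ((i + 1 : ℕ) : ℤ) = j + i + 1 := by push_cast; ring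
  rw [Prod.mk.injEq, hP1, hP2, hT1, hT2]
  rw [e2] at hTn ⊢
  rw [e1] at hPm ⊢
  constructor
  · rw [hP.frag_annotate_eq_plainTile hq hPm, ← drop_frag, ← hcan, ← hRP'.1, pieceP,
      if_neg (by omega), if_neg (by omega)]
    intro u hu hu' L hL hLu
    exact hRP'.2 L hL ⟨u, ⟨by omega, by omega⟩, ⟨by omega, by omega⟩⟩
  · rw [hT.frag_annotate_eq_plainTile hq hTn, ← drop_frag, ← hcan, ← hRT'.1, internalT]
    intro u hu hu' L hL hLu
    exact hRT'.2 L hL ⟨u, ⟨by omega, by omega⟩, ⟨by omega, by omega⟩⟩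

/-! ### Values of the trimmed sequences -/

/-- Trimming looks only at labels, so one list of surviving indices describes both the trimmed
pieces and the trimmed chunks. The end pairs are never plain and hence always survive. -/
theorem exists_trim_indices (LP LT : List (ℕ × ℕ)) (η : ℕ) (j : ℤ) (hβ : 20 ≤ N.betaP) :
    ∃ M : List ℕ, (∀ i ∈ M, 1 < i ∧ i < N.z) ∧
      (∀ v X Y, (keepAux (2 * η + 30) 0 (N.chunks LP LT j v X Y)).map Prod.snd =
        (1 :: (M ++ [N.z])).map fun i =>
          (frag X (N.cutP (i - 1)) (N.cutP i), frag Y (N.cutT j v (i - 1)) (N.cutT j v i))) ∧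
      N.seqTrim LP LT η j = (1 :: (M ++ [N.z])).map fun i => (N.pieceP i, N.pieceT j i) := by
  classical
  have hz := three_le_z hβ
  have hr : List.range' 1 N.z = 1 :: (List.range' 2 (N.z - 2) ++ [N.z]) := by
    obtain ⟨z', hz'⟩ : ∃ z', N.z = z' + 2 := ⟨N.z - 2, by omega⟩
    rw [hz', List.range'_succ, List.range'_concat]
    simp only [Nat.reduceAdd, Nat.add_sub_cancel, one_mul, add_comm]
  have hfst : ∀ i, (i = 1 ∨ i = N.z) → decide (N.IsPlain LP LT j i) = false := by
    rintro i (h | h) <;> simp [IsPlain, h]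
  have htrim : trimAux (2 * η + 30) 0
      ((List.range' 1 N.z).map fun i => (decide (N.IsPlain LP LT j i), i)) =
      1 :: (trimAux (2 * η + 30) 0 ((List.range' 2 (N.z - 2)).map
        fun i => (decide (N.IsPlain LP LT j i), i)) ++ [N.z]) := by
    rw [hr, List.map_cons, List.map_append, List.map_singleton, hfst 1 (.inl rfl),
      hfst N.z (.inr rfl), trimAux, trimAux_concat]
  refine ⟨trimAux (2 * η + 30) 0 ((List.range' 2 (N.z - 2)).map
        fun i => (decide (N.IsPlain LP LT j i), i)), ?_, ?_, ?_⟩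
  · intro i hi
    have := mem_of_mem_trimAux hi
    rw [List.map_map, List.mem_map] at this
    obtain ⟨i', hi', rfl⟩ := this
    rw [List.mem_range'] at hi'
    simp only [Function.comp_apply]
    omega
  · intro v X Y
    rw [map_snd_keepAux, ← htrim, ← trimAux_map, List.map_map]
    rfl
  · rw [← htrim, ← trimAux_map, List.map_map]
    rfl

theorem drop_pieceP (hβ : 20 ≤ N.betaP) {i : ℕ} (h1 : 1 < i) (hi : i ≤ N.z) :
    (N.pieceP i).drop N.Delta = frag N.P (N.cutP (i - 1)) (N.cutP i) := by
  have hz := three_le_z hβ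
  have hP1 : N.cutP (i - 1) = N.p i + N.Delta := by
    rw [cutP, if_neg (by omega), if_pos (by omega), Nat.sub_add_cancel (by omega)]
  rw [hP1]
  rcases Nat.lt_or_ge i N.z with h | h
  · rw [pieceP, if_neg (by omega), if_neg (by omega), cutP, if_neg (by omega), if_pos h, drop_frag]
    push_cast
    rfl
  · have : i = N.z := by omega
    rw [pieceP, if_neg (by omega), if_pos this, cutP, if_neg (by omega), if_neg (by omega),
      drop_frag, this]

theorem pieceP_one (hκ : 0 < N.kappa) (hβ : 20 ≤ N.betaP) :
    N.pieceP 1 = frag N.P (N.cutP 0) (N.cutP 1) := by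
  have hz := three_le_z hβ
  rw [pieceP, if_pos rfl, cutP, if_pos rfl, cutP, if_neg (by omega), if_pos (by omega),
    p_zero hκ hβ]
  rfl

theorem drop_pieceT (v : ℕ) {i : ℕ} (h1 : 1 < i) (hi : i < N.z) :
    (N.pieceT j i).drop N.Delta = frag N.T (N.cutT j v (i - 1)) (N.cutT j v i) := by
  have hP1 : N.cutT j v (i - 1) = N.t (j + i) + N.Delta := by
    rw [cutT, if_neg (by omega), if_pos (by omega), Nat.sub_add_cancel (by omega)]
  rw [hP1, pieceT, if_neg (by omega), cutT, if_neg (by omega), if_neg (by omega), if_pos hi,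
    drop_frag]
  push_cast
  rw [add_assoc j]

theorem F_eq (hκ : 0 < N.kappa) (hβ : 20 ≤ N.betaP) (η : ℕ) (hX : chs X = N.P) :
    chs (catX (keepAux (2 * η + 30) 0 (N.chunks LP LT j v X Y))) = N.F LP LT η j := by
  have hz := three_le_z hβ
  obtain ⟨M, hM, h1, h2⟩ := exists_trim_indices LP LT η j hβ
  rw [F, h2, catX_eq, h1, chs_flatten]
  simp only [List.map_cons, List.map_map, val, List.flatten_cons,
    chs_frag, hX, pieceP_one hκ hβ]
  congr 2
  apply List.map_congr_left
  intro i hi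
  simp only [Function.comp_apply, chs_frag, hX]
  refine (drop_pieceP hβ ?_ ?_).symm
  · rcases List.mem_append.1 hi with h | h
    · exact (hM i h).1
    · rw [List.mem_singleton.1 h]; omega
  · rcases List.mem_append.1 hi with h | h
    · exact (hM i h).2.le
    · rw [List.mem_singleton.1 h]

/-- `G` runs from `r_j` to `r'_j`, the chunks from `v` to the end of the text. Both discrepancies
lie in the end pieces, which trimming keeps, so the two strings share the middle part `G'`. -/
theorem G_eq (hκ : 0 < N.kappa) (hβ : 20 ≤ N.betaP) (hj : j ∈ N.J) (hrv : N.r j ≤ v)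
    (hv : v ≤ N.r j + 3 * N.kappa) (η : ℕ) (hY : chs Y = N.T) :
    ∃ G', N.G LP LT η j = frag N.T (N.r j) v ++ G' ∧
      chs (catY (keepAux (2 * η + 30) 0 (N.chunks LP LT j v X Y))) =
        G' ++ frag N.T (N.rEnd j) N.n := by
  have hz := three_le_z hβ
  obtain ⟨M, hM, h1, h2⟩ := exists_trim_indices LP LT η j hβ
  have hv1 : v ≤ N.cutT j v 1 := cutT_le hκ hβ hj hv (by omega : 0 < N.z)
  have hc1 : N.cutT j v 1 = N.t (j + 2) + N.Delta := by
    rw [cutT, if_neg (by omega), if_pos (by omega)]; rfl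
  have hc0 : N.cutT j v 0 = v := by rw [cutT, if_pos rfl]
  have hcz : N.cutT j v (N.z - 1) = N.t (j + N.z) + N.Delta := by
    rw [cutT, if_neg (by omega), if_pos (by omega), Nat.sub_add_cancel (by omega)]
  have hcz' : N.cutT j v N.z = N.n := by
    rw [cutT, if_neg (by omega), if_neg (by omega)]
  have hend : frag N.T (N.t (j + N.z) + N.Delta) N.n =
      (N.pieceT j N.z).drop N.Delta ++ frag N.T (N.rEnd j) N.n := by
    rw [pieceT, if_neg (by omega), if_pos rfl, drop_frag,
      frag_append _ (t_add_le hκ hβ hj) (rEnd_le_n hκ hj)]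
  have hfirst : N.pieceT j 1 = frag N.T (N.r j) v ++ frag N.T v (N.cutT j v 1) := by
    rw [frag_append _ hrv hv1, hc1, pieceT, if_pos rfl]
  have hmid : (M.map fun i => frag N.T (N.cutT j v (i - 1)) (N.cutT j v i)) =
      (M.map fun i => (N.pieceT j i).drop N.Delta) :=
    List.map_congr_left fun i hi => (drop_pieceT v (hM i hi).1 (hM i hi).2).symm
  refine ⟨frag N.T v (N.cutT j v 1) ++ ((M.map fun i => (N.pieceT j i).drop N.Delta).flatten ++
    (N.pieceT j N.z).drop N.Delta), ?_, ?_⟩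
  · rw [G, h2]
    simp only [List.map_cons, List.map_append, List.map_nil, List.map_map, val,
      List.flatten_append, List.flatten_cons, List.flatten_nil, hfirst, List.append_nil,
      List.append_assoc]
    rfl
  · rw [catY_eq, h1, chs_flatten]
    simp only [List.map_cons, List.map_append, List.map_nil, List.map_map,
      List.flatten_append, List.flatten_cons, List.flatten_nil, List.append_nil,
      chs_frag, hY, Nat.sub_self, hc0, hcz, hcz', hend, List.append_assoc, ← hmid]
    congr 2
    simp only [Function.comp_def, chs_frag, hY]

end NewPeriodicMatches

theorem IsLockedFamily.nodup {S Q : List σ} {h : ℕ} {Ls : List (ℕ × ℕ)} (hq : 0 < Q.length)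
    (hL : IsLockedFamily S Q h Ls) : Ls.Nodup := by
  rw [List.Nodup, List.pairwise_iff_forall_sublist]
  intro L L' hs he
  have h1 := List.pairwise_iff_forall_sublist.1 (hL.pairwise hq) hs
  have h2 := hL.fragments L (hs.subset (by simp))
  rw [← he] at h1
  omega

theorem lk_frag_annotate {S : List σ} {Ls : List (ℕ × ℕ)} {f c : ℕ → ℕ}
    (hp : Ls.Pairwise fun L L' => L.2 < L'.1) (hle : ∀ L ∈ Ls, L.1 ≤ L.2) {v j a : ℕ} {L : ℕ × ℕ}
    (h : lk (frag (annotate S Ls f c) v j) a = some L) :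
    L ∈ Ls ∧ L.1 ≤ v + a ∧ v + a < L.2 := by
  rw [lk] at h
  rcases Nat.lt_or_ge (v + a) j with hj | hj
  · rw [getElem?_frag _ hj, getElem?_annotate] at h
    cases hS : S[v + a]? with
    | none => simp [hS] at h
    | some x =>
      rw [hS] at h
      exact (find_lock_eq hp hle).1 h
  · rw [List.getElem?_eq_none (by simp [frag]; omega)] at h
    simp at h

theorem Profile.cst_lock {S Q : List σ} {A Ls : List (ℕ × ℕ)} {f c : ℕ → ℕ} {h : ℕ}
    (hp : Profile S Q A Ls f c) (hLs : IsLockedFamily S Q h Ls) {L : ℕ × ℕ} (hL : L ∈ Ls) :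
    cst (frag (annotate S Ls f c) L.1 L.2) = edSub (str S L) Q := by
  have hfr := hLs.fragments L hL
  rw [cst_frag_annotate _ _ hfr.1 hfr.2, hp.lock L hL]

namespace NewPeriodicMatches

variable {N : NewPeriodicMatches σ}

theorem FreeAround.cases {LT : List (ℕ × ℕ)} {x : ℤ} (h : N.FreeAround LT x) {L : ℕ × ℕ}
    (hL : L ∈ LT) (hlt : L.1 < L.2) : (L.2 : ℤ) ≤ x - N.slack ∨ x + N.slack ≤ (L.1 : ℤ) := by
  by_contra! hcon
  have hd := N.d_pos
  have hs : N.slack = 7 * N.d := rfl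
  exact h L hL ⟨max (L.1 : ℤ) (x - N.slack), ⟨by omega, by omega⟩, ⟨by omega, by omega⟩⟩

/-! ### Weights of locked fragments at a light position -/

/-- The minimum distance between the first locked fragment of the pattern and a prefix
of `Q^∞[y ..)`. -/
noncomputable def firstWeight (N : NewPeriodicMatches σ) (L₀ : ℕ × ℕ) (y : ℕ) : ℕ :=
  edPrefix (str N.P L₀) (rot^[((-(y : ℤ)) % N.Q.length).toNat] N.Q)

noncomputable def weightP (N : NewPeriodicMatches σ) (L₀ : ℕ × ℕ) (y : ℕ) (L : ℕ × ℕ) : ℕ :=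
  if L = L₀ then N.firstWeight L₀ y else edSub (str N.P L) N.Q

noncomputable def weightT (N : NewPeriodicMatches σ) (L : ℕ × ℕ) : ℕ := edSub (str N.T L) N.Q

def locksP (LP : List (ℕ × ℕ)) : Finset (ℕ × ℕ) := LP.toFinset.filter fun L => 0 ≤ L.1

def locksT (LT : List (ℕ × ℕ)) (v : ℕ) : Finset (ℕ × ℕ) := LT.toFinset.filter fun L => v ≤ L.1

def insideT (N : NewPeriodicMatches σ) (LT : List (ℕ × ℕ)) (v : ℕ) : Finset (ℕ × ℕ) :=
  (locksT LT v).filter fun L => L.2 ≤ v + N.m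

/-- A lower bound, up to marks, and an upper bound for the cost of an occurrence at `v`. -/
noncomputable def potential (N : NewPeriodicMatches σ) (LP LT : List (ℕ × ℕ)) (L₀ : ℕ × ℕ)
    (g : ℕ → ℕ) (v : ℕ) : ℕ :=
  ∑ L ∈ locksP LP, N.weightP L₀ (g v) L + ∑ L ∈ N.insideT LT v, N.weightT L

variable {LP LT : List (ℕ × ℕ)} {f c g c' : ℕ → ℕ} {L₀ : ℕ × ℕ} {η v : ℕ}

theorem light_le_n (hv : v ∈ N.light LP LT η) : v ≤ N.n := by
  have h1 : v + N.m ≤ N.n + N.k := hv.1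
  have h2 : N.k ≤ N.m := N.k_le
  omega

theorem sum_markPair_lt (hLP : IsLockedFamily N.P N.Q (2 * N.d) LP)
    (hLT : IsLockedFamily N.T N.Q 0 LT) (hv : v ∈ N.light LP LT η) :
    ∑ L ∈ locksP LP, ∑ L' ∈ locksT LT v, N.markPair v L L' < η := by
  refine lt_of_le_of_lt ?_ hv.2.1
  rw [mark, ← List.sum_toFinset _ (hLP.nodup N.q_pos)]
  refine (Finset.sum_le_sum_of_subset (Finset.filter_subset _ _)).trans
    (Finset.sum_le_sum fun L _ => ?_)
  rw [← List.sum_toFinset _ (hLT.nodup N.q_pos)]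
  exact Finset.sum_le_sum_of_subset (Finset.filter_subset _ _)

theorem head_fst (hLP : IsLockedFamily N.P N.Q (2 * N.d) LP) (h0 : LP.head? = some L₀) :
    L₀.1 = 0 := by
  obtain ⟨L, h1, h2⟩ := hLP.first
  rw [h0, Option.some.injEq] at h1
  rw [h1]
  exact h2.1

theorem le_or_le_of_light (hv : v ∈ N.light LP LT η) {L : ℕ × ℕ} (hL : L ∈ LT) :
    v ≤ L.1 ∨ L.2 ≤ v := by
  have hd := N.d_pos
  have hs : N.slack = 7 * N.d := rfl
  rcases Nat.lt_or_ge L.1 L.2 with h | h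
  · rcases hv.2.2.1.cases hL h with h | h <;> omega
  · omega

theorem lt_or_le_of_light (hv : v ∈ N.light LP LT η) {L : ℕ × ℕ} (hL : L ∈ LT) {u : ℕ}
    (h1 : L.1 ≤ u) (h2 : u < L.2) : L.2 + N.slack ≤ v + N.m ∨ v + N.m + N.slack ≤ L.1 := by
  rcases hv.2.2.2.1.cases hL (by omega) with h | h <;> omega

theorem sideP (hP : Profile N.P N.Q N.AP LP f c) (hLP : IsLockedFamily N.P N.Q (2 * N.d) LP)
    (h0 : LP.head? = some L₀) :
    Side N.Q (f 0) (locksP LP) (fun L => frag (annotate N.P LP f c) L.1 L.2) (· = L₀)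
      (frag (annotate N.P LP f c) 0 N.m) :=
  hP.side (hLP.pairwise N.q_pos) hLP.fragments _ (fun L hL => by rw [hL, head_fst hLP h0])
    fun _ _ => .inl (Nat.zero_le _)

theorem sideT (hT : Profile N.T N.Q N.AT LT g c') (hLT : IsLockedFamily N.T N.Q 0 LT)
    (hv : v ∈ N.light LP LT η) :
    Side N.Q (g v) (locksT LT v) (fun L => frag (annotate N.T LT g c') L.1 L.2) (fun _ => False)
      (frag (annotate N.T LT g c') v N.n) :=
  hT.side (hLT.pairwise N.q_pos) hLT.fragments _ (fun _ hL => hL.elim)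
    fun _ hL => le_or_le_of_light hv hL

theorem setting_of_light (hP : Profile N.P N.Q N.AP LP f c) (hT : Profile N.T N.Q N.AT LT g c')
    (hLP : IsLockedFamily N.P N.Q (2 * N.d) LP) (hLT : IsLockedFamily N.T N.Q 0 LT)
    (h0 : LP.head? = some L₀) (hv : v ∈ N.light LP LT η) :
    Setting N.Q N.k (f 0) (g v) (locksP LP) (locksT LT v) (N.insideT LT v)
      (fun L => frag (annotate N.P LP f c) L.1 L.2) (fun L => frag (annotate N.T LT g c') L.1 L.2)
      L₀ (N.weightP L₀ (g v)) N.weightT (N.markPair v)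
      (frag (annotate N.P LP f c) 0 N.m) (frag (annotate N.T LT g c') v N.n) where
  left := sideP hP hLP h0
  right := sideT hT hLT hv
  near a b L L' hL hL' hab hba := by
    obtain ⟨h1, h2, h3⟩ := lk_frag_annotate (hLP.pairwise N.q_pos)
      (fun L hL => (hLP.fragments L hL).1) hL
    obtain ⟨h4, h5, h6⟩ := lk_frag_annotate (hLT.pairwise N.q_pos)
      (fun L hL => (hLT.fragments L hL).1) hL'
    have hs : N.slack = 7 * N.d := rfl
    have hk := N.two_k_le
    -- Positions at distance at most `k ≤ d/2` are well within the slack `7d` of the mark interval.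
    rw [markPair, if_pos (by omega)]
    split_ifs with h7
    · exact .inr le_rfl
    · have h8 : L ≠ L₀ := fun h => h7 (by rw [h, head_fst hLP h0])
      rw [weightP, if_neg h8, weightT]
      rcases le_total (edSub (str N.T L') N.Q) (edSub (str N.P L) N.Q) with h9 | h9
      · exact .inr (le_min le_rfl h9)
      · exact .inl ⟨h8, le_min h9 le_rfl⟩
  inside L' hL' b hb := by
    obtain ⟨h4, h5, h6⟩ := lk_frag_annotate (hLT.pairwise N.q_pos)
      (fun L hL => (hLT.fragments L hL).1) hb
    have hs : N.slack = 7 * N.d := rfl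
    have hk := N.two_k_le
    have hd := N.d_pos
    have h7 := (Finset.mem_filter.1 hL').2
    have h8 : (annotate N.P LP f c).length = N.m := length_annotate ..
    rw [length_frag _ (by omega)]
    have := lt_or_le_of_light hv h4 h5 h6
    omega

theorem weights_of_light (hP : Profile N.P N.Q N.AP LP f c) (hT : Profile N.T N.Q N.AT LT g c')
    (hLP : IsLockedFamily N.P N.Q (2 * N.d) LP) (hLT : IsLockedFamily N.T N.Q 0 LT)
    (h0 : LP.head? = some L₀) (v : ℕ) :
    Weights N.Q (g v) (locksP LP) (locksT LT v) (N.insideT LT v)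
      (fun L => frag (annotate N.P LP f c) L.1 L.2) (fun L => frag (annotate N.T LT g c') L.1 L.2)
      L₀ (N.weightP L₀ (g v)) N.weightT where
  memL := Finset.mem_filter.2 ⟨List.mem_toFinset.2 (List.mem_of_head? h0), Nat.zero_le _⟩
  sub := Finset.filter_subset _ _
  costW L hL hne := by
    rw [hP.cst_lock hLP (List.mem_toFinset.1 (Finset.mem_filter.1 hL).1), weightP, if_neg hne]
  leW L hL hne := by
    rw [chs_frag, chs_annotate, weightP, if_neg hne, str]
  leW0 j b hj h := by
    have hq : 0 < N.Q.length := N.q_pos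
    rw [chs_frag, chs_annotate] at h
    rw [weightP, if_pos rfl, firstWeight]
    have hq' : (0 : ℤ) < N.Q.length := by omega
    have h1 := Int.emod_nonneg (-(g v : ℤ)) hq'.ne'
    refine edPrefix_le (j := (j - g v).toNat) ?_
    rw [infFrag_rot hq, infFrag_eq_of_dvd hq (i := g v) (j := j)]
    · exact h
    · rw [Int.toNat_of_nonneg h1]
      have h3 : (0 : ℤ) - -(g v : ℤ) % N.Q.length - g v =
        -(g v : ℤ) - -(g v : ℤ) % N.Q.length := by ring
      rw [h3]
      exact Int.dvd_self_sub_emod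
    · omega
  costW' L hL := (hT.cst_lock hLT (List.mem_toFinset.1 (Finset.mem_filter.1 hL).1)).le
  leW' L hL := by
    rw [chs_frag, chs_annotate, weightT, str]

end NewPeriodicMatches

theorem frag_sublist_frag {X : List σ} {i i' j j' : ℕ} (h : i' ≤ i) (hij : i ≤ j) (hj : j ≤ j') :
    (frag X i j).Sublist (frag X i' j') := by
  rw [← frag_append X (h.trans hij) hj, ← frag_append X h hij]
  exact (List.sublist_append_right _ _).trans (List.sublist_append_left _ _)

theorem Profile.eq_add_of_free {S Q : List σ} {A Ls : List (ℕ × ℕ)} {f c : ℕ → ℕ}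
    (h : Profile S Q A Ls f c) (hq : 0 < Q.length) {i j : ℕ} (hij : i ≤ j) (hj : j ≤ S.length)
    (hfree : ∀ u, i ≤ u → u < j → ∀ L ∈ Ls, ¬ (L.1 ≤ u ∧ u < L.2)) :
    frag S i j = infFrag Q (f i) (f j) ∧ f j = f i + (j - i) := by
  have h0 := (h.ed i j hij hj).mono (show _ ≤ 0 from (Finset.sum_eq_zero fun u hu => by
    rw [Finset.mem_Ico] at hu
    exact h.free u (by omega) (hfree u hu.1 hu.2)).le)
  have h1 := h0.length_eq
  have h2 := h.mono i j hij hj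
  rw [length_frag _ hj, length_infFrag hq] at h1
  exact ⟨h0.eq_of_zero, by omega⟩

theorem Profile.ed_edSub {S Q : List σ} {A Ls : List (ℕ × ℕ)} {f c : ℕ → ℕ} {h : ℕ}
    (hp : Profile S Q A Ls f c) (hq : 0 < Q.length) (hLs : IsLockedFamily S Q h Ls) {i j : ℕ}
    (hij : i ≤ j) (hj : j ≤ S.length) :
    Ed (frag S i j) (infFrag Q (f i) (f j)) (edSub S Q) := by
  refine (hp.ed i j hij hj).mono ?_
  rw [← cst_frag_annotate (S := S) (Ls := Ls) (f := f) i j hij hj]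
  have hs := hp.side (hLs.pairwise hq) hLs.fragments (v := 0) (fun _ => False)
    (fun _ h => h.elim) fun _ _ => .inl (Nat.zero_le _)
  refine (cst_sublist (frag_sublist_frag (Nat.zero_le i) hij hj)).trans ?_
  refine (hs.cst_le (List.Sublist.refl _) hs.mem le_rfl (W := fun L => edSub (str S L) Q)
    fun L hL => ?_).trans ?_
  · exact (hp.cst_lock hLs (List.mem_toFinset.1 (Finset.mem_filter.1 hL).1)).le
  · rw [hLs.total, ← List.sum_toFinset _ (hLs.nodup hq)]
    exact Finset.sum_le_sum_of_subset (Finset.filter_subset _ _)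

/-! ### The upper bound: an occurrence at a light position with cost equal to the potential. -/

namespace NewPeriodicMatches

variable {N : NewPeriodicMatches σ}
variable {LP LT : List (ℕ × ℕ)} {f c g c' : ℕ → ℕ} {L₀ : ℕ × ℕ} {η v : ℕ}

/-- A gap after the first locked fragment is aligned with a power of `Q`. -/
theorem dvd_of_head (hP : Profile N.P N.Q N.AP LP f c)
    (hLP : IsLockedFamily N.P N.Q (2 * N.d) LP) (h0 : LP.head? = some L₀) (hne : L₀.2 ≠ N.m) :
    N.Q.length ∣ f L₀.2 := by
  have hq : 0 < N.Q.length := N.q_pos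
  cases LP with
  | nil => simp at h0
  | cons L LP =>
    rw [List.head?_cons, Option.some.injEq] at h0
    subst h0
    cases LP with
    | nil =>
      obtain ⟨L', h1, h2⟩ := hLP.last
      rw [List.getLast?_singleton, Option.some.injEq] at h1
      rw [← h1] at h2
      exact absurd h2 hne
    | cons L' LP =>
      obtain ⟨⟨α, hα, hle, hgap⟩, -⟩ := List.isChain_cons_cons.1 hLP.gaps
      have hp := hLP.pairwise hq
      have hp' := (List.pairwise_cons.1 (List.pairwise_cons.1 hp).2).1
      have hL' := hLP.fragments L' (by simp)
      obtain ⟨h1, h2⟩ := hP.eq_add_of_free hq hle (by omega) (by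
        intro u hu hu' L'' hL''
        rw [List.mem_cons, List.mem_cons] at hL''
        rcases hL'' with rfl | rfl | h
        · omega
        · omega
        · have := hp' _ h
          omega)
      rw [hgap] at h1
      have h3 := congrArg List.length h1
      rw [length_strPow, length_infFrag hq] at h3
      have h4 : N.Q.length ≤ α * N.Q.length := Nat.le_mul_of_pos_left _ hα
      have h5 : frag (strPow N.Q α) 0 N.Q.length = N.Q := by
        obtain ⟨β, rfl⟩ : ∃ β, α = 1 + β := ⟨α - 1, by omega⟩
        rw [strPow_add, strPow_one, frag, List.take_left' rfl, List.drop_zero]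
      rw [h1, frag_infFrag hq _ _ (Nat.zero_le _) (by omega)] at h5
      have := N.primitive.dvd_of_infFrag_eq (x := f L.2) (by simpa using h5)
      exact_mod_cast this

/-- The `2d`-locked first fragment can be aligned optimally from `x` so as to end at a multiple of
`q`. The given alignment also leaves it at a multiple of `q` (`dvd_of_head`), so the rest of `P` can
be appended after a shift by whole periods. If the first fragment is all of `P`, there is no rest.
-/
theorem exists_ed_pattern (hP : Profile N.P N.Q N.AP LP f c)
    (hLP : IsLockedFamily N.P N.Q (2 * N.d) LP) (h0 : LP.head? = some L₀) (x : ℕ)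
    (hw : N.firstWeight L₀ x ≤ 2 * N.d) :
    ∃ y : ℤ, x ≤ y ∧ Ed N.P (infFrag N.Q x y) (∑ L ∈ locksP LP, N.weightP L₀ x L) := by
  have hq : 0 < N.Q.length := N.q_pos
  have hq' : (0 : ℤ) < N.Q.length := by omega
  have hL₀ := List.mem_of_head? h0
  have hfr : L₀.1 ≤ L₀.2 ∧ L₀.2 ≤ N.m := hLP.fragments L₀ hL₀
  have hfst := head_fst hLP h0
  have hmem : L₀ ∈ locksP LP :=
    Finset.mem_filter.2 ⟨List.mem_toFinset.2 hL₀, Nat.zero_le _⟩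
  obtain ⟨p, hp⟩ : ∃ p : ℕ, p = ((-(x : ℤ)) % N.Q.length).toNat := ⟨_, rfl⟩
  have hpn := Int.emod_nonneg (-(x : ℤ)) hq'.ne'
  have hpl := Int.emod_lt_of_pos (-(x : ℤ)) hq'
  have hpd : (N.Q.length : ℤ) ∣ x - -p := by
    have h1 : (x : ℤ) - -p = -(-(x : ℤ) - -(x : ℤ) % N.Q.length) := by omega
    rw [h1]
    exact (Int.dvd_self_sub_emod).neg_right
  have hw1 : N.firstWeight L₀ x = edPrefix (str N.P L₀) (rot^[p] N.Q) := by rw [hp]; rfl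
  -- the first fragment
  obtain ⟨y, hy, hEd, hcase⟩ : ∃ y : ℤ, -(p : ℤ) ≤ y ∧
      Ed (str N.P L₀) (infFrag N.Q (-p) y) (N.firstWeight L₀ x) ∧
      (L₀.2 = N.m ∨ (N.Q.length : ℤ) ∣ y) := by
    obtain ⟨L, h1, h2⟩ := hLP.first
    rw [h0, Option.some.injEq] at h1
    subst h1
    rcases h2.2 with h2 | h2
    · obtain ⟨j, hj, hjw⟩ := h2 p (by omega) (by rwa [← hw1])
      refine ⟨j * N.Q.length, hj, ?_, .inr (Dvd.intro_left _ rfl)⟩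
      rw [hw1, hjw]
      exact ed_editDist _ _
    · obtain ⟨j, hj⟩ := edPrefix_spec (str N.P L₀) (rot^[p] N.Q)
      rw [infFrag_rot hq, zero_sub, ← hw1] at hj
      exact ⟨j - p, by omega, hj, .inl (by rw [h2]; rfl)⟩
  have hmono := hP.mono L₀.2 N.m hfr.2 le_rfl
  have hrest : Ed (frag N.P L₀.2 N.m) (infFrag N.Q y (y + (f N.m - f L₀.2)))
      (∑ w ∈ Finset.Ico L₀.2 N.m, c w) := by
    rcases eq_or_ne L₀.2 N.m with h | h
    · rw [h, sub_self, add_zero, infFrag_self, frag, List.drop_eq_nil_of_le (by simp)]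
      exact Ed.refl _ _
    · have h1 := dvd_of_head hP hLP h0 h
      have h2 := hcase.resolve_left h
      rw [infFrag_eq_of_dvd hq (i := f L₀.2) (j := f N.m)]
      · exact hP.ed _ _ hfr.2 le_rfl
      · exact h2.sub (by exact_mod_cast h1)
      · ring
  have hcost : ∑ w ∈ Finset.Ico L₀.2 N.m, c w ≤
      ∑ L ∈ (locksP LP).erase L₀, N.weightP L₀ x L := by
    rw [← cst_frag_annotate (S := N.P) (Ls := LP) (f := f) _ _ hfr.2 (le_refl N.P.length)]
    refine (sideP hP hLP h0).cst_le (frag_sublist_frag (Nat.zero_le _) hfr.2 le_rfl) ?_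
      (Finset.erase_subset _ _) ?_
    · intro e he L hL
      obtain ⟨u, hu, -, -, -, -, -, hl⟩ := mem_frag_annotate he
      rw [hl] at hL
      have h1 := (find_lock_eq (hLP.pairwise hq) fun L hL => (hLP.fragments L hL).1).1 hL
      refine Finset.mem_erase.2 ⟨?_, Finset.mem_filter.2
        ⟨List.mem_toFinset.2 h1.1, Nat.zero_le _⟩⟩
      rintro rfl
      omega
    · intro L hL
      have h1 := Finset.mem_erase.1 hL
      rw [hP.cst_lock hLP (List.mem_toFinset.1 (Finset.mem_filter.1 h1.2).1), weightP,
        if_neg h1.1]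
  have hall := (hEd.append hrest).mono (c' := ∑ L ∈ locksP LP, N.weightP L₀ x L) (by
    rw [← Finset.add_sum_erase _ _ hmem]
    refine add_le_add ?_ hcost
    rw [weightP, if_pos rfl])
  rw [str, hfst, frag_append _ (Nat.zero_le _) hfr.2, infFrag_append hq hy (by omega)] at hall
  have hPe : frag N.P 0 N.m = N.P := frag_full _
  rw [hPe] at hall
  refine ⟨y + (f N.m - f L₀.2) + p + x, by omega, ?_⟩
  rwa [infFrag_eq_of_dvd hq (i := -p) (j := y + (f N.m - f L₀.2)) hpd (by ring)]

theorem sum_weightP_le (hLP : IsLockedFamily N.P N.Q (2 * N.d) LP) (h0 : LP.head? = some L₀)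
    (x : ℕ) : ∑ L ∈ locksP LP, N.weightP L₀ x L ≤ N.firstWeight L₀ x + edSub N.P N.Q := by
  have hmem : L₀ ∈ locksP LP :=
    Finset.mem_filter.2 ⟨List.mem_toFinset.2 (List.mem_of_head? h0), Nat.zero_le _⟩
  rw [← Finset.add_sum_erase _ _ hmem, weightP, if_pos rfl, hLP.total,
    ← List.sum_toFinset _ (hLP.nodup N.q_pos)]
  refine Nat.add_le_add_left ?_ _
  refine le_trans (Finset.sum_le_sum (g := fun L => edSub (str N.P L) N.Q) fun L hL => ?_)
    (Finset.sum_le_sum_of_subset ((Finset.erase_subset _ _).trans (Finset.filter_subset _ _)))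
  rw [weightP, if_neg (Finset.mem_erase.1 hL).1]

/-- No locked position of `T` is within `7d` of `v+m`, so `g` has slope one there and `w` can be
chosen with `g w = y` exactly. The locked positions in `[v .. w)` then lie in fragments inside `[v
.. v+m)`. -/
theorem exists_ed_text (hT : Profile N.T N.Q N.AT LT g c') (hLT : IsLockedFamily N.T N.Q 0 LT)
    (hlast : ∀ L, LT.getLast? = some L → L.1 < L.2) (hv : v ∈ N.light LP LT η) {y : ℤ}
    (h1 : (g v : ℤ) + N.m ≤ y + 3 * N.d) (h2 : y ≤ (g v : ℤ) + N.m + 3 * N.d) :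
    ∃ w, v ≤ w ∧ w ≤ N.n ∧ Ed (frag N.T v w) (infFrag N.Q (g v) y)
      (∑ L ∈ N.insideT LT v, N.weightT L) := by
  have hq : 0 < N.Q.length := N.q_pos
  have hd := N.d_pos
  have hs : N.slack = 7 * N.d := rfl
  have hk := N.two_k_le
  have hm := eight_mul_d_le (N := N)
  have hdT := N.dT_le
  have hvn := light_le_n hv
  -- The non-empty last fragment ends at `n` and stays away from `v+m`. It cannot lie to the left,
  -- because `v + m ≤ n + k` and `k < 7d`.
  have hn : v + N.m + N.slack ≤ N.n := by
    obtain ⟨L, h3, h4⟩ := hLT.last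
    have h5 := hlast L h3
    have h6 : v + N.m ≤ N.n + N.k := hv.1
    have h7 : L.2 = N.n := h4
    rcases lt_or_le_of_light hv (List.mem_of_getLast? h3) (u := L.2 - 1) (by omega) (by omega)
      with h | h <;> omega
  have hstep : ∀ w, v + N.m ≤ w + N.slack → w ≤ v + N.m + N.slack →
      g w = g (v + N.m - N.slack) + (w - (v + N.m - N.slack)) := by
    intro w hw hw'
    refine (hT.eq_add_of_free hq (by omega) (show w ≤ N.T.length from hw'.trans hn) ?_).2
    intro u hu hu' L hL hLu
    rcases lt_or_le_of_light hv hL hLu.1 hLu.2 with h | h <;> omega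
  have hv' := hT.mem v hvn
  have h3 := compareT hv' (hT.mem (v + N.m - N.slack) (show _ ≤ N.n by omega))
  simp only at h3
  obtain ⟨w, hw⟩ : ∃ w, w = ((v + N.m - N.slack : ℕ) + y - g (v + N.m - N.slack)).toNat :=
    ⟨_, rfl⟩
  have h4 := hstep w (by omega) (by omega)
  have h5 : (g w : ℤ) = y := by omega
  have hvw : v ≤ w := by omega
  have hwn : w ≤ N.n := by omega
  refine ⟨w, hvw, hwn, ?_⟩
  rw [← h5]
  refine (hT.ed v w hvw hwn).mono ?_
  rw [← cst_frag_annotate (S := N.T) (Ls := LT) (f := g) _ _ hvw hwn]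
  refine (sideT hT hLT hv).cst_le (frag_sublist_frag le_rfl hvw hwn) ?_
    (Finset.filter_subset _ _) fun L hL => ?_
  swap
  · have hL := (Finset.mem_filter.1 hL).1
    exact (hT.cst_lock hLT (List.mem_toFinset.1 (Finset.mem_filter.1 hL).1)).le
  intro e he L hL
  obtain ⟨u, hu, hu', -, -, -, -, hl⟩ := mem_frag_annotate he
  rw [hl] at hL
  obtain ⟨h6, h7, h8⟩ :=
    (find_lock_eq (hLT.pairwise hq) fun L hL => (hLT.fragments L hL).1).1 hL
  have h9 := lt_or_le_of_light hv h6 h7 h8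
  have h10 := le_or_le_of_light hv h6
  exact Finset.mem_filter.2 ⟨Finset.mem_filter.2 ⟨List.mem_toFinset.2 h6, by omega⟩, by omega⟩

theorem exists_ed_potential (hP : Profile N.P N.Q N.AP LP f c)
    (hT : Profile N.T N.Q N.AT LT g c') (hLP : IsLockedFamily N.P N.Q (2 * N.d) LP)
    (hLT : IsLockedFamily N.T N.Q 0 LT) (hlast : ∀ L, LT.getLast? = some L → L.1 < L.2)
    (h0 : LP.head? = some L₀) (hv : v ∈ N.light LP LT η)
    (hw : N.firstWeight L₀ (g v) ≤ 2 * N.d) :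
    ∃ w, v ≤ w ∧ w ≤ N.n ∧ Ed N.P (frag N.T v w) (N.potential LP LT L₀ g v) := by
  obtain ⟨y, hy, h1⟩ := exists_ed_pattern hP hLP h0 (g v) hw
  have h2 := sum_weightP_le hLP h0 (g v)
  have h3 := h1.length_le
  have h4 := h1.length_ge
  have h5 := N.dP_le
  have h6 : N.P.length = N.m := rfl
  rw [length_infFrag N.q_pos] at h3 h4
  -- The pattern alignment costs at most `2d + d_P ≤ 3d`, so its right end is within `3d` of `g v +
  -- m`.
  obtain ⟨w, h7, h8, h9⟩ := exists_ed_text hT hLT hlast hv (y := y) (by omega) (by omega)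
  exact ⟨w, h7, h8, h1.trans h9.symm⟩

end NewPeriodicMatches

theorem exists_mul_mem_Icc {τ : ℤ} (hτ : 0 < τ) {lo hi : ℤ} (h : lo + τ ≤ hi) :
    ∃ j : ℤ, lo ≤ j * τ ∧ j * τ ≤ hi := by
  have h1 := Int.emod_nonneg hi hτ.ne'
  have h2 := Int.emod_lt_of_pos hi hτ
  have h3 := Int.mul_ediv_add_emod hi τ
  have h4 := mul_comm τ (hi / τ)
  exact ⟨hi / τ, by omega, by omega⟩

/-! ### Choice of the index `j`, and transfer of occurrences in both directions. -/

namespace NewPeriodicMatches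

variable {N : NewPeriodicMatches σ}
variable {LP LT : List (ℕ × ℕ)} {f c g c' : ℕ → ℕ} {L₀ : ℕ × ℕ} {η v : ℕ} {j : ℤ}

/-- Going from `Q^∞[0 .. y_P)` to `P`, to `T[v .. w)`, to `Q^∞[g v .. g w)` costs at most `κ`, so
`synchronize` gives a multiple `Z` of `q` close to `g v` and `g w - y_P`. -/
theorem exists_index (hκ : 0 < N.kappa) (hT : Profile N.T N.Q N.AT LT g c')
    (hLT : IsLockedFamily N.T N.Q 0 LT) {w : ℕ} (hvw : v ≤ w) (hw : w ≤ N.n)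
    (h : Ed N.P (frag N.T v w) N.k) : ∃ j ∈ N.J, N.r j ≤ v ∧ w ≤ N.rEnd j := by
  have hq : 0 < N.Q.length := N.q_pos
  have h1 := ed_of_alignment (Q := N.Q) N.alignP
  rw [N.costP] at h1
  have h2 := (h1.symm.trans h).trans (hT.ed_edSub hq hLT hvw hw)
  have hmono := hT.mono v w hvw hw
  obtain ⟨Z, hZ, habs⟩ := N.primitive.synchronize (κ := N.kappa) (by omega) le_yP
    (h2.mono (by unfold kappa; omega))
  have hv' := hT.mem v (hvw.trans hw)
  have hw' := hT.mem w hw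
  have h3 := (bounds_of_mem_AT hv').2
  have h4 := (bounds_of_mem_AT hw').2
  have h5 := le_abs_self ((g v : ℤ) - Z)
  have h6 := neg_abs_le ((g v : ℤ) - Z)
  have h7 := le_abs_self ((g w : ℤ) - (Z + N.yP))
  have h8 := neg_abs_le ((g w : ℤ) - (Z + N.yP))
  obtain ⟨j, hj1, hj2⟩ : ∃ j : ℤ,
      max ((g w : ℤ) - N.yP - N.kappa) (N.xT - N.kappa) ≤ j * N.tau ∧
      j * N.tau ≤ min ((g v : ℤ) + N.kappa) (N.yT - N.yP + N.kappa) := by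
    -- If `τ = q`, then `Z` itself is a multiple of `τ`. Otherwise `τ ≤ κ`, and the admissible
    -- interval has length at least `κ`.
    rcases tau_eq_or_le hκ with h | h
    · obtain ⟨j, rfl⟩ := hZ
      have h9 : (N.tau : ℤ) = N.Q.length := by rw [h]; rfl
      refine ⟨j, ?_⟩
      rw [h9, mul_comm j]
      omega
    · exact exists_mul_mem_Icc (by have := tau_pos hκ; omega) (by omega)
  exact ⟨j, (mem_J hκ).2 ⟨by omega, by omega⟩, r_le hv' (by omega), le_rEnd hw' (by omega)⟩

theorem good_chunks (hκ : 0 < N.kappa) (hβ : 20 ≤ N.betaP) (hP : Profile N.P N.Q N.AP LP f c)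
    (hT : Profile N.T N.Q N.AT LT g c') (hLP : IsLockedFamily N.P N.Q (2 * N.d) LP)
    (hLT : IsLockedFamily N.T N.Q 0 LT) (h0 : LP.head? = some L₀) (hv : v ∈ N.light LP LT η)
    (hj : j ∈ N.J) (hrv : N.r j ≤ v) (hvr : v ≤ N.r j + 3 * N.kappa) :
    Good N.Q N.k (f 0) (g v) (locksP LP) (locksT LT v) (N.insideT LT v)
      (fun L => frag (annotate N.P LP f c) L.1 L.2) (fun L => frag (annotate N.T LT g c') L.1 L.2)
      L₀ (N.weightP L₀ (g v)) N.weightT (N.markPair v)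
      (infFrag N.Q N.Delta (N.Delta + N.tau)) (5 * N.kappa - N.k)
      (N.chunks LP LT j v (annotate N.P LP f c) (annotate N.T LT g c')) where
  setting := by
    rw [catX_chunks hκ hβ, catY_chunks hκ hβ hj hvr]
    exact setting_of_light hP hT hLP hLT h0 hv
  drift u w h hw :=
    chunks_drift hκ hβ hj hrv hvr (length_annotate ..) (length_annotate ..) h hw
  plain e he h := chunks_plain hκ hβ hj hP hT he h

theorem trim_chunks (hκ : 0 < N.kappa) (hβ : 20 ≤ N.betaP) (hP : Profile N.P N.Q N.AP LP f c)
    (hT : Profile N.T N.Q N.AT LT g c') (hLP : IsLockedFamily N.P N.Q (2 * N.d) LP)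
    (hLT : IsLockedFamily N.T N.Q 0 LT) (h0 : LP.head? = some L₀) (hv : v ∈ N.light LP LT η)
    (hj : j ∈ N.J) (hrv : N.r j ≤ v) (hvr : v ≤ N.r j + 3 * N.kappa) :
    (∀ b e, b ≤ N.k → Reach b e (keepAux (2 * η + 30) 0
        (N.chunks LP LT j v (annotate N.P LP f c) (annotate N.T LT g c'))) →
      N.firstWeight L₀ (g v) < N.k + η) ∧
    ∀ b e, b ≤ N.k → b ≤ N.potential LP LT L₀ g v →
      (Reach b e (N.chunks LP LT j v (annotate N.P LP f c) (annotate N.T LT g c')) ↔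
        Reach b e (keepAux (2 * η + 30) 0
          (N.chunks LP LT j v (annotate N.P LP f c) (annotate N.T LT g c')))) := by
  have hq : 0 < N.Q.length := N.q_pos
  have hτ := tau_pos hκ
  have hV : (infFrag N.Q N.Delta (N.Delta + N.tau)).length = N.tau := by
    rw [length_infFrag hq]; omega
  have hμ := sum_markPair_lt hLP hLT hv
  have hw := weights_of_light hP hT hLP hLT h0 v
  have h := (good_chunks hκ hβ hP hT hLP hLT h0 hv hj hrv hvr).trim hq (by omega)
    (by rw [hV]; exact N.q_dvd_tau)
    (by have := N.kappa_le_two_tau; have := N.kappa_eq; rw [hV]; omega)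
    (a := 2 * η + 30) (by omega) hw
  refine ⟨?_, h.2⟩
  rintro b e hb ⟨y, hy, hEd⟩
  have := h.1.setting.first_weight_le hq hw (by omega) hEd hb
  rw [weightP, if_pos rfl] at this
  omega

theorem firstWeight_le_of_lt (hηd : η ≤ N.d) (h : N.firstWeight L₀ v < N.k + η) :
    N.firstWeight L₀ v ≤ 2 * N.d := by
  have := N.two_k_le
  omega

theorem length_trim_chunks (hκ : 0 < N.kappa) (hβ : 20 ≤ N.betaP)
    (hP : Profile N.P N.Q N.AP LP f c) (hT : Profile N.T N.Q N.AT LT g c') (hj : j ∈ N.J)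
    (hv : v ≤ N.r j + 3 * N.kappa) :
    (catX (keepAux (2 * η + 30) 0
        (N.chunks LP LT j v (annotate N.P LP f c) (annotate N.T LT g c')))).length + (N.n - v) =
      N.m + (catY (keepAux (2 * η + 30) 0
        (N.chunks LP LT j v (annotate N.P LP f c) (annotate N.T LT g c')))).length := by
  have h := length_keepAux (2 * η + 30) _ fun e he h => chunks_plain (v := v) hκ hβ hj hP hT he h
  rw [catX_chunks hκ hβ, catY_chunks hκ hβ hj hv] at h
  have hlP : (annotate N.P LP f c).length = N.m := length_annotate ..
  have hlT : (annotate N.T LT g c').length = N.n := length_annotate ..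
  rw [length_frag _ hlP.ge, length_frag _ hlT.ge] at h
  exact h

/-- Trimming preserves the length difference, so `|G| - |F| = |R_j| - m ≤ 3κ - k`, and a `k`-error
occurrence adds at most `k`. This keeps the cut at `v = r_j + u` within the first piece. -/
theorem start_le (hκ : 0 < N.kappa) (hβ : 20 ≤ N.betaP)
    (hP : Profile N.P N.Q N.AP LP f c) (hT : Profile N.T N.Q N.AT LT g c') (hj : j ∈ N.J)
    {u : ℕ} (hu : u ∈ Occ N.k (N.F LP LT η j) (N.G LP LT η j)) : u ≤ 3 * N.kappa := by
  obtain ⟨w, huw, hw, hEd⟩ := hu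
  have h1 := length_trim_chunks (η := η) hκ hβ hP hT hj (v := N.r j) (by omega)
  obtain ⟨G', h2, h3⟩ := G_eq (LP := LP) (LT := LT) (X := annotate N.P LP f c)
    (Y := annotate N.T LT g c') hκ hβ hj le_rfl (by omega) η (chs_annotate ..)
  have h4 := F_eq (LP := LP) (LT := LT) (j := j) (v := N.r j) (X := annotate N.P LP f c)
    (Y := annotate N.T LT g c') hκ hβ η (chs_annotate ..)
  rw [← length_chs, ← length_chs (catY _), h3, h4] at h1
  rw [frag, List.drop_eq_nil_of_le (by simp), List.nil_append] at h2
  have h5 := rEnd_le hκ hj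
  have h6 := rEnd_le_n hκ hj
  have h7 := (editDist_le_iff.1 hEd).length_le
  obtain ⟨b, hb, -⟩ := r_mem hκ hj
  have h8 := (bounds_of_mem_AT hb).1
  rw [length_frag _ hw] at h7
  rw [← h2, List.length_append, length_frag _ (le_refl N.n)] at h1
  omega

theorem take_G (hκ : 0 < N.kappa) (hβ : 20 ≤ N.betaP) (hj : j ∈ N.J) (hrv : N.r j ≤ v)
    (hvr : v ≤ N.r j + 3 * N.kappa) (hvn : v ≤ N.n) (η : ℕ) {X Y : List (Letter σ)}
    (hY : chs Y = N.T) :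
    (N.G LP LT η j).length + N.n =
      (catY (keepAux (2 * η + 30) 0 (N.chunks LP LT j v X Y))).length + (v - N.r j) + N.rEnd j ∧
    ∀ y, y + (v - N.r j) ≤ (N.G LP LT η j).length →
      (chs (catY (keepAux (2 * η + 30) 0 (N.chunks LP LT j v X Y)))).take y =
        frag (N.G LP LT η j) (v - N.r j) (v - N.r j + y) := by
  obtain ⟨G', h1, h2⟩ := G_eq (LP := LP) (LT := LT) (X := X) (Y := Y) hκ hβ hj hrv hvr η hY
  have h3 : (frag N.T (N.r j) v).length = v - N.r j := length_frag _ hvn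
  have h4 := rEnd_le_n hκ hj
  constructor
  · rw [← length_chs (catY _), h2, h1, List.length_append, List.length_append, h3,
      length_frag _ (le_refl N.n)]
    omega
  · intro y hy
    rw [h1, List.length_append, h3] at hy
    rw [h2, h1, ← h3, List.take_append_of_le_length (by omega), frag.eq_def (_ ++ G'),
      List.take_length_add_append, List.drop_left]

/-- The trimmed occurrence bounds the first weight. If `potential ≤ k`, an occurrence exists
outright; otherwise threshold `k` is within the range where trimming is reversible. -/
theorem mem_occ_of_trim (hκ : 0 < N.kappa) (hβ : 20 ≤ N.betaP)
    (hLP : IsLockedFamily N.P N.Q (2 * N.d) LP) (hLT : IsLockedFamily N.T N.Q 0 LT)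
    (hlast : ∀ L, LT.getLast? = some L → L.1 < L.2) (hηd : η ≤ N.d) (hj : j ∈ N.J) {u : ℕ}
    (hu : u ∈ Occ N.k (N.F LP LT η j) (N.G LP LT η j)) (hv : N.r j + u ∈ N.light LP LT η) :
    N.r j + u ∈ Occ N.k N.P N.T := by
  obtain ⟨f, c, hP⟩ := exists_profile N.q_pos N.alignP N.costP hLP
  obtain ⟨g, c', hT⟩ := exists_profile N.q_pos N.alignT N.costT hLT
  obtain ⟨L₀, h0, -⟩ := hLP.first
  have h3κ := start_le hκ hβ hP hT hj hu
  obtain ⟨w, huw, hw, hEd⟩ := hu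
  rw [editDist_le_iff] at hEd
  have hvr : N.r j + u ≤ N.r j + 3 * N.kappa := by omega
  have hrv : N.r j ≤ N.r j + u := Nat.le_add_right _ _
  obtain ⟨h1, h2⟩ := trim_chunks hκ hβ hP hT hLP hLT h0 hv hj hrv hvr
  obtain ⟨h3, h4⟩ := take_G (LP := LP) (LT := LT) (X := annotate N.P LP f c)
    (Y := annotate N.T LT g c') hκ hβ hj hrv hvr (light_le_n hv) η (chs_annotate ..)
  rw [Nat.add_sub_cancel_left] at h3 h4
  have h5 := h4 (w - u) (by omega)
  have h6 := rEnd_le_n hκ hj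
  have hr : Reach N.k ((catY (keepAux (2 * η + 30) 0 (N.chunks LP LT j (N.r j + u)
      (annotate N.P LP f c) (annotate N.T LT g c')))).length - (w - u)) (keepAux (2 * η + 30) 0
      (N.chunks LP LT j (N.r j + u) (annotate N.P LP f c) (annotate N.T LT g c'))) := by
    refine ⟨w - u, by omega, ?_⟩
    rwa [h5, F_eq hκ hβ η (chs_annotate ..), Nat.add_sub_cancel' huw]
  have h7 := firstWeight_le_of_lt hηd (h1 _ _ le_rfl hr)
  rcases le_total (N.potential LP LT L₀ g (N.r j + u)) N.k with h8 | h8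
  · obtain ⟨w', h9, h10, h11⟩ := exists_ed_potential hP hT hLP hLT hlast h0 hv h7
    exact ⟨w', h9, h10, editDist_le_iff.2 (h11.mono h8)⟩
  · obtain ⟨y, hy, h9⟩ := (h2 _ _ le_rfl h8).2 hr
    have hlT : (annotate N.T LT g c').length = N.n := length_annotate ..
    have hvn := light_le_n hv
    rw [catX_chunks hκ hβ, catY_chunks hκ hβ hj hvr, chs_frag, chs_frag, chs_annotate,
      chs_annotate] at h9
    rw [catY_chunks hκ hβ hj hvr, length_frag _ hlT.ge] at hy
    have h10 : (frag N.T (N.r j + u) N.n).take y = frag N.T (N.r j + u) (N.r j + u + y) := by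
      rw [frag, List.take_drop, List.take_take, frag, Nat.min_eq_left (by omega)]
    have h11 : frag N.P 0 N.m = N.P := frag_full _
    rw [h10, h11] at h9
    exact ⟨N.r j + u + y, Nat.le_add_right _ _, show _ ≤ N.n by omega, editDist_le_iff.2 h9⟩

theorem exists_mem_trim_occ (hκ : 0 < N.kappa) (hβ : 20 ≤ N.betaP)
    (hLP : IsLockedFamily N.P N.Q (2 * N.d) LP) (hLT : IsLockedFamily N.T N.Q 0 LT)
    (hlast : ∀ L, LT.getLast? = some L → L.1 < L.2) (hηd : η ≤ N.d)
    (hocc : v ∈ Occ N.k N.P N.T) (hv : v ∈ N.light LP LT η) :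
    ∃ j ∈ N.J, ∃ u ∈ Occ N.k (N.F LP LT η j) (N.G LP LT η j), N.r j + u = v := by
  obtain ⟨f, c, hP⟩ := exists_profile N.q_pos N.alignP N.costP hLP
  obtain ⟨g, c', hT⟩ := exists_profile N.q_pos N.alignT N.costT hLT
  obtain ⟨L₀, h0, -⟩ := hLP.first
  have hvn := light_le_n hv
  have hlT : (annotate N.T LT g c').length = N.n := length_annotate ..
  have h11 : frag N.P 0 N.m = N.P := frag_full _
  have htake : ∀ w, w ≤ N.n → (frag N.T v N.n).take (w - v) = frag N.T v w := by
    intro w hw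
    rcases le_total v w with h | h
    · rw [frag, List.take_drop, List.take_take, frag, Nat.min_eq_left (by omega),
        Nat.add_sub_cancel' h]
    · rw [Nat.sub_eq_zero_of_le h, List.take_zero, frag, List.drop_eq_nil_of_le]
      rw [List.length_take]
      omega
  -- An alignment costlier than `potential` could spoil all plain tiles. In that case it is replaced
  -- by one of cost `potential`, possibly with another right end `w`.
  obtain ⟨w, b, hvw, hwn, hEd, hbk, hbU⟩ : ∃ w b, v ≤ w ∧ w ≤ N.n ∧ Ed N.P (frag N.T v w) b ∧
      b ≤ N.k ∧ b ≤ N.potential LP LT L₀ g v := by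
    obtain ⟨w, hvw, hwn, hEd⟩ := hocc
    rw [editDist_le_iff] at hEd
    have hwn : w ≤ N.n := hwn
    rcases le_total N.k (N.potential LP LT L₀ g v) with h | h
    · exact ⟨w, N.k, hvw, hwn, hEd, le_rfl, h⟩
    · have h1 := (setting_of_light hP hT hLP hLT h0 hv).first_weight_le N.q_pos
        (weights_of_light hP hT hLP hLT h0 v) (y := w - v) (c := N.k)
        (by rw [length_frag _ hlT.ge]; omega)
        (by rwa [chs_frag, chs_frag, chs_annotate, chs_annotate, h11, htake w hwn]) le_rfl
      rw [weightP, if_pos rfl] at h1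
      have hμ := sum_markPair_lt hLP hLT hv
      obtain ⟨w', h2, h3, h4⟩ := exists_ed_potential hP hT hLP hLT hlast h0 hv
        (firstWeight_le_of_lt hηd (by omega))
      exact ⟨w', _, h2, h3, h4, h, le_rfl⟩
  obtain ⟨j, hj, hrv, hwr⟩ := exists_index hκ hT hLT hvw hwn (hEd.mono hbk)
  have hvr : v ≤ N.r j + 3 * N.kappa := by
    have h1 := rEnd_le hκ hj
    have h2 := hEd.length_le
    have h3 : N.P.length = N.m := rfl
    rw [length_frag _ hwn] at h2
    omega
  obtain ⟨-, h2⟩ := trim_chunks hκ hβ hP hT hLP hLT h0 hv hj hrv hvr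
  have hr : Reach b (N.n - w) (N.chunks LP LT j v (annotate N.P LP f c)
      (annotate N.T LT g c')) := by
    refine ⟨w - v, ?_, ?_⟩
    · rw [catY_chunks hκ hβ hj hvr, length_frag _ hlT.ge]
      omega
    · rwa [catX_chunks hκ hβ, catY_chunks hκ hβ hj hvr, chs_frag, chs_frag, chs_annotate,
        chs_annotate, h11, htake w hwn]
  obtain ⟨y, hy, h5⟩ := (h2 b _ hbk hbU).1 hr
  obtain ⟨h3, h4⟩ := take_G (LP := LP) (LT := LT) (X := annotate N.P LP f c)
    (Y := annotate N.T LT g c') hκ hβ hj hrv hvr hvn η (chs_annotate ..)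
  have h6 := rEnd_le_n hκ hj
  rw [F_eq hκ hβ η (chs_annotate ..), h4 y (by omega)] at h5
  exact ⟨j, hj, v - N.r j, ⟨v - N.r j + y, Nat.le_add_right _ _, by omega,
    editDist_le_iff.2 (h5.mono hbk)⟩, by omega⟩

end NewPeriodicMatches

end PuzzleMatching

open PuzzleMatching in
theorem mainTheorem7 {σ : Type*} (N : NewPeriodicMatches σ)
    (hκ : 0 < N.kappa) (hβ : 20 ≤ N.betaP)
    (LP LT : List (ℕ × ℕ))
    (hLP : IsLockedFamily N.P N.Q (2 * N.d) LP)
    (hLT : IsLockedFamily N.T N.Q 0 LT)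
    (hLT_last : ∀ L, LT.getLast? = some L → L.1 < L.2)
    (η : ℕ) (hη : 1 ≤ η) (hηd : η ≤ N.d) :
    Occ N.k N.P N.T ∩ N.light LP LT η
        = (⋃ j ∈ N.J, (fun v => N.r j + v) '' OccDPM N.k N.Delta (N.seqTrim LP LT η j))
          ∩ N.light LP LT η ∧
    (⋃ j ∈ N.J, (fun v => N.r j + v) '' OccDPM N.k N.Delta (N.seqTrim LP LT η j))
          ∩ N.light LP LT η
        = (⋃ j ∈ N.J, (fun v => N.r j + v) '' Occ N.k (N.F LP LT η j) (N.G LP LT η j))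
          ∩ N.light LP LT η := by
  -- `F` and `G` are by definition the two values in `OccDPM` of the trimmed sequence.
  refine ⟨?_, rfl⟩
  ext v
  simp only [Set.mem_inter_iff, Set.mem_iUnion, Set.mem_image, exists_prop]
  constructor
  · rintro ⟨hocc, hv⟩
    exact ⟨NewPeriodicMatches.exists_mem_trim_occ hκ hβ hLP hLT hLT_last hηd hocc hv, hv⟩
  · rintro ⟨⟨j, hj, u, hu, rfl⟩, hv⟩
    exact ⟨NewPeriodicMatches.mem_occ_of_trim hκ hβ hLP hLT hLT_last hηd hj hu hv, hv⟩
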